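/- Let $T\subset\mathbb{R}^2$ be a (nondegenerate, open) triangle with vertices $p_1,p_2,p_3$ and edges $\gamma_1=p_2p_3$, $\gamma_2=p_3p_1$, $\gamma_3=p_1p_2$. Put $|u|_{H^2}^2=\|u_{xx}\|_{L^2}^2+2\|u_{xy}\|_{L^2}^2+\|u_{yy}\|_{L^2}^2$ and $$V^{1,1}(T)=\Big\{\varphi\in H^1(T):\int_T\varphi\,dx\,dy=0\Big\},\quad V^{1,2}(T)=\Big\{\varphi\in H^1(T):\int_{\gamma_k}\varphi\,ds=0,\ k=1,2,3\Big\},$$ $$V^2(T)=\{\varphi\in H^2(T):\varphi(p_k)=0,\ k=1,2,3\}$$ (edge integrals in the sense of traces, point values those of the continuous representative on $\overline T$). Define $$C_j(T)=\sup_{u\in V^{1,j}(T)\setminus 0}\frac{\|u\|_{L^2(T)}}{\|\nabla u\|_{L^2(T)}}\ (j=1,2),\quad C_3(T)=\sup_{u\in V^2(T)\setminus0}\frac{\|u\|_{L^2(T)}}{|u|_{H^2(T)}},\quad C_4(T)=\sup_{u\in V^2(T)\setminus0}\frac{\|\nabla u\|_{L^2(T)}}{|u|_{H^2(T)}}.$$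 Let $Q_\alpha=\operatorname{span}\{x^2+y^2,x,y,1\}$ and let $Q_\beta$ be the space of polynomials of degree at most $2$ in $x,y$. For a triangle $\tau$ with vertices $p_k$, edges $\gamma_k$ and outer unit normal $n_\tau$, and for $\varphi\in H^1(\tau)$, respectively $\varphi\in H^2(\tau)$, let $\Pi^{(\alpha)}_\tau\varphi\in Q_\alpha$, respectively $\Pi^{(\beta)}_\tau\varphi\in Q_\beta$, be determined by $$\int_{\gamma_k}\Pi^{(\alpha)}_\tau\varphi\,ds=\int_{\gamma_k}\varphi\,ds\ (k=1,2,3),\qquad \int_\tau\Pi^{(\alpha)}_\tau\varphi\,dx\,dy=\int_\tau\varphi\,dx\,dy;$$ $$\Pi^{(\beta)}_\tau\varphi(p_k)=\varphi(p_k),\qquad \int_{\gamma_k}\nabla\Pi^{(\beta)}_\tau\varphi\cdot n_\tau\,ds=\int_{\gamma_k}\nabla\varphi\cdot n_\tau\,ds\ (k=1,2,3).$$ Let $n\ge2$ be an integer, divide $T$ (by lines parallel to its edges) into $n^2$ congruent open triangles $\tau_1,\dots,\tau_{n^2}$ similar to $T$ with ratio $1/n$, put $T'=\bigcup_k\tau_k$,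 and define $\Pi^{(\alpha)}u$ and $\Pi^{(\beta)}u$ on $T'$ by $\Pi^{(\alpha)}u|_{\tau_k}=\Pi^{(\alpha)}_{\tau_k}u$ and $\Pi^{(\beta)}u|_{\tau_k}=\Pi^{(\beta)}_{\tau_k}u$. Set $$C_j^{(n)}(T)=\sup_{u\in V^{1,j}(T)\setminus 0}\frac{\|\Pi^{(\alpha)}u\|_{L^2(T')}}{\|\nabla\Pi^{(\alpha)}u\|_{L^2(T')}}\ (j=1,2),$$ $$C_3^{(n)}(T)=\sup_{u\in V^2(T)\setminus0}\frac{\|\Pi^{(\beta)}u\|_{L^2(T')}}{|\Pi^{(\beta)}u|_{H^2(T')}},\qquad C_4^{(n)}(T)=\sup_{u\in V^2(T)\setminus0}\frac{\|\nabla\Pi^{(\beta)}u\|_{L^2(T')}}{|\Pi^{(\beta)}u|_{H^2(T')}}.$$ All suprema are taken in $[0,\infty]$, with the conventions $0/0=0$ and $a/0=\infty$ for $a>0$. Then $$C_1(T)\le\sqrt{\frac{n^2}{n^2-1}}\,C_1^{(n)}(T),\qquad C_2(T)\le\sqrt{\frac{n^2}{n^2-1}}\,C_2^{(n)}(T),$$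 $$C_3(T)\le\sqrt{\frac{n^4}{n^4-1}}\,C_3^{(n)}(T),\qquad C_4(T)\le\sqrt{C_4^{(n)}(T)^2+\frac{C_2(T)^2}{n^2}}.$$ -/

import Mathlib

open MeasureTheory Filter Topology
open scoped ENNReal ContDiff

noncomputable section

namespace TriInterp

/-- The Euclidean plane with Cartesian coordinates `x 0`, `x 1`. -/
abbrev Plane := EuclideanSpace ℝ (Fin 2)

/-- Classical partial derivative in the `i`-th coordinate direction. -/
def pderiv (i : Fin 2) (f : Plane → ℝ) : Plane → ℝ :=
  fun x => fderiv ℝ f x (EuclideanSpace.single i 1)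

/-! ### Norms on a plane set `U` -/

/-- The `L²(U)` norm of a scalar function. -/
def l2Norm (U : Set Plane) (f : Plane → ℝ) : ℝ≥0∞ :=
  eLpNorm f 2 (volume.restrict U)

/-- The `L²(U)` norm of a gradient field `g = (g₀, g₁)`. -/
def gradNorm (U : Set Plane) (g : Fin 2 → Plane → ℝ) : ℝ≥0∞ :=
  (∑ i, l2Norm U (g i) ^ 2) ^ (1 / 2 : ℝ)

/-- The `H²(U)` seminorm computed from the second derivatives `h i j`; the mixed derivative is
counted twice, `‖h₀₀‖² + ‖h₀₁‖² + ‖h₁₀‖² + ‖h₁₁‖²`. -/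
def hessNorm (U : Set Plane) (h : Fin 2 → Fin 2 → Plane → ℝ) : ℝ≥0∞ :=
  (∑ i, ∑ j, l2Norm U (h i j) ^ 2) ^ (1 / 2 : ℝ)

/-! ### Sobolev functions through weak derivatives -/

/-- `g` is the weak `i`-th partial derivative of `u` on `U`. -/
def IsWeakDeriv (U : Set Plane) (i : Fin 2) (u g : Plane → ℝ) : Prop :=
  ∀ φ : Plane → ℝ, ContDiff ℝ ∞ φ → HasCompactSupport φ → tsupport φ ⊆ U →
    ∫ x in U, u x * pderiv i φ x = - ∫ x in U, g x * φ x

/-- `u ∈ H¹(U)` with weak gradient `g`. -/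
structure IsH1 (U : Set Plane) (u : Plane → ℝ) (g : Fin 2 → Plane → ℝ) : Prop where
  memLp : MemLp u 2 (volume.restrict U)
  memLp_grad : ∀ i, MemLp (g i) 2 (volume.restrict U)
  weak : ∀ i, IsWeakDeriv U i u (g i)

/-- `u ∈ H²(U)` with weak gradient `g` and weak second derivatives `h i j = ∂ⱼ∂ᵢu`. -/
structure IsH2 (U : Set Plane) (u : Plane → ℝ) (g : Fin 2 → Plane → ℝ)
    (h : Fin 2 → Fin 2 → Plane → ℝ) : Prop where
  isH1 : IsH1 U u g
  isH1_grad : ∀ i, IsH1 U (g i) (h i)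

/-! ### Boundary values -/

/-- Arc length measure on the segment from `a` to `b`. -/
def edgeMeasure (a b : Plane) : Measure Plane :=
  ENNReal.ofReal (dist a b) •
    Measure.map (fun t : ℝ => AffineMap.lineMap a b t) (volume.restrict (Set.Icc (0 : ℝ) 1))

/-- `θ` is the trace on the segment `[a, b]` of the `H¹(U)` function `u` with weak gradient `g`:
it is the `L²`-limit on the segment of the restrictions of smooth functions on the plane that
converge to `u` in `H¹(U)`. -/
def IsTrace (U : Set Plane) (a b : Plane) (u : Plane → ℝ) (g : Fin 2 → Plane → ℝ)
    (θ : Plane → ℝ) : Prop :=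
  MemLp θ 2 (edgeMeasure a b) ∧
  ∃ φ : ℕ → Plane → ℝ, (∀ m, ContDiff ℝ ∞ (φ m)) ∧
    Tendsto (fun m => l2Norm U (fun x => φ m x - u x)) atTop (𝓝 0) ∧
    (∀ i, Tendsto (fun m => l2Norm U (fun x => pderiv i (φ m) x - g i x)) atTop (𝓝 0)) ∧
    Tendsto (fun m => eLpNorm (fun x => φ m x - θ x) 2 (edgeMeasure a b)) atTop (𝓝 0)

/-- The value at `x ∈ closure U` of `u` is `c`: the representative of `u` that is continuous
on the closure of `U` takes the value `c` at `x`. -/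
def HasPointValue (U : Set Plane) (u : Plane → ℝ) (x : Plane) (c : ℝ) : Prop :=
  ∃ v : Plane → ℝ, ContinuousOn v (closure U) ∧ u =ᵐ[volume.restrict U] v ∧ v x = c

/-! ### Triangles

A triangle is given by its vertices `p 0, p 1, p 2`; the edge `γ k`, opposite to `p k`, joins
`p (k + 1)` to `p (k + 2)` (indices modulo 3). -/

/-- The open triangle with vertices `p`. -/
def openTri (p : Fin 3 → Plane) : Set Plane := interior (convexHull ℝ (Set.range p))

/-- Arc length on the edge `γ k`. -/
def edge (p : Fin 3 → Plane) (k : Fin 3) : Measure Plane := edgeMeasure (p (k + 1)) (p (k + 2))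

/-- `θ` is the trace on the edge `γ k` of `u ∈ H¹` of the open triangle, with weak gradient `g`. -/
def IsEdgeTrace (p : Fin 3 → Plane) (k : Fin 3) (u : Plane → ℝ) (g : Fin 2 → Plane → ℝ)
    (θ : Plane → ℝ) : Prop :=
  IsTrace (openTri p) (p (k + 1)) (p (k + 2)) u g θ

/-- `ν` is the outer unit normal vector on the edge `γ k`. -/
def IsOuterNormal (p : Fin 3 → Plane) (k : Fin 3) (ν : Plane) : Prop :=
  ‖ν‖ = 1 ∧ inner ℝ ν (p (k + 2) - p (k + 1)) = 0 ∧ 0 < inner ℝ ν (p (k + 1) - p k)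

/-- `u ∈ V^{1,1}(T)` with weak gradient `g`. -/
def IsV11 (p : Fin 3 → Plane) (u : Plane → ℝ) (g : Fin 2 → Plane → ℝ) : Prop :=
  IsH1 (openTri p) u g ∧ ∫ x in openTri p, u x = 0

/-- `u ∈ V^{1,2}(T)` with weak gradient `g`. -/
def IsV12 (p : Fin 3 → Plane) (u : Plane → ℝ) (g : Fin 2 → Plane → ℝ) : Prop :=
  IsH1 (openTri p) u g ∧
    ∀ k, ∃ θ, IsEdgeTrace p k u g θ ∧ ∫ x, θ x ∂(edge p k) = 0

/-- `u ∈ V²(T)` with weak gradient `g` and weak second derivatives `h`. -/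
def IsV2 (p : Fin 3 → Plane) (u : Plane → ℝ) (g : Fin 2 → Plane → ℝ)
    (h : Fin 2 → Fin 2 → Plane → ℝ) : Prop :=
  IsH2 (openTri p) u g h ∧ ∀ k, HasPointValue (openTri p) u (p k) 0

/-- `u` is not the zero element of `L²` of the open triangle. -/
def NonzeroOn (p : Fin 3 → Plane) (u : Plane → ℝ) : Prop :=
  ¬ u =ᵐ[volume.restrict (openTri p)] 0

/-! ### The interpolation error constants

All quotients are taken in `[0, ∞]`, where `0 / 0 = 0` and `a / 0 = ∞` for `a ≠ 0`. -/

def C1 (p : Fin 3 → Plane) : ℝ≥0∞ :=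
  sSup {r | ∃ u g, IsV11 p u g ∧ NonzeroOn p u ∧
    r = l2Norm (openTri p) u / gradNorm (openTri p) g}

def C2 (p : Fin 3 → Plane) : ℝ≥0∞ :=
  sSup {r | ∃ u g, IsV12 p u g ∧ NonzeroOn p u ∧
    r = l2Norm (openTri p) u / gradNorm (openTri p) g}

def C3 (p : Fin 3 → Plane) : ℝ≥0∞ :=
  sSup {r | ∃ u g h, IsV2 p u g h ∧ NonzeroOn p u ∧
    r = l2Norm (openTri p) u / hessNorm (openTri p) h}

def C4 (p : Fin 3 → Plane) : ℝ≥0∞ :=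
  sSup {r | ∃ u g h, IsV2 p u g h ∧ NonzeroOn p u ∧
    r = gradNorm (openTri p) g / hessNorm (openTri p) h}

/-! ### The two quadratic interpolations on one triangle -/

/-- The space `Q_α` spanned by `x² + y², x, y, 1`. -/
def Qα : Set (Plane → ℝ) :=
  {q | ∃ a₁ a₂ a₃ a₄ : ℝ, ∀ x : Plane,
    q x = a₁ * (x 0 ^ 2 + x 1 ^ 2) + a₂ * x 0 + a₃ * x 1 + a₄}

/-- The space `Q_β` of polynomials of degree at most two. -/
def Qβ : Set (Plane → ℝ) :=
  {q | ∃ a₁ a₂ a₃ a₄ a₅ a₆ : ℝ, ∀ x : Plane,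
    q x = a₁ * x 0 ^ 2 + a₂ * (x 0 * x 1) + a₃ * x 1 ^ 2 + a₄ * x 0 + a₅ * x 1 + a₆}

/-- `q = Π^{(α)}_τ u`, for the triangle `τ` and `u ∈ H¹(τ)` with weak gradient `g`. -/
def IsInterpα (τ : Fin 3 → Plane) (u : Plane → ℝ) (g : Fin 2 → Plane → ℝ)
    (q : Plane → ℝ) : Prop :=
  q ∈ Qα ∧
  (∀ k, ∃ θ, IsEdgeTrace τ k u g θ ∧ ∫ x, q x ∂(edge τ k) = ∫ x, θ x ∂(edge τ k)) ∧
  ∫ x in openTri τ, q x = ∫ x in openTri τ, u x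

/-- `q = Π^{(β)}_τ u`, for the triangle `τ` and `u ∈ H²(τ)` with weak gradient `g` and weak
second derivatives `h`. -/
def IsInterpβ (τ : Fin 3 → Plane) (u : Plane → ℝ) (g : Fin 2 → Plane → ℝ)
    (h : Fin 2 → Fin 2 → Plane → ℝ) (q : Plane → ℝ) : Prop :=
  q ∈ Qβ ∧
  (∀ k, HasPointValue (openTri τ) u (τ k) (q (τ k))) ∧
  ∀ k, ∀ ν, IsOuterNormal τ k ν →
    ∃ θ : Fin 2 → Plane → ℝ, (∀ i, IsEdgeTrace τ k (g i) (h i) (θ i)) ∧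
      ∫ x, (∑ i, pderiv i q x * ν i) ∂(edge τ k) = ∫ x, (∑ i, θ i x * ν i) ∂(edge τ k)

/-! ### The subdivision into `n²` congruent triangles -/

/-- The lattice point `p₁ + (i/n)(p₂ - p₁) + (j/n)(p₃ - p₁)`. -/
def gridPt (p : Fin 3 → Plane) (n i j : ℕ) : Plane :=
  p 0 + ((i : ℝ) / n) • (p 1 - p 0) + ((j : ℝ) / n) • (p 2 - p 0)

/-- The `n²` small triangles, similar to `T` with ratio `1/n`: `n(n+1)/2` translated copies and
`n(n-1)/2` point-reflected copies. -/
def subtriangles (p : Fin 3 → Plane) (n : ℕ) : Set (Fin 3 → Plane) :=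
  {τ | ∃ i j : ℕ, i + j + 1 ≤ n ∧
    τ = ![gridPt p n i j, gridPt p n (i + 1) j, gridPt p n i (j + 1)]} ∪
  {τ | ∃ i j : ℕ, i + j + 2 ≤ n ∧
    τ = ![gridPt p n (i + 1) (j + 1), gridPt p n i (j + 1), gridPt p n (i + 1) j]}

/-- `T'`, the union of the open small triangles. -/
def brokenTri (p : Fin 3 → Plane) (n : ℕ) : Set Plane :=
  ⋃ τ ∈ subtriangles p n, openTri τ

/-- `w = Π^{(α)} u` on `T'`. -/
def IsPiecewiseα (p : Fin 3 → Plane) (n : ℕ) (u : Plane → ℝ) (g : Fin 2 → Plane → ℝ)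
    (w : Plane → ℝ) : Prop :=
  ∀ τ ∈ subtriangles p n, ∃ q, IsInterpα τ u g q ∧ Set.EqOn w q (openTri τ)

/-- `w = Π^{(β)} u` on `T'`. -/
def IsPiecewiseβ (p : Fin 3 → Plane) (n : ℕ) (u : Plane → ℝ) (g : Fin 2 → Plane → ℝ)
    (h : Fin 2 → Fin 2 → Plane → ℝ) (w : Plane → ℝ) : Prop :=
  ∀ τ ∈ subtriangles p n, ∃ q, IsInterpβ τ u g h q ∧ Set.EqOn w q (openTri τ)

/-! ### The discrete constants

The derivatives of the piecewise polynomial `w` are the classical ones on the open set `T'`. -/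

def C1d (p : Fin 3 → Plane) (n : ℕ) : ℝ≥0∞ :=
  sSup {r | ∃ u g w, IsV11 p u g ∧ NonzeroOn p u ∧ IsPiecewiseα p n u g w ∧
    r = l2Norm (brokenTri p n) w / gradNorm (brokenTri p n) (fun i => pderiv i w)}

def C2d (p : Fin 3 → Plane) (n : ℕ) : ℝ≥0∞ :=
  sSup {r | ∃ u g w, IsV12 p u g ∧ NonzeroOn p u ∧ IsPiecewiseα p n u g w ∧
    r = l2Norm (brokenTri p n) w / gradNorm (brokenTri p n) (fun i => pderiv i w)}

def C3d (p : Fin 3 → Plane) (n : ℕ) : ℝ≥0∞ :=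
  sSup {r | ∃ u g h w, IsV2 p u g h ∧ NonzeroOn p u ∧ IsPiecewiseβ p n u g h w ∧
    r = l2Norm (brokenTri p n) w /
      hessNorm (brokenTri p n) (fun i j => pderiv j (pderiv i w))}

def C4d (p : Fin 3 → Plane) (n : ℕ) : ℝ≥0∞ :=
  sSup {r | ∃ u g h w, IsV2 p u g h ∧ NonzeroOn p u ∧ IsPiecewiseβ p n u g h w ∧
    r = gradNorm (brokenTri p n) (fun i => pderiv i w) /
      hessNorm (brokenTri p n) (fun i j => pderiv j (pderiv i w))}

end TriInterp

end

open MeasureTheory Filter Topology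
open scoped ENNReal ContDiff

noncomputable section

namespace TriInterp

/-! ### Auxiliary facts on `L²` norms -/

/-! On each small triangle both interpolations are orthogonal projections in the energy. The
gradient of the α interpolant is the L² projection of ∇u onto the fields κ(x - x̄) + m, with x̄ the
centroid, and the Hessian of the β interpolant is the mean of the Hessian of u. Summing Pythagoras
over the small triangles gives |u|² = |Πu|² + |u - Πu|², where | | is the seminorm in the
denominator, taken piecewise. The error u - Πu lies, on each small triangle τ, in the space that
defines the constant of τ, and τ is the image of T under a homothety of ratio ±1/n. Hence ‖u - Πu‖ ≤
(C/n)|u - Πu| for C₁ and C₂, with n² instead of n for C₃. The triangle inequality and Cauchy-Schwarz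
in ℝ² give ‖u‖ ≤ D|Πu| + (C/n)|u - Πu| ≤ √(D² + C²/n²) |u| with D the discrete constant, that is C²
≤ D² + C²/n². The last term is absorbed on the left, which requires C < ∞ (`C1_ne_top`, `C2_ne_top`,
`C3_ne_top`). For C₄ nothing is absorbed: each component of ∇(u - Πu) has mean zero on every edge of
τ, so it is estimated by C₂. Edge integrals are rewritten as integrals over the triangle. The field
(x - p_k)u has no flux through the two edges meeting at p_k, and on γ_k its normal component is a
constant times u. So the integral of u over γ_k is a fixed multiple of ∫ (2u + (x - p_k)·∇u), the
functional `edgeFunctional`. In this form the edge conditions follow from the projections. For α, x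
- p_k belongs to the space of fields projected onto. For β, the Hessian error has mean zero, so the
functional of each gradient component is the same on all three edges, and the vertex values make the
resulting vector orthogonal to every edge. The discrete constants are suprema over all interpolants
of u, so existence of one is enough: `exists_interp_α`, `exists_interp_β`, glued in
`exists_piecewiseα` and `exists_piecewiseβ`. Uniqueness plays no role. The analytic input is the
density of smooth functions (`exists_smooth_approx_aux`), the Poincaré inequality on convex sets
(`exists_poincare`) and the embedding of H² into C⁰ on a triangle (`exists_continuous_rep`). These
yield traces, point values and the finiteness of the constants. -/

theorem lintegral_mul_sq_le {α : Type*} [MeasurableSpace α] {μ : Measure α} {f g : α → ℝ≥0∞}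
    (hf : AEMeasurable f μ) (hg : AEMeasurable g μ) :
    (∫⁻ x, f x * g x ∂μ) ^ 2 ≤ (∫⁻ x, f x ^ 2 ∂μ) * ∫⁻ x, g x ^ 2 ∂μ := by
  have h := ENNReal.lintegral_mul_le_Lp_mul_Lq μ Real.HolderConjugate.two_two hf hg
  have h2 := pow_le_pow_left' h 2
  have e : ∀ a : ℝ≥0∞, (a ^ (1 / 2 : ℝ)) ^ 2 = a := fun a => by
    rw [← ENNReal.rpow_natCast, ← ENNReal.rpow_mul]; norm_num
  simp only [Pi.mul_apply] at h2
  rw [mul_pow, e, e] at h2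
  simpa using h2

/-- Jensen's inequality for a weight of mass at most one: Cauchy-Schwarz applied to f√k and √k. -/
theorem lintegral_mul_sq_le_of_weight {α : Type*} [MeasurableSpace α] {μ : Measure α}
    {f k : α → ℝ≥0∞} (hf : AEMeasurable f μ) (hk : AEMeasurable k μ) (h1 : ∫⁻ x, k x ∂μ ≤ 1) :
    (∫⁻ x, f x * k x ∂μ) ^ 2 ≤ ∫⁻ x, f x ^ 2 * k x ∂μ := by
  have hk' : AEMeasurable (fun x => k x ^ (1 / 2 : ℝ)) μ := hk.pow_const _
  have e : ∀ a : ℝ≥0∞, (a ^ (1 / 2 : ℝ)) ^ 2 = a := fun a => by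
    rw [← ENNReal.rpow_natCast, ← ENNReal.rpow_mul]; norm_num
  have h := lintegral_mul_sq_le (hf.mul hk') hk'
  simp only [Pi.mul_apply, mul_pow, e, mul_assoc, ← sq] at h
  calc _ ≤ _ := h
    _ ≤ (∫⁻ x, f x ^ 2 * k x ∂μ) * 1 := by gcongr
    _ = _ := mul_one _

theorem eLpNorm_two_sq {α : Type*} [MeasurableSpace α] (μ : Measure α) (f : α → ℝ) :
    eLpNorm f 2 μ ^ 2 = ∫⁻ x, ‖f x‖ₑ ^ 2 ∂μ := by
  rw [eLpNorm_eq_lintegral_rpow_enorm_toReal (by norm_num) (by norm_num), ← ENNReal.rpow_natCast,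
    ← ENNReal.rpow_mul]
  norm_num

theorem l2Norm_sq (U : Set Plane) (f : Plane → ℝ) :
    l2Norm U f ^ 2 = ∫⁻ x in U, ‖f x‖ₑ ^ 2 := eLpNorm_two_sq _ _

theorem l2Norm_sq_eq_ofReal {U : Set Plane} {f : Plane → ℝ}
    (hf : MemLp f 2 (volume.restrict U)) :
    l2Norm U f ^ 2 = ENNReal.ofReal (∫ x in U, f x ^ 2) := by
  rw [l2Norm_sq, ofReal_integral_eq_lintegral_ofReal hf.integrable_sq
    (ae_of_all _ fun x => sq_nonneg _)]
  refine lintegral_congr fun x => ?_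
  rw [Real.enorm_eq_ofReal_abs, ← ENNReal.ofReal_pow (abs_nonneg _), sq_abs]

theorem rpow_half_sq (a : ℝ≥0∞) : (a ^ (1 / 2 : ℝ)) ^ 2 = a := by
  rw [← ENNReal.rpow_natCast, ← ENNReal.rpow_mul]; norm_num

theorem gradNorm_sq (U : Set Plane) (g : Fin 2 → Plane → ℝ) :
    gradNorm U g ^ 2 = ∑ i, l2Norm U (g i) ^ 2 := rpow_half_sq _

theorem hessNorm_sq (U : Set Plane) (h : Fin 2 → Fin 2 → Plane → ℝ) :
    hessNorm U h ^ 2 = ∑ i, ∑ j, l2Norm U (h i j) ^ 2 := rpow_half_sq _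

theorem sq_le_sq_iff_ennreal {a b : ℝ≥0∞} : a ^ 2 ≤ b ^ 2 ↔ a ≤ b :=
  ENNReal.pow_le_pow_left_iff (by norm_num)

theorem hessNorm_sq_eq (U : Set Plane) (h : Fin 2 → Fin 2 → Plane → ℝ) :
    hessNorm U h ^ 2 = ∑ i, gradNorm U (h i) ^ 2 := by
  simp only [hessNorm_sq, gradNorm_sq]

theorem l2Norm_le_gradNorm (U : Set Plane) (g : Fin 2 → Plane → ℝ) (i : Fin 2) :
    l2Norm U (g i) ≤ gradNorm U g := by
  rw [← sq_le_sq_iff_ennreal, gradNorm_sq]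
  exact Finset.single_le_sum (f := fun i => l2Norm U (g i) ^ 2) (fun _ _ => zero_le) (Finset.mem_univ i)

theorem gradNorm_le_hessNorm (U : Set Plane) (h : Fin 2 → Fin 2 → Plane → ℝ) (i : Fin 2) :
    gradNorm U (h i) ≤ hessNorm U h := by
  rw [← sq_le_sq_iff_ennreal, hessNorm_sq_eq]
  exact Finset.single_le_sum (f := fun i => gradNorm U (h i) ^ 2) (fun _ _ => zero_le) (Finset.mem_univ i)

theorem gradNorm_ne_top {U : Set Plane} {g : Fin 2 → Plane → ℝ}
    (hg : ∀ i, MemLp (g i) 2 (volume.restrict U)) : gradNorm U g ≠ ⊤ :=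
  ENNReal.rpow_ne_top_of_nonneg (by norm_num)
    (ENNReal.sum_ne_top.2 fun i _ => ENNReal.pow_ne_top (hg i).eLpNorm_lt_top.ne)

/-! ### Homotheties -/

theorem measurableEmbedding_homothety (q : Plane) {c : ℝ} (hc : c ≠ 0) :
    MeasurableEmbedding (fun x : Plane => q + c • x) :=
  ((Homeomorph.smulOfNeZero c hc).trans (Homeomorph.addLeft q)).measurableEmbedding

theorem map_homothety (q : Plane) {c : ℝ} (hc : c ≠ 0) :
    Measure.map (fun x : Plane => q + c • x) volume = ENNReal.ofReal (c⁻¹ ^ 2) • volume := by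
  have h1 : Measure.map (fun x : Plane => c • x) volume = ENNReal.ofReal (c⁻¹ ^ 2) • volume := by
    rw [Measure.map_addHaar_smul _ hc]
    simp
  have : (fun x : Plane => q + c • x) = (fun y => q + y) ∘ (fun x : Plane => c • x) := rfl
  rw [this, ← Measure.map_map (by fun_prop) (by fun_prop), h1, Measure.map_smul, map_add_left_eq_self]

theorem lintegral_homothety (q : Plane) {c : ℝ} (hc : c ≠ 0) (f : Plane → ℝ≥0∞) :
    ∫⁻ x, f (q + c • x) = ENNReal.ofReal (c⁻¹ ^ 2) * ∫⁻ x, f x := by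
  rw [← (measurableEmbedding_homothety q hc).lintegral_map, map_homothety q hc,
    lintegral_smul_measure, smul_eq_mul]

/-! ### Density of smooth functions -/

/-- The function `F`, dilated about `c` by the factor `1 - ε` and mollified with the kernel `k`. -/
def dilMollify (c : Plane) (ε : ℝ) (k F : Plane → ℝ) (x : Plane) : ℝ :=
  convolution F k (ContinuousLinearMap.mul ℝ ℝ) volume (c + (1 - ε) • (x - c))

theorem dilMollify_apply (c : Plane) (ε : ℝ) (k F : Plane → ℝ) (x : Plane) :
    dilMollify c ε k F x = ∫ w, F w * k (c + (1 - ε) • (x - c) - w) := rfl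

theorem contDiff_dilMollify (c : Plane) (ε : ℝ) {k F : Plane → ℝ} (hk : ContDiff ℝ ∞ k)
    (hks : HasCompactSupport k) (hF : LocallyIntegrable F volume) :
    ContDiff ℝ ∞ (dilMollify c ε k F) := by
  have h := hks.contDiff_convolution_right (n := ⊤) (ContinuousLinearMap.mul ℝ ℝ) hF hk
  exact h.comp (by fun_prop)

theorem pderiv_dilMollify_eq_integral (c : Plane) (ε : ℝ) {k F : Plane → ℝ} (hk : ContDiff ℝ ∞ k)
    (hks : HasCompactSupport k) (hF : LocallyIntegrable F volume) (i : Fin 2) (x : Plane) :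
    pderiv i (dilMollify c ε k F) x =
      (1 - ε) * ∫ w, F w * pderiv i k (c + (1 - ε) • (x - c) - w) := by
  have h := hks.hasFDerivAt_convolution_right (ContinuousLinearMap.mul ℝ ℝ) hF (hk.of_le (by simp))
    (c + (1 - ε) • (x - c))
  have hd : HasFDerivAt (fun x : Plane => c + (1 - ε) • (x - c))
      ((1 - ε) • ContinuousLinearMap.id ℝ Plane) x := by
    exact (((hasFDerivAt_id (𝕜 := ℝ) x).sub_const c).const_smul (1 - ε)).const_add c
  have hc := h.comp x hd
  rw [pderiv, show dilMollify c ε k F = (convolution F k (ContinuousLinearMap.mul ℝ ℝ) volume) ∘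
      (fun x : Plane => c + (1 - ε) • (x - c)) from rfl, hc.fderiv]
  simp only [ContinuousLinearMap.comp_smul, ContinuousLinearMap.comp_id,
    _root_.smul_apply, smul_eq_mul]
  congr 1
  rw [convolution_precompR_apply (ContinuousLinearMap.mul ℝ ℝ) hF
    (hks.fderiv (𝕜 := ℝ)) (hk.continuous_fderiv (by simp))]
  rfl

theorem pderiv_comp_sub_left (i : Fin 2) {k : Plane → ℝ} (hk : ContDiff ℝ ∞ k) (z w : Plane) :
    pderiv i (fun y => k (z - y)) w = - pderiv i k (z - w) := by
  have h := ((hk.differentiable (by simp)) (z - w)).hasFDerivAt.comp w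
    ((hasFDerivAt_id (𝕜 := ℝ) w).const_sub z)
  rw [pderiv, show (fun y => k (z - y)) = k ∘ (HSub.hSub z) from rfl, h.fderiv]
  simp [pderiv]

/-- As long as the ball of radius r about the dilated point lies in U, the function w ↦ k(z - w) is
an admissible test function, so the derivative on the kernel moves onto u. The factor 1 - ε is the
chain rule for the dilation. -/
theorem pderiv_dilMollify {U : Set Plane} {c : Plane} {ε r : ℝ} {k u g : Plane → ℝ} {i : Fin 2}
    (hU : MeasurableSet U) (hk : ContDiff ℝ ∞ k) (hks : tsupport k ⊆ Metric.closedBall 0 r)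
    (hu : IntegrableOn u U) (hw : IsWeakDeriv U i u g) {x : Plane}
    (hx : Metric.closedBall (c + (1 - ε) • (x - c)) r ⊆ U) :
    pderiv i (dilMollify c ε k (U.indicator u)) x =
      (1 - ε) * dilMollify c ε k (U.indicator g) x := by
  have hkc : HasCompactSupport k :=
    HasCompactSupport.of_support_subset_isCompact (isCompact_closedBall 0 r)
      ((subset_tsupport k).trans hks)
  rw [pderiv_dilMollify_eq_integral c ε hk hkc
    ((integrable_indicator_iff hU).2 hu).locallyIntegrable, dilMollify_apply]
  congr 1
  set z := c + (1 - ε) • (x - c)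
  have key := hw (fun w => k (z - w)) (by fun_prop)
    (hkc.comp_homeomorph (Homeomorph.subLeft z)) (by
      refine subset_trans ?_ hx
      refine closure_minimal ?_ Metric.isClosed_closedBall
      intro w hw
      have := hks (subset_tsupport k hw)
      simpa [dist_eq_norm, norm_sub_rev] using this)
  simp only [pderiv_comp_sub_left _ hk, mul_neg, integral_neg, neg_inj] at key
  have e : ∀ (f m : Plane → ℝ), ∫ w, U.indicator f w * m w = ∫ w in U, f w * m w := by
    intro f m
    rw [← integral_indicator hU]
    congr 1; ext w
    by_cases h : w ∈ U <;> simp [h]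
  rw [e, e, key]

/-- Jensen with the probability density k(z - ·), then Tonelli. The inner integral over x is that of
k under a homothety of ratio 1 - ε, whence (1 - ε)⁻² for the squared norms. -/
theorem eLpNorm_dilMollify_le (c : Plane) {ε : ℝ} (hε : ε < 1) {k F : Plane → ℝ}
    (hk : Continuous k) (hk0 : ∀ x, 0 ≤ k x) (hk1 : ∫⁻ x, ENNReal.ofReal (k x) = 1)
    (hF : AEStronglyMeasurable F volume) :
    eLpNorm (dilMollify c ε k F) 2 volume ≤ ENNReal.ofReal ((1 - ε)⁻¹) * eLpNorm F 2 volume := by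
  have hε' : (1 - ε) ≠ 0 := by linarith
  rw [← sq_le_sq_iff_ennreal, mul_pow, eLpNorm_two_sq, eLpNorm_two_sq,
    ← ENNReal.ofReal_pow (by rw [inv_nonneg]; linarith)]
  have hkm : Measurable fun x => ENNReal.ofReal (k x) := by fun_prop
  have hz : ∀ x : Plane, c + (1 - ε) • (x - c) = (c - (1 - ε) • c) + (1 - ε) • x := fun x => by
    rw [smul_sub]; abel
  have h1 : ∀ x, ‖dilMollify c ε k F x‖ₑ ^ 2 ≤
      ∫⁻ w, ‖F w‖ₑ ^ 2 * ENNReal.ofReal (k (c + (1 - ε) • (x - c) - w)) := by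
    intro x
    rw [dilMollify_apply]
    refine le_trans (pow_le_pow_left' (enorm_integral_le_lintegral_enorm _) 2) ?_
    have : ∀ w, ‖F w * k (c + (1 - ε) • (x - c) - w)‖ₑ =
        ‖F w‖ₑ * ENNReal.ofReal (k (c + (1 - ε) • (x - c) - w)) := fun w => by
      rw [enorm_mul, Real.enorm_of_nonneg (hk0 _)]
    simp only [this]
    refine lintegral_mul_sq_le_of_weight hF.enorm (by fun_prop) ?_
    rw [lintegral_sub_left_eq_self (fun y => ENNReal.ofReal (k y)), hk1]
  refine (lintegral_mono h1).trans ?_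
  rw [lintegral_lintegral_swap]
  · rw [← lintegral_const_mul'' _ (hF.enorm.pow_const 2)]
    refine lintegral_mono fun w => ?_
    simp only [hz, add_sub_right_comm _ _ w]
    rw [lintegral_const_mul _ (by fun_prop)]
    rw [lintegral_homothety _ hε' (fun y => ENNReal.ofReal (k y)), hk1, mul_one, mul_comm]
  · have : AEMeasurable (fun q : Plane × Plane => ‖F q.2‖ₑ ^ 2) (volume.prod volume) :=
      (hF.enorm.pow_const 2).comp_snd
    exact this.mul (by fun_prop)

theorem abs_dilMollify_sub_le (c : Plane) {ε r η : ℝ} {k h : Plane → ℝ}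
    (hk : Continuous k) (hks : tsupport k ⊆ Metric.closedBall 0 r) (hk0 : ∀ x, 0 ≤ k x)
    (hk1 : ∫ x, k x = 1) (hh : Continuous h) {x : Plane}
    (hx : ∀ w, dist w (c + (1 - ε) • (x - c)) ≤ r → |h w - h x| ≤ η) :
    |dilMollify c ε k h x - h x| ≤ η := by
  have hkc : HasCompactSupport k :=
    HasCompactSupport.of_support_subset_isCompact (isCompact_closedBall 0 r)
      ((subset_tsupport k).trans hks)
  rw [dilMollify_apply]
  set z := c + (1 - ε) • (x - c)
  have hi : ∀ f : Plane → ℝ, Continuous f → Integrable (fun w => f w * k (z - w)) := fun f hf =>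
    (hf.mul (by fun_prop)).integrable_of_hasCompactSupport
      ((hkc.comp_homeomorph (Homeomorph.subLeft z)).mul_left)
  have hk1' : ∫ w, k (z - w) = 1 := by rw [integral_sub_left_eq_self, hk1]
  have h1 : (∫ w, h w * k (z - w)) - h x = ∫ w, (h w - h x) * k (z - w) := by
    simp only [sub_mul]
    rw [integral_sub (hi _ hh) (hi _ continuous_const), integral_const_mul, hk1', mul_one]
  rw [h1, ← Real.norm_eq_abs]
  calc _ ≤ ∫ w, η * k (z - w) := by
        refine norm_integral_le_of_norm_le (hi _ continuous_const) (ae_of_all _ fun w => ?_)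
        rw [norm_mul, Real.norm_of_nonneg (hk0 _), Real.norm_eq_abs]
        by_cases hw : k (z - w) = 0
        · simp [hw]
        · refine mul_le_mul_of_nonneg_right (hx w ?_) (hk0 _)
          have := hks (subset_tsupport k hw)
          simpa [dist_eq_norm, norm_sub_rev] using this
    _ = η := by rw [integral_const_mul, hk1', mul_one]

/-- The operators are bounded on L² by 2, uniformly in m, so it suffices to treat a compactly
supported continuous h close to F. For such h uniform continuity suffices, since all points sampled
for x lie within r + εD of x. -/
theorem tendsto_l2Norm_dilMollify_sub {U : Set Plane} (hU : MeasurableSet U) (hUb : Bornology.IsBounded U) {c : Plane}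
    {ε r : ℕ → ℝ} {k : ℕ → Plane → ℝ} (hε0 : ∀ m, 0 < ε m) (hε1 : ∀ m, ε m ≤ 1 / 2)
    (hεl : Tendsto ε atTop (𝓝 0)) (hrl : Tendsto r atTop (𝓝 0))
    (hk : ∀ m, Continuous (k m)) (hks : ∀ m, tsupport (k m) ⊆ Metric.closedBall 0 (r m))
    (hk0 : ∀ m x, 0 ≤ k m x) (hk1 : ∀ m, ∫ x, k m x = 1) {F : Plane → ℝ}
    (hF : MemLp F 2 volume) :
    Tendsto (fun m => l2Norm U (fun x => dilMollify c (ε m) (k m) F x - F x)) atTop (𝓝 0) := by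
  have hkc : ∀ m, HasCompactSupport (k m) := fun m =>
    HasCompactSupport.of_support_subset_isCompact (isCompact_closedBall 0 (r m))
      ((subset_tsupport (k m)).trans (hks m))
  have hk1' : ∀ m, ∫⁻ x, ENNReal.ofReal (k m x) = 1 := fun m => by
    rw [← ofReal_integral_eq_lintegral_ofReal
      ((hk m).integrable_of_hasCompactSupport (hkc m)) (ae_of_all _ (hk0 m)), hk1 m]
    simp
  have hfin : volume U ≠ ⊤ := hUb.measure_lt_top.ne
  rw [ENNReal.tendsto_atTop_zero]
  intro δ hδ
  -- The error splits as 2δ' from the smoothing of F - h, δ' from the smoothing of h, and δ' from h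
  -- - F.
  obtain ⟨δ', hδ'0, hδ'⟩ : ∃ δ' : ℝ≥0∞, δ' ≠ 0 ∧ 4 * δ' ≤ δ := by
    refine ⟨δ / 4, (ENNReal.div_pos hδ.ne' (by simp)).ne', ?_⟩
    rw [ENNReal.mul_div_cancel (by simp) (by simp)]
  obtain ⟨h, hhs, hhF, hhc, hhL⟩ := hF.exists_hasCompactSupport_eLpNorm_sub_le (by simp) hδ'0
  obtain ⟨η, hη0, hη⟩ : ∃ η : ℝ, 0 < η ∧ volume U ^ (1 / 2 : ℝ) * ENNReal.ofReal η ≤ δ' := by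
    have ht : Tendsto (fun η : ℝ => volume U ^ (1 / 2 : ℝ) * ENNReal.ofReal η) (𝓝[>] 0) (𝓝 0) := by
      have : Tendsto (fun η : ℝ => volume U ^ (1 / 2 : ℝ) * ENNReal.ofReal η) (𝓝 0)
          (𝓝 (volume U ^ (1 / 2 : ℝ) * ENNReal.ofReal 0)) := by
        refine ENNReal.Tendsto.const_mul (ENNReal.continuous_ofReal.tendsto 0) (Or.inr ?_)
        exact ENNReal.rpow_ne_top_of_nonneg (by norm_num) hfin
      simpa using this.mono_left nhdsWithin_le_nhds
    have := (ht.eventually (ge_mem_nhds (pos_iff_ne_zero.2 hδ'0))).and self_mem_nhdsWithin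
    obtain ⟨η, h1, h2⟩ := this.exists
    exact ⟨η, h2, h1⟩
  obtain ⟨κ, hκ0, hκ⟩ := Metric.uniformContinuous_iff.1
    (hhs.uniformContinuous_of_continuous hhc) η hη0
  obtain ⟨D, hD⟩ := hUb.subset_closedBall c
  have hl : Tendsto (fun m => r m + ε m * D) atTop (𝓝 (0 + 0 * D)) := hrl.add (hεl.mul_const D)
  rw [zero_mul, zero_add] at hl
  obtain ⟨N, hN⟩ := eventually_atTop.1 (hl.eventually (gt_mem_nhds hκ0))
  refine ⟨N, fun m hm => ?_⟩
  have hi : ∀ f : Plane → ℝ, MemLp f 2 volume → ∀ x : Plane,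
      Integrable (fun w => f w * k m (c + (1 - ε m) • (x - c) - w)) := fun f hf x => by
    have := MemLp.integrable_mul (p := 2) (q := 2) hf
      (((hk m).comp (continuous_const.sub continuous_id)).memLp_of_hasCompactSupport
        ((hkc m).comp_homeomorph (Homeomorph.subLeft (c + (1 - ε m) • (x - c)))) :
        MemLp (fun w => k m (c + (1 - ε m) • (x - c) - w)) 2 volume)
    exact this
  have hdec : (fun x => dilMollify c (ε m) (k m) F x - F x) = fun x =>
      (dilMollify c (ε m) (k m) (F - h) x + (dilMollify c (ε m) (k m) h x - h x)) + (h - F) x := by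
    ext x
    have : dilMollify c (ε m) (k m) (F - h) x =
        dilMollify c (ε m) (k m) F x - dilMollify c (ε m) (k m) h x := by
      simp only [dilMollify_apply, Pi.sub_apply, sub_mul]
      exact integral_sub (hi _ hF x) (hi _ hhL x)
    rw [this]
    simp
  have hcont : ∀ f : Plane → ℝ, MemLp f 2 volume → Continuous (dilMollify c (ε m) (k m) f) := by
    intro f hf
    have := (hkc m).continuous_convolution_right (ContinuousLinearMap.mul ℝ ℝ)
      (hf.locallyIntegrable (by norm_num)) (hk m)
    exact this.comp (by fun_prop : Continuous fun x : Plane => c + (1 - ε m) • (x - c))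
  have b1 : l2Norm U (dilMollify c (ε m) (k m) (F - h)) ≤ 2 * δ' := by
    calc l2Norm U (dilMollify c (ε m) (k m) (F - h))
        ≤ eLpNorm (dilMollify c (ε m) (k m) (F - h)) 2 volume :=
          eLpNorm_mono_measure _ Measure.restrict_le_self
      _ ≤ ENNReal.ofReal ((1 - ε m)⁻¹) * eLpNorm (F - h) 2 volume :=
          eLpNorm_dilMollify_le c (by linarith [hε1 m]) (hk m) (hk0 m) (hk1' m)
            (hF.1.sub hhL.1)
      _ ≤ 2 * δ' := by
          gcongr
          rw [show (2 : ℝ≥0∞) = ENNReal.ofReal 2 by simp]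
          refine ENNReal.ofReal_le_ofReal ?_
          rw [inv_le_comm₀ (by linarith [hε1 m]) (by norm_num)]
          linarith [hε1 m]
  have b2 : l2Norm U (fun x => dilMollify c (ε m) (k m) h x - h x) ≤ δ' := by
    have h3 : ∀ᵐ x ∂(volume.restrict U), ‖dilMollify c (ε m) (k m) h x - h x‖ ≤ η := by
      refine ae_restrict_of_forall_mem hU fun x hx => ?_
      refine abs_dilMollify_sub_le c (hk m) (hks m) (hk0 m) (hk1 m) hhc fun w hw => ?_
      refine (hκ (a := w) (b := x) ?_).le
      have hzx : dist (c + (1 - ε m) • (x - c)) x ≤ ε m * D := by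
        have : c + (1 - ε m) • (x - c) - x = -(ε m • (x - c)) := by
          rw [sub_smul, one_smul]; abel
        rw [dist_eq_norm, this, norm_neg, norm_smul, Real.norm_of_nonneg (hε0 m).le]
        have := hD hx
        rw [mem_closedBall_iff_norm] at this
        exact mul_le_mul_of_nonneg_left this (hε0 m).le
      calc dist w x ≤ dist w (c + (1 - ε m) • (x - c)) + dist (c + (1 - ε m) • (x - c)) x :=
            dist_triangle _ _ _
        _ ≤ r m + ε m * D := add_le_add hw hzx
        _ < κ := hN m hm
    refine (eLpNorm_le_of_ae_bound h3).trans ?_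
    simpa using hη
  have b3 : l2Norm U (h - F) ≤ δ' := by
    refine (eLpNorm_mono_measure _ Measure.restrict_le_self).trans ?_
    rw [eLpNorm_sub_comm]; exact hhF
  rw [hdec]
  refine le_trans ?_ hδ'
  calc _ ≤ _ + _ := eLpNorm_add_le
        ((hcont _ (hF.sub hhL)).aestronglyMeasurable.add
          ((hcont _ hhL).sub hhc).aestronglyMeasurable)
        (hhL.1.sub hF.1).restrict (by norm_num)
    _ ≤ (_ + _) + _ := by
        gcongr
        exact eLpNorm_add_le (hcont _ (hF.sub hhL)).aestronglyMeasurable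
          ((hcont _ hhL).sub hhc).aestronglyMeasurable (by norm_num)
    _ ≤ (2 * δ' + δ') + δ' := by gcongr <;> assumption
    _ = 4 * δ' := by ring

/-- One sequence of operators serves all functions at once. The derivative rule can therefore be
applied to u and then again to its gradient, which gives convergence of the second derivatives. -/
theorem exists_smoothing {U : Set Plane} (hUo : IsOpen U) (hUc : Convex ℝ U)
    (hUb : Bornology.IsBounded U) (hUn : U.Nonempty) :
    ∃ (M : ℕ → (Plane → ℝ) → Plane → ℝ) (s : ℕ → ℝ), Tendsto s atTop (𝓝 1) ∧
      (∀ m F, LocallyIntegrable F volume → ContDiff ℝ ∞ (M m F)) ∧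
      (∀ F, MemLp F 2 volume → Tendsto (fun m => l2Norm U (fun x => M m F x - F x)) atTop (𝓝 0)) ∧
      ∀ m u g i, IntegrableOn u U → IsWeakDeriv U i u g → ∀ x ∈ U,
        pderiv i (M m (U.indicator u)) x = s m * M m (U.indicator g) x := by
  obtain ⟨c, hc⟩ := hUn
  obtain ⟨R, hR, hRU⟩ := Metric.nhds_basis_closedBall.mem_iff.1 (hUo.mem_nhds hc)
  have hpos : ∀ m : ℕ, (0 : ℝ) < 1 / ((m : ℝ) + 2) := fun m => by positivity
  -- The outer radius is ε times the radius R of a ball about c inside U. By convexity the ball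
  -- about (1 - ε)x + εc of radius εR is contained in (1 - ε)x + εB(c, R) ⊆ U for every x in U.
  let b : ℕ → ContDiffBump (0 : Plane) := fun m =>
    ⟨1 / ((m : ℝ) + 2) * R / 2, 1 / ((m : ℝ) + 2) * R,
      by have := hpos m; positivity, by have := mul_pos (hpos m) hR; linarith⟩
  have hεl : Tendsto (fun m : ℕ => 1 / ((m : ℝ) + 2)) atTop (𝓝 0) := by
    have := (tendsto_add_atTop_iff_nat 1).2 (tendsto_one_div_add_atTop_nhds_zero_nat (𝕜 := ℝ))
    refine this.congr fun m => ?_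
    push_cast; ring
  have hts : ∀ m, tsupport ((b m).normed volume) ⊆ Metric.closedBall 0 (1 / ((m : ℝ) + 2) * R) :=
    fun m => ((b m).tsupport_normed_eq (μ := volume)).subset
  refine ⟨fun m => dilMollify c (1 / ((m : ℝ) + 2)) ((b m).normed volume),
    fun m => 1 - 1 / ((m : ℝ) + 2), ?_, ?_, ?_, ?_⟩
  · simpa using hεl.const_sub 1
  · exact fun m F hF => contDiff_dilMollify c _ (b m).contDiff_normed (b m).hasCompactSupport_normed hF
  · intro F hF
    refine tendsto_l2Norm_dilMollify_sub hUo.measurableSet hUb hpos ?_ hεl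
      (r := fun m => 1 / ((m : ℝ) + 2) * R) (by simpa using hεl.mul_const R)
      (fun m => (b m).continuous_normed) hts (fun m x => (b m).nonneg_normed x)
      (fun m => (b m).integral_normed) hF
    intro m
    exact one_div_le_one_div_of_le (by norm_num) (by linarith [(Nat.cast_nonneg m : (0 : ℝ) ≤ m)])
  · intro m u g i hu hw x hx
    refine pderiv_dilMollify hUo.measurableSet (b m).contDiff_normed (hts m) hu hw ?_
    intro w hw
    set ε := 1 / ((m : ℝ) + 2)
    have hε : 0 < ε := hpos m
    have hε1 : ε ≤ 1 :=
      (div_le_one (by positivity)).2 (by linarith [(Nat.cast_nonneg m : (0 : ℝ) ≤ m)])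
    have hy : c + ε⁻¹ • (w - (c + (1 - ε) • (x - c))) ∈ U := by
      apply hRU
      rw [mem_closedBall_iff_norm, add_sub_cancel_left, norm_smul, norm_inv,
        Real.norm_of_nonneg hε.le, inv_mul_le_iff₀ hε]
      exact mem_closedBall_iff_norm.1 hw
    have := hUc hx hy (sub_nonneg.2 hε1) hε.le (by ring)
    convert this using 1
    rw [smul_add, smul_inv_smul₀ hε.ne']
    module

/-! ### Simultaneous approximation of a function and its weak derivatives -/

theorem l2Norm_congr {U : Set Plane} (hU : MeasurableSet U) {f f' : Plane → ℝ}
    (h : Set.EqOn f f' U) : l2Norm U f = l2Norm U f' :=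
  eLpNorm_congr_ae (ae_restrict_of_forall_mem hU h)

theorem tendsto_l2Norm_mul_sub {U : Set Plane} {s : ℕ → ℝ} (hs : Tendsto s atTop (𝓝 1))
    {φ : ℕ → Plane → ℝ} {f : Plane → ℝ} (hφ : ∀ m, AEStronglyMeasurable (φ m) (volume.restrict U))
    (hf : MemLp f 2 (volume.restrict U))
    (h : Tendsto (fun m => l2Norm U (fun x => φ m x - f x)) atTop (𝓝 0)) :
    Tendsto (fun m => l2Norm U (fun x => s m * φ m x - f x)) atTop (𝓝 0) := by
  have h1 : Tendsto (fun m => ‖s m‖ₑ * l2Norm U (fun x => φ m x - f x) + ‖s m - 1‖ₑ * l2Norm U f)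
      atTop (𝓝 (‖(1 : ℝ)‖ₑ * 0 + ‖(1 : ℝ) - 1‖ₑ * l2Norm U f)) := by
    refine Tendsto.add (ENNReal.Tendsto.mul ((continuous_enorm.tendsto _).comp hs) (by simp) h
      (by simp)) (ENNReal.Tendsto.mul_const ((continuous_enorm.tendsto _).comp (hs.sub_const 1))
        (Or.inr hf.eLpNorm_lt_top.ne))
  simp only [mul_zero, sub_self, enorm_zero, zero_mul, add_zero] at h1
  refine tendsto_of_tendsto_of_tendsto_of_le_of_le tendsto_const_nhds h1 (fun _ => zero_le)
    fun m => ?_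
  have : (fun x => s m * φ m x - f x) = (s m • fun x => φ m x - f x) + (s m - 1) • f := by
    ext x; simp; ring
  rw [l2Norm, this]
  refine (eLpNorm_add_le (((hφ m).sub hf.1).const_smul _) (hf.1.const_smul _) (by norm_num)).trans ?_
  rw [eLpNorm_const_smul, eLpNorm_const_smul]
  rfl

/-- The H² clause is conditional on the gradient being in H¹, so that the same sequence proves
density in H¹ and in H². -/
theorem exists_smooth_approx_aux {U : Set Plane} (hUo : IsOpen U) (hUc : Convex ℝ U)
    (hUb : Bornology.IsBounded U) (hUn : U.Nonempty) {u : Plane → ℝ} {g : Fin 2 → Plane → ℝ}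
    (hu : IsH1 U u g) :
    ∃ φ : ℕ → Plane → ℝ, (∀ m, ContDiff ℝ ∞ (φ m)) ∧
      Tendsto (fun m => l2Norm U (fun x => φ m x - u x)) atTop (𝓝 0) ∧
      (∀ i, Tendsto (fun m => l2Norm U (fun x => pderiv i (φ m) x - g i x)) atTop (𝓝 0)) ∧
      ∀ h : Fin 2 → Fin 2 → Plane → ℝ, (∀ i, IsH1 U (g i) (h i)) →
        ∀ i j, Tendsto (fun m => l2Norm U (fun x => pderiv j (pderiv i (φ m)) x - h i j x))
          atTop (𝓝 0) := by
  obtain ⟨M, s, hs, hM, hL, hD⟩ := exists_smoothing hUo hUc hUb hUn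
  have hUm := hUo.measurableSet
  have : IsFiniteMeasure (volume.restrict U) := ⟨by simpa using hUb.measure_lt_top⟩
  have hind : ∀ {f : Plane → ℝ}, MemLp f 2 (volume.restrict U) → MemLp (U.indicator f) 2 volume :=
    fun hf => (memLp_indicator_iff_restrict hUm).2 hf
  have hint : ∀ {f : Plane → ℝ}, MemLp f 2 (volume.restrict U) → IntegrableOn f U :=
    fun hf => hf.integrable (by norm_num)
  have hcd : ∀ m {f : Plane → ℝ}, MemLp f 2 (volume.restrict U) →
      ContDiff ℝ ∞ (M m (U.indicator f)) :=
    fun m _ hf => hM m _ ((hind hf).locallyIntegrable (by norm_num))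
  have hlim : ∀ {f : Plane → ℝ}, MemLp f 2 (volume.restrict U) →
      Tendsto (fun m => l2Norm U (fun x => M m (U.indicator f) x - f x)) atTop (𝓝 0) := by
    intro f hf
    refine (hL _ (hind hf)).congr fun m => l2Norm_congr hUm fun x hx => ?_
    simp [hx]
  refine ⟨fun m => M m (U.indicator u), fun m => hcd m hu.memLp, hlim hu.memLp, fun i => ?_,
    fun h hh i j => ?_⟩
  · refine (tendsto_l2Norm_mul_sub hs (fun m => (hcd m (hu.memLp_grad i)).continuous.aestronglyMeasurable)
      (hu.memLp_grad i) (hlim (hu.memLp_grad i))).congr fun m => l2Norm_congr hUm fun x hx => ?_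
    simp only [hD m u (g i) i (hint hu.memLp) (hu.weak i) x hx]
  · have hs2 : Tendsto (fun m => s m * s m) atTop (𝓝 1) := by simpa using hs.mul hs
    refine (tendsto_l2Norm_mul_sub hs2
      (fun m => (hcd m ((hh i).memLp_grad j)).continuous.aestronglyMeasurable)
      ((hh i).memLp_grad j) (hlim ((hh i).memLp_grad j))).congr fun m =>
        l2Norm_congr hUm fun x hx => ?_
    have e : pderiv i (M m (U.indicator u)) =ᶠ[𝓝 x] fun y => s m * M m (U.indicator (g i)) y :=
      Filter.eventuallyEq_of_mem (hUo.mem_nhds hx)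
        fun y hy => hD m u (g i) i (hint hu.memLp) (hu.weak i) y hy
    have e2 : pderiv j (pderiv i (M m (U.indicator u))) x =
        s m * pderiv j (M m (U.indicator (g i))) x := by
      unfold pderiv at e ⊢
      rw [e.fderiv_eq, fderiv_const_mul ((hcd m (hu.memLp_grad i)).differentiable (by simp) x)]
      rfl
    simp only [e2, hD m _ _ j (hint (hu.memLp_grad i)) ((hh i).weak j) x hx]
    ring

/-- Smooth functions on the plane are dense in `H¹` of a bounded convex open set. -/
theorem IsH1.exists_smooth_approx {U : Set Plane} (hUo : IsOpen U) (hUc : Convex ℝ U)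
    (hUb : Bornology.IsBounded U) (hUn : U.Nonempty) {u : Plane → ℝ} {g : Fin 2 → Plane → ℝ}
    (hu : IsH1 U u g) :
    ∃ φ : ℕ → Plane → ℝ, (∀ m, ContDiff ℝ ∞ (φ m)) ∧
      Tendsto (fun m => l2Norm U (fun x => φ m x - u x)) atTop (𝓝 0) ∧
      ∀ i, Tendsto (fun m => l2Norm U (fun x => pderiv i (φ m) x - g i x)) atTop (𝓝 0) := by
  obtain ⟨φ, h1, h2, h3, -⟩ := exists_smooth_approx_aux hUo hUc hUb hUn hu
  exact ⟨φ, h1, h2, h3⟩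

/-- Smooth functions on the plane are dense in `H²` of a bounded convex open set. -/
theorem IsH2.exists_smooth_approx {U : Set Plane} (hUo : IsOpen U) (hUc : Convex ℝ U)
    (hUb : Bornology.IsBounded U) (hUn : U.Nonempty) {u : Plane → ℝ} {g : Fin 2 → Plane → ℝ}
    {h : Fin 2 → Fin 2 → Plane → ℝ} (hu : IsH2 U u g h) :
    ∃ φ : ℕ → Plane → ℝ, (∀ m, ContDiff ℝ ∞ (φ m)) ∧
      Tendsto (fun m => l2Norm U (fun x => φ m x - u x)) atTop (𝓝 0) ∧
      (∀ i, Tendsto (fun m => l2Norm U (fun x => pderiv i (φ m) x - g i x)) atTop (𝓝 0)) ∧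
      ∀ i j, Tendsto (fun m => l2Norm U (fun x => pderiv j (pderiv i (φ m)) x - h i j x))
        atTop (𝓝 0) := by
  obtain ⟨φ, h1, h2, h3, h4⟩ := exists_smooth_approx_aux hUo hUc hUb hUn hu.isH1
  exact ⟨φ, h1, h2, h3, h4 h hu.isH1_grad⟩

/-! ### Triangles in affine coordinates -/

/-- The affine map taking the reference triangle to the triangle with vertices `p`. -/
def triMap (p : Fin 3 → Plane) (z : Plane) : Plane :=
  p 0 + (z 0 • (p 1 - p 0) + z 1 • (p 2 - p 0))

/-- The linear part of `triMap`. -/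
def triLin (p : Fin 3 → Plane) : Plane →L[ℝ] Plane :=
  (EuclideanSpace.proj (𝕜 := ℝ) (0 : Fin 2)).smulRight (p 1 - p 0) +
    (EuclideanSpace.proj (𝕜 := ℝ) (1 : Fin 2)).smulRight (p 2 - p 0)

theorem triLin_apply (p : Fin 3 → Plane) (z : Plane) :
    triLin p z = z 0 • (p 1 - p 0) + z 1 • (p 2 - p 0) := rfl

theorem triMap_eq (p : Fin 3 → Plane) (z : Plane) : triMap p z = p 0 + triLin p z := rfl

theorem eq_zero_of_smul_edge {p : Fin 3 → Plane} (hp : AffineIndependent ℝ p) {s t : ℝ}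
    (h : s • (p 1 - p 0) + t • (p 2 - p 0) = 0) : s = 0 ∧ t = 0 := by
  have h1 := (affineIndependent_iff_linearIndependent_vsub ℝ p 0).1 hp
  have h2 := h1.comp ![(⟨1, by decide⟩ : {x : Fin 3 // x ≠ 0}), ⟨2, by decide⟩] (by decide)
  have h3 : LinearIndependent ℝ ![p 1 - p 0, p 2 - p 0] := by
    have e : ![p 1 - p 0, p 2 - p 0] = (fun i : {x : Fin 3 // x ≠ 0} => p i -ᵥ p 0) ∘
        ![⟨1, by decide⟩, ⟨2, by decide⟩] := by
      ext i : 1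
      fin_cases i <;> rfl
    rw [e]; exact h2
  exact LinearIndependent.pair_iff.1 h3 s t h

theorem triLin_injective {p : Fin 3 → Plane} (hp : AffineIndependent ℝ p) :
    Function.Injective (triLin p) := by
  rw [injective_iff_map_eq_zero]
  intro z hz
  obtain ⟨h0, h1⟩ := eq_zero_of_smul_edge hp hz
  ext i
  fin_cases i
  · exact h0
  · exact h1

theorem triLin_det_ne_zero {p : Fin 3 → Plane} (hp : AffineIndependent ℝ p) :
    LinearMap.det (triLin p : Plane →ₗ[ℝ] Plane) ≠ 0 :=
  (LinearEquiv.isUnit_det' (LinearEquiv.ofInjectiveEndo (triLin p : Plane →ₗ[ℝ] Plane)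
    (triLin_injective hp))).ne_zero

theorem triMap_surjective {p : Fin 3 → Plane} (hp : AffineIndependent ℝ p) :
    Function.Surjective (triMap p) := by
  intro x
  obtain ⟨z, hz⟩ := (LinearMap.injective_iff_surjective
    (f := (triLin p : Plane →ₗ[ℝ] Plane))).1 (triLin_injective hp) (x - p 0)
  refine ⟨z, ?_⟩
  rw [triMap_eq]
  have : triLin p z = x - p 0 := hz
  rw [this]; abel

theorem triMap_injective {p : Fin 3 → Plane} (hp : AffineIndependent ℝ p) :
    Function.Injective (triMap p) := fun a b h => by
  rw [triMap_eq, triMap_eq] at h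
  exact triLin_injective hp (add_left_cancel h)

theorem continuous_triMap (p : Fin 3 → Plane) : Continuous (triMap p) := by
  unfold triMap; fun_prop

theorem measurableEmbedding_triMap {p : Fin 3 → Plane} (hp : AffineIndependent ℝ p) :
    MeasurableEmbedding (triMap p) :=
  (continuous_triMap p).measurableEmbedding (triMap_injective hp)

theorem exists_map_triMap {p : Fin 3 → Plane} (hp : AffineIndependent ℝ p) :
    ∃ J : ℝ, 0 < J ∧ Measure.map (triMap p) volume = ENNReal.ofReal J • volume := by
  refine ⟨|(LinearMap.det (triLin p : Plane →ₗ[ℝ] Plane))⁻¹|,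
    abs_pos.2 (inv_ne_zero (triLin_det_ne_zero hp)), ?_⟩
  have h := Measure.map_linearMap_addHaar_eq_smul_addHaar (volume : Measure Plane)
    (triLin_det_ne_zero hp)
  have h' : Measure.map (triLin p) volume = _ := h
  have : triMap p = (fun y => p 0 + y) ∘ (triLin p) := rfl
  rw [this, ← Measure.map_map (by fun_prop) (triLin p).measurable, h', Measure.map_smul,
    map_add_left_eq_self]

/-- The affine basis formed by the vertices of a triangle. -/
def triBasis {p : Fin 3 → Plane} (hp : AffineIndependent ℝ p) : AffineBasis (Fin 3) ℝ Plane :=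
  ⟨p, hp, (hp.affineSpan_eq_top_iff_card_eq_finrank_add_one).2 (by simp)⟩

theorem triBasis_coe {p : Fin 3 → Plane} (hp : AffineIndependent ℝ p) :
    ⇑(triBasis hp) = p := rfl

/-- The reference coordinates are the barycentric coordinates belonging to `p 1` and `p 2`.
Membership in the open or closed triangle thus becomes a set of linear inequalities in z. -/
theorem coord_triMap {p : Fin 3 → Plane} (hp : AffineIndependent ℝ p) (z : Plane) :
    (triBasis hp).coord 0 (triMap p z) = 1 - z 0 - z 1 ∧
    (triBasis hp).coord 1 (triMap p z) = z 0 ∧ (triBasis hp).coord 2 (triMap p z) = z 1 := by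
  have key : ∀ i, (triBasis hp).coord i (triMap p z) = (triBasis hp).coord i (p 0) +
      (z 0 * ((triBasis hp).coord i (p 1) - (triBasis hp).coord i (p 0)) +
        z 1 * ((triBasis hp).coord i (p 2) - (triBasis hp).coord i (p 0))) := by
    intro i
    have hv : ∀ a b : Plane, ((triBasis hp).coord i).linear (a - b) =
      (triBasis hp).coord i a - (triBasis hp).coord i b := fun a b =>
        ((triBasis hp).coord i).linearMap_vsub a b
    rw [triMap, add_comm (p 0), ← vadd_eq_add, AffineMap.map_vadd, map_add, map_smul, map_smul,
      hv, hv, vadd_eq_add]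
    simp only [smul_eq_mul]
    ring
  have hc : ∀ i j, (triBasis hp).coord i (p j) = if i = j then 1 else 0 := fun i j =>
    (triBasis hp).coord_apply i j
  simp only [key, hc]
  refine ⟨?_, ?_, ?_⟩ <;> simp
  ring

/-- The open reference triangle. -/
def refTri : Set Plane := {z | 0 < z 0 ∧ 0 < z 1 ∧ z 0 + z 1 < 1}

theorem triMap_mem_openTri {p : Fin 3 → Plane} (hp : AffineIndependent ℝ p) (z : Plane) :
    triMap p z ∈ openTri p ↔ 0 < z 0 ∧ 0 < z 1 ∧ z 0 + z 1 < 1 := by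
  have := (triBasis hp).interior_convexHull
  rw [triBasis_coe hp] at this
  obtain ⟨h0, h1, h2⟩ := coord_triMap hp z
  rw [openTri, this, Set.mem_ofPred_eq, Fin.forall_fin_succ, Fin.forall_fin_two]
  simp only [Fin.succ_zero_eq_one, Fin.succ_one_eq_two, h0, h1, h2]
  constructor
  · rintro ⟨a, b, c⟩; exact ⟨b, c, by linarith⟩
  · rintro ⟨a, b, c⟩; exact ⟨by linarith, a, b⟩

theorem triMap_mem_convexHull {p : Fin 3 → Plane} (hp : AffineIndependent ℝ p) (z : Plane) :
    triMap p z ∈ convexHull ℝ (Set.range p) ↔ 0 ≤ z 0 ∧ 0 ≤ z 1 ∧ z 0 + z 1 ≤ 1 := by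
  have := (triBasis hp).convexHull_eq_nonneg_coord
  rw [triBasis_coe hp] at this
  obtain ⟨h0, h1, h2⟩ := coord_triMap hp z
  rw [this, Set.mem_ofPred_eq, Fin.forall_fin_succ, Fin.forall_fin_two]
  simp only [Fin.succ_zero_eq_one, Fin.succ_one_eq_two, h0, h1, h2]
  constructor
  · rintro ⟨a, b, c⟩; exact ⟨b, c, by linarith⟩
  · rintro ⟨a, b, c⟩; exact ⟨by linarith, a, b⟩

theorem preimage_triMap_openTri {p : Fin 3 → Plane} (hp : AffineIndependent ℝ p) :
    triMap p ⁻¹' openTri p = refTri := Set.ext fun z => triMap_mem_openTri hp z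

/-! ### Topology and measure of the open triangle -/

theorem isOpen_openTri (p : Fin 3 → Plane) : IsOpen (openTri p) := isOpen_interior

theorem measurableSet_openTri (p : Fin 3 → Plane) : MeasurableSet (openTri p) :=
  (isOpen_openTri p).measurableSet

theorem convex_openTri (p : Fin 3 → Plane) : Convex ℝ (openTri p) :=
  (convex_convexHull ℝ _).interior

theorem isBounded_openTri (p : Fin 3 → Plane) : Bornology.IsBounded (openTri p) :=
  ((isBounded_convexHull.2 (Set.finite_range p).isBounded)).subset interior_subset

theorem isCompact_convexHull_tri (p : Fin 3 → Plane) :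
    IsCompact (convexHull ℝ (Set.range p)) := (Set.finite_range p).isCompact_convexHull (𝕜 := ℝ)

theorem nonempty_openTri {p : Fin 3 → Plane} (hp : AffineIndependent ℝ p) :
    (openTri p).Nonempty :=
  ⟨triMap p !₂[1 / 3, 1 / 3], (triMap_mem_openTri hp _).2 (by norm_num)⟩

theorem closure_openTri {p : Fin 3 → Plane} (hp : AffineIndependent ℝ p) :
    closure (openTri p) = convexHull ℝ (Set.range p) := by
  rw [openTri, (convex_convexHull ℝ _).closure_interior_eq_closure_of_nonempty_interior
    (nonempty_openTri hp), (isCompact_convexHull_tri p).isClosed.closure_eq]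

theorem vertex_mem_closure {p : Fin 3 → Plane} (hp : AffineIndependent ℝ p) (k : Fin 3) :
    p k ∈ closure (openTri p) := by
  rw [closure_openTri hp]; exact subset_convexHull _ _ ⟨k, rfl⟩

theorem volume_openTri_ne_top (p : Fin 3 → Plane) : volume (openTri p) ≠ ⊤ :=
  (isBounded_openTri p).measure_lt_top.ne

instance (p : Fin 3 → Plane) : IsFiniteMeasure (volume.restrict (openTri p)) :=
  ⟨by simpa using (isBounded_openTri p).measure_lt_top⟩

theorem volume_openTri_ne_zero {p : Fin 3 → Plane} (hp : AffineIndependent ℝ p) :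
    volume (openTri p) ≠ 0 :=
  ((isOpen_openTri p).measure_pos _ (nonempty_openTri hp)).ne'

theorem setIntegral_triMap {p : Fin 3 → Plane} (hp : AffineIndependent ℝ p) :
    ∃ J : ℝ, 0 < J ∧ ∀ f : Plane → ℝ, ∫ z in refTri, f (triMap p z) = J * ∫ x in openTri p, f x := by
  obtain ⟨J, hJ, h⟩ := exists_map_triMap hp
  refine ⟨J, hJ, fun f => ?_⟩
  rw [← preimage_triMap_openTri hp, ← (measurableEmbedding_triMap hp).setIntegral_map, h,
    Measure.restrict_smul, integral_smul_measure, ENNReal.toReal_ofReal hJ.le, smul_eq_mul]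

/-- Cyclic relabelling of the vertices. -/
theorem openTri_rotate (p : Fin 3 → Plane) (k : Fin 3) :
    openTri (fun i => p (i + k)) = openTri p := by
  unfold openTri
  congr 2
  exact (Equiv.addRight k).surjective.range_comp p

theorem affineIndependent_rotate {p : Fin 3 → Plane} (hp : AffineIndependent ℝ p) (k : Fin 3) :
    AffineIndependent ℝ (fun i => p (i + k)) :=
  hp.comp_embedding (Equiv.addRight k).toEmbedding

/-! ### Smooth functions on bounded sets -/

theorem _root_.Continuous.memLp_restrict {U : Set Plane} (hU : MeasurableSet U)
    (hb : Bornology.IsBounded U) {f : Plane → ℝ} (hf : Continuous f) :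
    MemLp f 2 (volume.restrict U) := by
  obtain ⟨C, hC⟩ := (hb.isCompact_closure).exists_bound_of_continuousOn hf.continuousOn
  have : IsFiniteMeasure (volume.restrict U) := ⟨by simpa using hb.measure_lt_top⟩
  exact MemLp.of_bound hf.aestronglyMeasurable C
    (ae_restrict_of_forall_mem hU fun x hx => hC x (subset_closure hx))

theorem contDiff_pderiv {f : Plane → ℝ} (hf : ContDiff ℝ ∞ f) (i : Fin 2) :
    ContDiff ℝ ∞ (pderiv i f) := by
  unfold pderiv
  exact (hf.fderiv_right (m := ∞) (by simp)).clm_apply contDiff_const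

theorem fderiv_eq_sum_pderiv (f : Plane → ℝ) (x v : Plane) :
    fderiv ℝ f x v = ∑ i, v i * pderiv i f x := by
  have : v = ∑ i, v i • EuclideanSpace.single i (1 : ℝ) := by
    ext j; fin_cases j <;> simp
  conv_lhs => rw [this]
  simp [pderiv]

/-! ### Integration by parts on a triangle -/

theorem measurePreserving_coords :
    MeasurePreserving (fun z : Plane => (z 0, z 1)) volume (volume : Measure (ℝ × ℝ)) :=
  (volume_preserving_finTwoArrow ℝ).comp (PiLp.volume_preserving_ofLp (Fin 2))

theorem measurableEmbedding_coords :
    MeasurableEmbedding (fun z : Plane => (z 0, z 1)) :=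
  (MeasurableEquiv.finTwoArrow (α := ℝ)).measurableEmbedding.comp
    (MeasurableEquiv.toLp 2 (Fin 2 → ℝ)).symm.measurableEmbedding

/-- The open reference triangle in `ℝ × ℝ`. -/
def refTriProd : Set (ℝ × ℝ) := {q | 0 < q.1 ∧ 0 < q.2 ∧ q.1 + q.2 < 1}

theorem measurableSet_refTriProd : MeasurableSet refTriProd := by
  refine IsOpen.measurableSet ?_
  exact (isOpen_lt continuous_const continuous_fst).inter
    ((isOpen_lt continuous_const continuous_snd).inter
      (isOpen_lt (continuous_fst.add continuous_snd) continuous_const))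

theorem setIntegral_refTri (G : ℝ × ℝ → ℝ) :
    ∫ z in refTri, G (z 0, z 1) = ∫ q in refTriProd, G q := by
  rw [← measurePreserving_coords.setIntegral_preimage_emb measurableEmbedding_coords]
  rfl

theorem integrable_indicator_refTriProd {G : ℝ × ℝ → ℝ} (hG : Continuous G) :
    Integrable (refTriProd.indicator G) (volume.prod volume) := by
  rw [integrable_indicator_iff measurableSet_refTriProd]
  refine (hG.continuousOn.integrableOn_compact
    (isCompact_Icc (a := ((0 : ℝ), (0 : ℝ))) (b := (1, 1)))).mono_set ?_
  rintro ⟨x, y⟩ ⟨h1, h2, h3⟩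
  simp only at h1 h2 h3
  exact ⟨⟨h1.le, h2.le⟩, ⟨by simp only; linarith, by simp only; linarith⟩⟩

/-- The factor x annihilates the boundary term at x = 0, and only the value on the hypotenuse x = 1
- y survives. At y = 1 the segment is empty and the right side vanishes too. -/
theorem integral_indicator_segment {f f' : ℝ → ℝ} (hf : ∀ x, HasDerivAt (fun x => x * f x) (f' x) x)
    (hf' : Continuous f') (y : ℝ) :
    ∫ x, {x | 0 < x ∧ 0 < y ∧ x + y < 1}.indicator f' x =
      (Set.Ioc (0 : ℝ) 1).indicator (fun y => (1 - y) * f (1 - y)) y := by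
  by_cases hy : 0 < y ∧ y ≤ 1
  · have e : {x | 0 < x ∧ 0 < y ∧ x + y < 1} = Set.Ioo 0 (1 - y) := by
      ext x; simp only [Set.mem_ofPred_eq, Set.mem_Ioo]
      exact ⟨fun h => ⟨h.1, by linarith [h.2.2]⟩, fun h => ⟨h.1, hy.1, by linarith [h.2]⟩⟩
    rw [e, integral_indicator measurableSet_Ioo, ← integral_Ioc_eq_integral_Ioo,
      ← intervalIntegral.integral_of_le (by linarith [hy.2]),
      intervalIntegral.integral_eq_sub_of_hasDerivAt (fun x _ => hf x)
        (hf'.intervalIntegrable _ _), Set.indicator_of_mem (show y ∈ Set.Ioc (0 : ℝ) 1 from hy)]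
    ring
  · have e : {x | 0 < x ∧ 0 < y ∧ x + y < 1} = ∅ := by
      ext x; simp only [Set.mem_ofPred_eq, Set.mem_empty_iff_false, iff_false]
      exact fun h => hy ⟨h.2.1, by linarith [h.1, h.2.2]⟩
    rw [e, Set.indicator_of_notMem (show y ∉ Set.Ioc (0 : ℝ) 1 from hy)]
    simp

theorem integral_refTriProd_fst {F F' : ℝ × ℝ → ℝ} (hF' : Continuous F')
    (hF : ∀ x y, HasDerivAt (fun x => x * F (x, y)) (F' (x, y)) x) :
    ∫ q in refTriProd, F' q = ∫ y in (0 : ℝ)..1, (1 - y) * F (1 - y, y) := by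
  rw [← integral_indicator measurableSet_refTriProd, Measure.volume_eq_prod,
    integral_prod_symm _ (integrable_indicator_refTriProd hF'),
    intervalIntegral.integral_of_le zero_le_one, ← integral_indicator measurableSet_Ioc]
  congr 1; ext y
  exact integral_indicator_segment (fun x => hF x y) (by fun_prop) y

theorem integral_refTriProd_snd {F F' : ℝ × ℝ → ℝ} (hF' : Continuous F')
    (hF : ∀ x y, HasDerivAt (fun y => y * F (x, y)) (F' (x, y)) y) :
    ∫ q in refTriProd, F' q = ∫ y in (0 : ℝ)..1, y * F (1 - y, y) := by
  have h1 : ∫ q in refTriProd, F' q = ∫ x in (0 : ℝ)..1, (1 - x) * F (x, 1 - x) := by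
    rw [← integral_indicator measurableSet_refTriProd, Measure.volume_eq_prod,
      integral_prod _ (integrable_indicator_refTriProd hF'),
      intervalIntegral.integral_of_le zero_le_one, ← integral_indicator measurableSet_Ioc]
    congr 1; ext x
    have hs := integral_indicator_segment (f := fun y => F (x, y)) (f' := fun y => F' (x, y))
      (fun y => hF x y) (by fun_prop) x
    rw [Set.indicator_apply] at hs ⊢
    rw [← hs]
    congr 1; ext y
    refine Set.indicator_eq_indicator ?_ rfl
    simp only [refTriProd, Set.mem_ofPred_eq, add_comm x y]
    tauto
  have h2 := intervalIntegral.integral_comp_sub_left (a := 0) (b := 1)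
    (fun x => (1 - x) * F (x, 1 - x)) 1
  simp only [sub_sub_cancel, sub_zero, sub_self] at h2
  rw [h1, ← h2]

/-- The integrand is the divergence of z f(z). This field is tangent to both legs, so only the
hypotenuse contributes, and there the two contributions (1 - t)f and t f add up to f. -/
theorem integral_refTri_euler {f : Plane → ℝ} (hf : ContDiff ℝ 1 f) :
    ∫ z in refTri, (2 * f z + fderiv ℝ f z z) = ∫ t in (0 : ℝ)..1, f !₂[1 - t, t] := by
  set F : ℝ × ℝ → ℝ := fun q => f !₂[q.1, q.2] with hFdef
  have hfd : Continuous (fderiv ℝ f) := hf.continuous_fderiv (by simp)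
  have hc : Continuous fun q : ℝ × ℝ => (!₂[q.1, q.2] : Plane) := by fun_prop
  have hFc : Continuous F := hf.continuous.comp hc
  set F1 : ℝ × ℝ → ℝ := fun q => F q + q.1 * fderiv ℝ f !₂[q.1, q.2] !₂[1, 0] with hF1
  set F2 : ℝ × ℝ → ℝ := fun q => F q + q.2 * fderiv ℝ f !₂[q.1, q.2] !₂[0, 1] with hF2
  have hF1c : Continuous F1 := by
    refine hFc.add (continuous_fst.mul ?_)
    exact (hfd.comp hc).clm_apply continuous_const
  have hF2c : Continuous F2 := by
    refine hFc.add (continuous_snd.mul ?_)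
    exact (hfd.comp hc).clm_apply continuous_const
  have hd1 : ∀ x y, HasDerivAt (fun x => x * F (x, y)) (F1 (x, y)) x := by
    intro x y
    have hl : HasDerivAt (fun x : ℝ => (!₂[0, y] : Plane) + x • !₂[1, 0]) ((1 : ℝ) • !₂[1, 0]) x :=
      ((hasDerivAt_id x).smul_const (!₂[1, 0] : Plane)).const_add _
    have he : ∀ x : ℝ, (!₂[0, y] : Plane) + x • !₂[1, 0] = !₂[x, y] := fun x => by
      ext i; fin_cases i <;> simp
    have h := (hf.differentiable (by simp) _).hasFDerivAt.comp_hasDerivAt x hl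
    have h2 := (hasDerivAt_id x).mul h
    simp only [he, Function.comp_def, one_smul, id, one_mul] at h2
    exact h2
  have hd2 : ∀ x y, HasDerivAt (fun y => y * F (x, y)) (F2 (x, y)) y := by
    intro x y
    have hl : HasDerivAt (fun y : ℝ => (!₂[x, 0] : Plane) + y • !₂[0, 1]) ((1 : ℝ) • !₂[0, 1]) y :=
      ((hasDerivAt_id y).smul_const (!₂[0, 1] : Plane)).const_add _
    have he : ∀ y : ℝ, (!₂[x, 0] : Plane) + y • !₂[0, 1] = !₂[x, y] := fun x => by
      ext i; fin_cases i <;> simp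
    have h := (hf.differentiable (by simp) _).hasFDerivAt.comp_hasDerivAt y hl
    have h2 := (hasDerivAt_id y).mul h
    simp only [he, Function.comp_def, one_smul, id, one_mul] at h2
    exact h2
  have h0 : ∫ z in refTri, (2 * f z + fderiv ℝ f z z) = ∫ z in refTri, (F1 + F2) (z 0, z 1) := by
    congr 1; ext z
    have hz : !₂[z 0, z 1] = z := by ext i; fin_cases i <;> rfl
    have hz2 : z = z 0 • !₂[1, 0] + z 1 • !₂[0, 1] := by ext i; fin_cases i <;> simp
    have : fderiv ℝ f z z = z 0 * fderiv ℝ f z !₂[1, 0] + z 1 * fderiv ℝ f z !₂[0, 1] := by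
      conv_lhs => rw [show fderiv ℝ f z z = fderiv ℝ f z (z 0 • !₂[1, 0] + z 1 • !₂[0, 1]) from
        congrArg _ hz2]
      simp
    simp only [Pi.add_apply, hF1, hF2, hFdef, hz, this]
    ring
  have hint : ∀ {G : ℝ × ℝ → ℝ}, Continuous G → IntegrableOn G refTriProd := fun hG =>
    (integrable_indicator_iff measurableSet_refTriProd).1 (integrable_indicator_refTriProd hG)
  rw [h0, setIntegral_refTri]
  simp only [Pi.add_apply]
  rw [integral_add (hint hF1c) (hint hF2c), integral_refTriProd_fst hF1c hd1,
    integral_refTriProd_snd hF2c hd2, ← intervalIntegral.integral_add]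
  · congr 1; ext t; simp only [hFdef]; ring
  · exact Continuous.intervalIntegrable (by
      refine (by fun_prop : Continuous fun y : ℝ => 1 - y).mul (hFc.comp (by fun_prop))) _ _
  · exact Continuous.intervalIntegrable (by
      refine continuous_id.mul (hFc.comp (by fun_prop))) _ _

theorem integral_edgeMeasure (a b : Plane) {f : Plane → ℝ} (hf : Continuous f) :
    ∫ x, f x ∂(edgeMeasure a b) = dist a b * ∫ t in (0 : ℝ)..1, f (AffineMap.lineMap a b t) := by
  have hc : Continuous fun t : ℝ => AffineMap.lineMap (k := ℝ) a b t := AffineMap.lineMap_continuous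
  rw [edgeMeasure, integral_smul_measure, ENNReal.toReal_ofReal dist_nonneg,
    integral_map hc.aemeasurable hf.aestronglyMeasurable, smul_eq_mul,
    intervalIntegral.integral_of_le zero_le_one, integral_Icc_eq_integral_Ioc]

instance (a b : Plane) : IsFiniteMeasure (edgeMeasure a b) := by
  unfold edgeMeasure
  exact Measure.smul_finite _ ENNReal.ofReal_ne_top

/-- The functional giving, up to a constant, the integral over the edge `γ k` of a function `u`
with gradient `g`. -/
def edgeFunctional (p : Fin 3 → Plane) (k : Fin 3) (u : Plane → ℝ) (g : Fin 2 → Plane → ℝ) : ℝ :=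
  ∫ x in openTri p, (2 * u x + ∑ i, (x i - p k i) * g i x)

/-- Divergence theorem for (x - p_k)φ, transported from the reference triangle. The constant depends
on the triangle and the edge only, so the identity extends to H¹ by density. -/
theorem exists_integral_edge_eq {p : Fin 3 → Plane} (hp : AffineIndependent ℝ p) (k : Fin 3) :
    ∃ c : ℝ, 0 < c ∧ ∀ φ : Plane → ℝ, ContDiff ℝ ∞ φ →
      ∫ x, φ x ∂(edge p k) = c * edgeFunctional p k φ (fun i => pderiv i φ) := by
  -- The rotation puts p_k at the origin of the reference coordinates and γ_k on the hypotenuse.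
  set p' : Fin 3 → Plane := fun i => p (i + k) with hp'
  have hpi : AffineIndependent ℝ p' := affineIndependent_rotate hp k
  obtain ⟨J, hJ, h⟩ := setIntegral_triMap hpi
  have hd : 0 < dist (p (k + 1)) (p (k + 2)) :=
    dist_pos.2 fun h => by
      have := hp.injective h
      simp at this
  refine ⟨dist (p (k + 1)) (p (k + 2)) * J, mul_pos hd hJ, fun φ hφ => ?_⟩
  have h1 := h (fun x => 2 * φ x + ∑ i, (x i - p k i) * pderiv i φ x)
  have h2 : ∀ z, 2 * φ (triMap p' z) + ∑ i, ((triMap p' z) i - p k i) * pderiv i φ (triMap p' z) =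
      2 * (φ ∘ triMap p') z + fderiv ℝ (φ ∘ triMap p') z z := by
    intro z
    have hdz : HasFDerivAt (triMap p') (triLin p') z := (triLin p').hasFDerivAt.const_add (p' 0)
    rw [((hφ.differentiable (by simp) _).hasFDerivAt.comp z hdz).fderiv]
    rw [ContinuousLinearMap.comp_apply, fderiv_eq_sum_pderiv]
    simp only [Function.comp_apply, triMap_eq p' z]
    simp [hp']
  have hcd : ContDiff ℝ 1 (φ ∘ triMap p') := by
    refine (hφ.of_le (by simp)).comp ?_
    unfold triMap; fun_prop
  simp only [h2] at h1
  rw [integral_refTri_euler hcd, hp', openTri_rotate] at h1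
  rw [edge, integral_edgeMeasure _ _ hφ.continuous, edgeFunctional, mul_assoc, ← h1]
  congr 2; ext t
  rw [AffineMap.lineMap_apply, Function.comp_apply, triMap]
  congr 1
  simp only [vsub_eq_sub, vadd_eq_add, add_comm _ k]
  simp
  module

/-! ### Traces -/

theorem tendsto_integral_mul {α : Type*} [MeasurableSpace α] {μ : Measure α} {w f : α → ℝ}
    {φ : ℕ → α → ℝ} (hw : MemLp w 2 μ) (hf : MemLp f 2 μ) (hφ : ∀ m, MemLp (φ m) 2 μ)
    (h : Tendsto (fun m => eLpNorm (fun x => φ m x - f x) 2 μ) atTop (𝓝 0)) :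
    Tendsto (fun m => ∫ x, w x * φ m x ∂μ) atTop (𝓝 (∫ x, w x * f x ∂μ)) := by
  refine tendsto_integral_of_L1' _ (hw.integrable_mul hf).aestronglyMeasurable
    (Eventually.of_forall fun m => hw.integrable_mul (hφ m)) ?_
  have h2 : Tendsto (fun m => eLpNorm w 2 μ * eLpNorm (fun x => φ m x - f x) 2 μ) atTop (𝓝 0) := by
    simpa using ENNReal.Tendsto.const_mul h (Or.inr hw.eLpNorm_lt_top.ne)
  refine tendsto_of_tendsto_of_tendsto_of_le_of_le tendsto_const_nhds h2 (fun _ => zero_le)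
    fun m => ?_
  rw [← sq_le_sq_iff_ennreal, mul_pow, eLpNorm_two_sq, eLpNorm_two_sq, eLpNorm_one_eq_lintegral_enorm]
  refine le_trans (le_of_eq ?_) (lintegral_mul_sq_le hw.1.enorm ((hφ m).1.sub hf.1).enorm)
  congr 2; ext x
  simp only [Pi.sub_apply]
  rw [← enorm_mul]; congr 1; simp [mul_sub]

theorem exists_eLpNorm_limit {α : Type*} [MeasurableSpace α] {μ : Measure α} {φ : ℕ → α → ℝ}
    (hφ : ∀ m, MemLp (φ m) 2 μ) {b : ℕ → ℝ≥0∞} (hb : Tendsto b atTop (𝓝 0))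
    (h : ∀ m n, eLpNorm (fun x => φ m x - φ n x) 2 μ ≤ b m + b n) :
    ∃ f, MemLp f 2 μ ∧ Tendsto (fun m => eLpNorm (fun x => φ m x - f x) 2 μ) atTop (𝓝 0) := by
  have hc : CauchySeq fun m => (hφ m).toLp := by
    rw [EMetric.cauchySeq_iff]
    intro ε hε
    obtain ⟨N, hN⟩ := (ENNReal.tendsto_atTop_zero.1 hb) (ε / 3) (ENNReal.div_pos hε.ne' (by simp))
    by_cases hεt : ε = ⊤
    · refine ⟨0, fun m _ n _ => ?_⟩
      rw [hεt]; exact edist_lt_top _ _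
    refine ⟨N, fun m hm n hn => ?_⟩
    rw [Lp.edist_toLp_toLp]
    calc _ ≤ b m + b n := h m n
      _ ≤ ε / 3 + ε / 3 := add_le_add (hN m hm) (hN n hn)
      _ < ε / 3 + ε / 3 + ε / 3 :=
          ENNReal.lt_add_right (by finiteness) (ENNReal.div_pos hε.ne' (by simp)).ne'
      _ = ε := ENNReal.add_thirds ε
  obtain ⟨f, hf⟩ := cauchySeq_tendsto_of_complete hc
  refine ⟨f, Lp.memLp f, ?_⟩
  rw [Lp.tendsto_Lp_iff_tendsto_eLpNorm'] at hf
  refine hf.congr fun m => eLpNorm_congr_ae ?_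
  filter_upwards [(hφ m).coeFn_toLp] with x hx
  simp [hx]

theorem memLp_coord_sub (p : Fin 3 → Plane) (i : Fin 2) (a : ℝ) :
    MemLp (fun x : Plane => x i - a) 2 (volume.restrict (openTri p)) :=
  Continuous.memLp_restrict (measurableSet_openTri p) (isBounded_openTri p) (by fun_prop)

theorem memLp_smooth (p : Fin 3 → Plane) {φ : Plane → ℝ} (hφ : ContDiff ℝ ∞ φ) :
    MemLp φ 2 (volume.restrict (openTri p)) :=
  hφ.continuous.memLp_restrict (measurableSet_openTri p) (isBounded_openTri p)

theorem edgeFunctional_eq (p : Fin 3 → Plane) (k : Fin 3) {u : Plane → ℝ} {g : Fin 2 → Plane → ℝ}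
    (hu : MemLp u 2 (volume.restrict (openTri p)))
    (hg : ∀ i, MemLp (g i) 2 (volume.restrict (openTri p))) :
    edgeFunctional p k u g =
      2 * (∫ x in openTri p, u x) + ∑ i, ∫ x in openTri p, (x i - p k i) * g i x := by
  have hi : ∀ i, Integrable (fun x : Plane => (x i - p k i) * g i x)
      (volume.restrict (openTri p)) := fun i => (memLp_coord_sub p i _).integrable_mul (hg i)
  rw [edgeFunctional, integral_add ((hu.integrable (by norm_num)).const_mul 2)
    (integrable_finsetSum _ fun i _ => hi i), integral_const_mul,
    integral_finsetSum _ fun i _ => hi i]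

theorem tendsto_edgeFunctional (p : Fin 3 → Plane) (k : Fin 3) {u : Plane → ℝ}
    {g : Fin 2 → Plane → ℝ} (hu : MemLp u 2 (volume.restrict (openTri p)))
    (hg : ∀ i, MemLp (g i) 2 (volume.restrict (openTri p))) {φ : ℕ → Plane → ℝ}
    {ψ : ℕ → Fin 2 → Plane → ℝ}
    (hφ : ∀ m, MemLp (φ m) 2 (volume.restrict (openTri p)))
    (hψ : ∀ m i, MemLp (ψ m i) 2 (volume.restrict (openTri p)))
    (h0 : Tendsto (fun m => l2Norm (openTri p) (fun x => φ m x - u x)) atTop (𝓝 0))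
    (h1 : ∀ i, Tendsto (fun m => l2Norm (openTri p) (fun x => ψ m i x - g i x))
      atTop (𝓝 0)) :
    Tendsto (fun m => edgeFunctional p k (φ m) (ψ m)) atTop (𝓝 (edgeFunctional p k u g)) := by
  rw [edgeFunctional_eq p k hu hg]
  simp only [fun m => edgeFunctional_eq p k (hφ m) (hψ m)]
  refine Tendsto.add (Tendsto.const_mul 2 ?_) (tendsto_finsetSum _ fun i _ => ?_)
  · simpa using tendsto_integral_mul (memLp_const (1 : ℝ)) hu hφ h0
  · exact tendsto_integral_mul (memLp_coord_sub p i _) (hg i) (fun m => hψ m i) (h1 i)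

theorem _root_.Continuous.memLp_edgeMeasure {f : Plane → ℝ} (hf : Continuous f) (a b : Plane) :
    MemLp f 2 (edgeMeasure a b) := by
  have hc : Continuous fun t : ℝ => AffineMap.lineMap (k := ℝ) a b t := AffineMap.lineMap_continuous
  obtain ⟨C, hC⟩ := (isCompact_Icc (a := (0 : ℝ)) (b := 1)).exists_bound_of_continuousOn
    (hf.comp hc).continuousOn
  refine MemLp.of_bound hf.aestronglyMeasurable C ?_
  unfold edgeMeasure
  refine Measure.ae_smul_measure ?_ _
  rw [ae_map_iff hc.aemeasurable (measurableSet_le hf.norm.measurable measurable_const)]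
  exact ae_restrict_of_forall_mem measurableSet_Icc hC

theorem pderiv_sub {f g : Plane → ℝ} (hf : ContDiff ℝ ∞ f) (hg : ContDiff ℝ ∞ g) (i : Fin 2) :
    pderiv i (fun x => f x - g x) = fun x => pderiv i f x - pderiv i g x := by
  ext x
  unfold pderiv
  rw [fderiv_fun_sub (hf.differentiable (by simp) x) (hg.differentiable (by simp) x)]
  rfl

theorem pderiv_sq {f : Plane → ℝ} (hf : ContDiff ℝ ∞ f) (i : Fin 2) (x : Plane) :
    pderiv i (fun x => f x ^ 2) x = 2 * f x * pderiv i f x := by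
  unfold pderiv
  rw [fderiv_fun_pow 2 (hf.differentiable (by simp) x)]
  simp

/-- The edge identity is applied to φ². The term 2(x - p_k)·φ∇φ is absorbed by |x - p_k| ≤ D and the
inequality between the arithmetic and geometric means. -/
theorem exists_trace_bound {p : Fin 3 → Plane} (hp : AffineIndependent ℝ p) (k : Fin 3) :
    ∃ K : ℝ≥0∞, K ≠ ⊤ ∧ ∀ φ : Plane → ℝ, ContDiff ℝ ∞ φ → eLpNorm φ 2 (edge p k) ≤
      K * (l2Norm (openTri p) φ + ∑ i, l2Norm (openTri p) (pderiv i φ)) := by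
  obtain ⟨c, hc, h⟩ := exists_integral_edge_eq hp k
  obtain ⟨D, hD⟩ := (isBounded_openTri p).subset_closedBall (p k)
  refine ⟨ENNReal.ofReal (√(c * (2 + 2 * D ^ 2 + 1))), by simp, fun φ hφ => ?_⟩
  have hm := memLp_smooth p hφ
  have hmg := fun i => memLp_smooth p (contDiff_pderiv hφ i)
  have hcK : 0 ≤ c * (2 + 2 * D ^ 2 + 1) := by positivity
  have e1 : eLpNorm φ 2 (edge p k) ^ 2 = ENNReal.ofReal (∫ x, φ x ^ 2 ∂(edge p k)) := by
    rw [eLpNorm_two_sq, edge, ofReal_integral_eq_lintegral_ofReal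
      (hφ.continuous.memLp_edgeMeasure _ _).integrable_sq (ae_of_all _ fun x => sq_nonneg _)]
    refine lintegral_congr fun x => ?_
    rw [Real.enorm_eq_ofReal_abs, ← ENNReal.ofReal_pow (abs_nonneg _), sq_abs]
  have e2 : ∫ x, φ x ^ 2 ∂(edge p k) ≤ c * (2 + 2 * D ^ 2 + 1) *
      ((∫ x in openTri p, φ x ^ 2) + ∑ i, ∫ x in openTri p, pderiv i φ x ^ 2) := by
    rw [h _ (hφ.pow 2), edgeFunctional, mul_assoc c]
    refine mul_le_mul_of_nonneg_left ?_ hc.le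
    rw [← integral_finsetSum _ fun i _ => (hmg i).integrable_sq,
      ← integral_add hm.integrable_sq (integrable_finsetSum _ fun i _ => (hmg i).integrable_sq),
      ← integral_const_mul]
    refine setIntegral_mono_on ?_ ?_ (measurableSet_openTri p) fun x hx => ?_
    · refine Integrable.add (hm.integrable_sq.const_mul 2) (integrable_finsetSum _ fun i _ => ?_)
      simp only [pderiv_sq hφ]
      exact (memLp_coord_sub p i _).integrable_mul
        (memLp_smooth p (((contDiff_const (c := (2 : ℝ))).mul hφ).mul (contDiff_pderiv hφ i)))
    · exact (hm.integrable_sq.add (integrable_finsetSum _ fun i _ => (hmg i).integrable_sq)).const_mul _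
    · simp only [pderiv_sq hφ, Fin.sum_univ_two]
      have hb : ∀ i, (x i - p k i) ^ 2 ≤ D ^ 2 := fun i => by
        have h1 := mem_closedBall_iff_norm.1 (hD hx)
        have h2 := (PiLp.norm_apply_le (x - p k) i).trans h1
        rw [← sq_abs]
        exact pow_le_pow_left₀ (abs_nonneg _) h2 2
      set a := φ x
      set b₀ := pderiv 0 φ x
      set b₁ := pderiv 1 φ x
      have q0 : (x 0 - p k 0) * (2 * a * b₀) ≤ D ^ 2 * a ^ 2 + b₀ ^ 2 := by
        nlinarith [sq_nonneg ((x 0 - p k 0) * a - b₀), mul_le_mul_of_nonneg_right (hb 0) (sq_nonneg a)]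
      have q1 : (x 1 - p k 1) * (2 * a * b₁) ≤ D ^ 2 * a ^ 2 + b₁ ^ 2 := by
        nlinarith [sq_nonneg ((x 1 - p k 1) * a - b₁), mul_le_mul_of_nonneg_right (hb 1) (sq_nonneg a)]
      have r : 0 ≤ (2 * D ^ 2 + 2) * (b₀ ^ 2 + b₁ ^ 2) + a ^ 2 := by positivity
      nlinarith
  rw [← sq_le_sq_iff_ennreal, e1, mul_pow, ← ENNReal.ofReal_pow (Real.sqrt_nonneg _),
    Real.sq_sqrt hcK]
  refine (ENNReal.ofReal_le_ofReal e2).trans ?_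
  rw [ENNReal.ofReal_mul hcK, ENNReal.ofReal_add (integral_nonneg fun x => sq_nonneg _)
    (Finset.sum_nonneg fun i _ => integral_nonneg fun x => sq_nonneg _),
    ENNReal.ofReal_sum_of_nonneg fun i _ => integral_nonneg fun x => sq_nonneg _]
  simp only [← l2Norm_sq_eq_ofReal hm, ← l2Norm_sq_eq_ofReal (hmg _)]
  gcongr
  simp only [Fin.sum_univ_two]
  set a := l2Norm (openTri p) φ
  set b₀ := l2Norm (openTri p) (pderiv 0 φ)
  set b₁ := l2Norm (openTri p) (pderiv 1 φ)
  calc a ^ 2 + (b₀ ^ 2 + b₁ ^ 2) ≤ a ^ 2 + (b₀ ^ 2 + b₁ ^ 2) +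
        (2 * a * b₀ + 2 * a * b₁ + 2 * b₀ * b₁) := le_self_add
    _ = _ := by ring

/-- The constant relating the integral over `γ k` with the edge functional. -/
def edgeConst {p : Fin 3 → Plane} (hp : AffineIndependent ℝ p) (k : Fin 3) : ℝ :=
  (exists_integral_edge_eq hp k).choose

theorem edgeConst_pos {p : Fin 3 → Plane} (hp : AffineIndependent ℝ p) (k : Fin 3) :
    0 < edgeConst hp k := (exists_integral_edge_eq hp k).choose_spec.1

theorem integral_edge_eq {p : Fin 3 → Plane} (hp : AffineIndependent ℝ p) (k : Fin 3)
    {φ : Plane → ℝ} (hφ : ContDiff ℝ ∞ φ) :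
    ∫ x, φ x ∂(edge p k) = edgeConst hp k * edgeFunctional p k φ (fun i => pderiv i φ) :=
  (exists_integral_edge_eq hp k).choose_spec.2 φ hφ

/-- Both sides are limits along the smooth functions that define the trace. In particular the
integral does not depend on the choice of trace. -/
theorem IsEdgeTrace.integral_eq {p : Fin 3 → Plane} (hp : AffineIndependent ℝ p) {k : Fin 3}
    {u θ : Plane → ℝ} {g : Fin 2 → Plane → ℝ} (hu : IsH1 (openTri p) u g)
    (hθ : IsEdgeTrace p k u g θ) :
    ∫ x, θ x ∂(edge p k) = edgeConst hp k * edgeFunctional p k u g := by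
  obtain ⟨hm, φ, hφ, h0, h1, h2⟩ := hθ
  have l1 := (tendsto_edgeFunctional p k hu.memLp hu.memLp_grad (fun m => memLp_smooth p (hφ m))
    (fun m i => memLp_smooth p (contDiff_pderiv (hφ m) i)) h0 h1).const_mul (edgeConst hp k)
  simp only [fun m => (integral_edge_eq hp k (hφ m)).symm] at l1
  have l2 := tendsto_integral_mul (memLp_const (1 : ℝ)) hm
    (fun m => (hφ m).continuous.memLp_edgeMeasure (p (k + 1)) (p (k + 2))) h2
  simp only [one_mul] at l2
  exact tendsto_nhds_unique l2 l1

theorem IsH1.exists_isEdgeTrace {p : Fin 3 → Plane} (hp : AffineIndependent ℝ p) (k : Fin 3)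
    {u : Plane → ℝ} {g : Fin 2 → Plane → ℝ} (hu : IsH1 (openTri p) u g) :
    ∃ θ, IsEdgeTrace p k u g θ := by
  obtain ⟨φ, hφ, h0, h1⟩ := hu.exists_smooth_approx (isOpen_openTri p) (convex_openTri p)
    (isBounded_openTri p) (nonempty_openTri hp)
  obtain ⟨K, hK, hb⟩ := exists_trace_bound hp k
  have hml := fun m => (hφ m).continuous.memLp_edgeMeasure (p (k + 1)) (p (k + 2))
  -- The trace bound for φ m - φ n, split by the triangle inequality through u, makes the
  -- restrictions to the edge a Cauchy sequence in L².
  obtain ⟨θ, hθ, hl⟩ := exists_eLpNorm_limit hml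
    (b := fun m => K * (l2Norm (openTri p) (fun x => φ m x - u x) +
      ∑ i, l2Norm (openTri p) (fun x => pderiv i (φ m) x - g i x))) (by
    have := ENNReal.Tendsto.const_mul (h0.add (tendsto_finsetSum Finset.univ fun i _ => h1 i))
      (Or.inr hK)
    rwa [Finset.sum_const_zero, add_zero, mul_zero] at this) (fun m n => by
    have htri : ∀ {a b f : Plane → ℝ}, MemLp a 2 (volume.restrict (openTri p)) →
        MemLp b 2 (volume.restrict (openTri p)) → MemLp f 2 (volume.restrict (openTri p)) →
        l2Norm (openTri p) (fun x => a x - b x) ≤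
          l2Norm (openTri p) (fun x => a x - f x) + l2Norm (openTri p) (fun x => b x - f x) := by
      intro a b f ha hb hf
      have e : (fun x => a x - b x) = (a - f) - (b - f) := by ext x; simp
      rw [l2Norm, e]
      exact eLpNorm_sub_le (ha.1.sub hf.1) (hb.1.sub hf.1) (by norm_num)
    refine (hb _ ((hφ m).sub (hφ n))).trans ?_
    rw [← mul_add]
    refine mul_le_mul' le_rfl ?_
    have e : ∀ i, pderiv i (fun x => φ m x - φ n x) = fun x => pderiv i (φ m) x - pderiv i (φ n) x :=
      fun i => pderiv_sub (hφ m) (hφ n) i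
    simp only [e]
    calc _ ≤ (_ + _) + ∑ i, (_ + _) := add_le_add
          (htri (memLp_smooth p (hφ m)) (memLp_smooth p (hφ n)) hu.memLp)
          (Finset.sum_le_sum fun i _ => htri (memLp_smooth p (contDiff_pderiv (hφ m) i))
            (memLp_smooth p (contDiff_pderiv (hφ n) i)) (hu.memLp_grad i))
      _ = _ := by rw [Finset.sum_add_distrib]; ring)
  exact ⟨θ, hθ, φ, hφ, h0, h1, hl⟩

/-! ### The Poincaré inequality on convex sets -/

theorem tendsto_eLpNorm_two {α : Type*} [MeasurableSpace α] {μ : Measure α} {f : α → ℝ}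
    {φ : ℕ → α → ℝ} (hφ : ∀ m, MemLp (φ m) 2 μ) (hf : MemLp f 2 μ)
    (h : Tendsto (fun m => eLpNorm (fun x => φ m x - f x) 2 μ) atTop (𝓝 0)) :
    Tendsto (fun m => eLpNorm (φ m) 2 μ) atTop (𝓝 (eLpNorm f 2 μ)) := by
  have h1 := (Lp.tendsto_Lp_iff_tendsto_eLpNorm'' φ hφ f hf).2 h
  have h2 := (continuous_enorm.tendsto _).comp h1
  simpa [Function.comp_def, Lp.enorm_toLp] using h2

/-- The segment from x to y is followed only to its midpoint. For t ≤ 1/2 the map x ↦ x + t(y - x)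
has Jacobian (1 - t)² ≥ 1/4, so the later integration over x stays bounded. -/
theorem enorm_sub_midpoint_sq_le {φ : Plane → ℝ} (hφ : ContDiff ℝ ∞ φ) (x y : Plane) :
    ‖φ x - φ (x + (1 / 2 : ℝ) • (y - x))‖ₑ ^ 2 ≤
      2 * ‖y - x‖ₑ ^ 2 * ∫⁻ t in Set.Ioc (0 : ℝ) (1 / 2), ∑ i, ‖pderiv i φ (x + t • (y - x))‖ₑ ^ 2 := by
  have hd : ∀ t : ℝ, HasDerivAt (fun t : ℝ => φ (x + t • (y - x)))
      (fderiv ℝ φ (x + t • (y - x)) (y - x)) t := fun t => by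
    have hl : HasDerivAt (fun t : ℝ => x + t • (y - x)) ((1 : ℝ) • (y - x)) t :=
      ((hasDerivAt_id t).smul_const (y - x)).const_add x
    have h := (hφ.differentiable (by simp) _).hasFDerivAt.comp_hasDerivAt t hl
    rw [one_smul] at h
    exact h
  have hc : Continuous fun t : ℝ => fderiv ℝ φ (x + t • (y - x)) (y - x) :=
    ((hφ.continuous_fderiv (by simp)).comp (by fun_prop)).clm_apply continuous_const
  have h1 := intervalIntegral.integral_eq_sub_of_hasDerivAt (a := 0) (b := 1 / 2)
    (fun t _ => hd t) (hc.intervalIntegrable _ _)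
  simp only [zero_smul, add_zero] at h1
  rw [intervalIntegral.integral_of_le (by norm_num)] at h1
  have h2 : ‖φ x - φ (x + (1 / 2 : ℝ) • (y - x))‖ₑ ≤
      ∫⁻ t in Set.Ioc (0 : ℝ) (1 / 2), ‖fderiv ℝ φ (x + t • (y - x)) (y - x)‖ₑ := by
    rw [← enorm_neg, neg_sub, ← h1]
    exact enorm_integral_le_lintegral_enorm _
  have h3 : (∫⁻ t in Set.Ioc (0 : ℝ) (1 / 2), ‖fderiv ℝ φ (x + t • (y - x)) (y - x)‖ₑ) ^ 2 ≤
      ∫⁻ t in Set.Ioc (0 : ℝ) (1 / 2), ‖fderiv ℝ φ (x + t • (y - x)) (y - x)‖ₑ ^ 2 := by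
    have := lintegral_mul_sq_le_of_weight (μ := volume.restrict (Set.Ioc (0 : ℝ) (1 / 2)))
      (f := fun t => ‖fderiv ℝ φ (x + t • (y - x)) (y - x)‖ₑ) (k := fun _ => 1)
      hc.enorm.measurable.aemeasurable aemeasurable_const
      (by simp)
    simpa using this
  refine (pow_le_pow_left' h2 2).trans (h3.trans ?_)
  rw [← lintegral_const_mul' _ _ (by finiteness)]
  refine lintegral_mono fun t => ?_
  have h4 : ‖fderiv ℝ φ (x + t • (y - x)) (y - x)‖ ^ 2 ≤
      2 * ‖y - x‖ ^ 2 * ∑ i, ‖pderiv i φ (x + t • (y - x))‖ ^ 2 := by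
    rw [fderiv_eq_sum_pderiv]
    have hb : ∀ i, (y - x) i ^ 2 ≤ ‖y - x‖ ^ 2 := fun i => by
      rw [← sq_abs]; exact pow_le_pow_left₀ (abs_nonneg _) (PiLp.norm_apply_le (y - x) i) 2
    simp only [Fin.sum_univ_two, Real.norm_eq_abs, sq_abs]
    set b₀ := pderiv 0 φ (x + t • (y - x))
    set b₁ := pderiv 1 φ (x + t • (y - x))
    nlinarith [sq_nonneg ((y - x) 0 * b₀ - (y - x) 1 * b₁),
      mul_le_mul_of_nonneg_right (hb 0) (sq_nonneg b₀),
      mul_le_mul_of_nonneg_right (hb 1) (sq_nonneg b₁)]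
  have h5 := ENNReal.ofReal_le_ofReal h4
  rw [ENNReal.ofReal_mul (by positivity), ENNReal.ofReal_mul (by norm_num),
    ENNReal.ofReal_sum_of_nonneg fun i _ => by positivity] at h5
  simp only [ENNReal.ofReal_pow (norm_nonneg _), ofReal_norm, ENNReal.ofReal_ofNat] at h5
  exact h5

/-- For fixed y and t the point x + t(y - x) stays in U by convexity, and the change of variables
costs at most 4. Together with the 2 of the pointwise bound this gives 8. -/
theorem lintegral_midpoint_le {U : Set Plane} (hU : MeasurableSet U) (hUc : Convex ℝ U) {D : ℝ}
    (hD : ∀ x ∈ U, ∀ y ∈ U, dist x y ≤ D) {φ : Plane → ℝ} (hφ : ContDiff ℝ ∞ φ) {y : Plane}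
    (hy : y ∈ U) :
    ∫⁻ x in U, ‖φ x - φ (x + (1 / 2 : ℝ) • (y - x))‖ₑ ^ 2 ≤
      8 * ENNReal.ofReal D ^ 2 * gradNorm U (fun i => pderiv i φ) ^ 2 := by
  set S : Plane → ℝ≥0∞ := fun z => ∑ i, ‖pderiv i φ z‖ₑ ^ 2 with hS
  have hSc : Continuous S := continuous_finsetSum _ fun i _ =>
    (ENNReal.continuous_pow 2).comp (contDiff_pderiv hφ i).continuous.enorm
  have hSg : gradNorm U (fun i => pderiv i φ) ^ 2 = ∫⁻ z in U, S z := by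
    rw [gradNorm_sq, hS, lintegral_finsetSum _ fun i _ =>
      ((contDiff_pderiv hφ i).continuous.enorm.measurable.pow_const 2)]
    simp only [l2Norm_sq]
  have h1 : ∀ t ∈ Set.Ioc (0 : ℝ) (1 / 2), ∫⁻ x in U, S (x + t • (y - x)) ≤ 4 * ∫⁻ z in U, S z := by
    intro t ht
    have ht' : (1 - t) ≠ 0 := by linarith [ht.2]
    rw [← lintegral_indicator hU, ← lintegral_indicator hU]
    calc _ ≤ ∫⁻ x, U.indicator S (t • y + (1 - t) • x) := by
          refine lintegral_mono fun x => ?_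
          by_cases hx : x ∈ U
          · have e : x + t • (y - x) = t • y + (1 - t) • x := by module
            have hm : t • y + (1 - t) • x ∈ U :=
              hUc hy hx ht.1.le (by linarith [ht.2]) (by ring)
            simp [hx, hm, e]
          · simp [hx]
      _ = ENNReal.ofReal ((1 - t)⁻¹ ^ 2) * ∫⁻ z, U.indicator S z := lintegral_homothety _ ht' _
      _ ≤ 4 * ∫⁻ z, U.indicator S z := by
          gcongr
          rw [show (4 : ℝ≥0∞) = ENNReal.ofReal (2 ^ 2) by norm_num]
          refine ENNReal.ofReal_le_ofReal (pow_le_pow_left₀ (by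
            rw [inv_nonneg]; linarith [ht.2]) ?_ 2)
          rw [inv_le_comm₀ (by linarith [ht.2]) (by norm_num)]
          linarith [ht.2]
  calc _ ≤ ∫⁻ x in U, 2 * ENNReal.ofReal D ^ 2 *
        ∫⁻ t in Set.Ioc (0 : ℝ) (1 / 2), S (x + t • (y - x)) := by
        refine setLIntegral_mono' hU fun x hx => (enorm_sub_midpoint_sq_le hφ x y).trans ?_
        gcongr
        rw [← ofReal_norm, ← dist_eq_norm]
        exact ENNReal.ofReal_le_ofReal (hD y hy x hx)
    _ = 2 * ENNReal.ofReal D ^ 2 *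
        ∫⁻ t in Set.Ioc (0 : ℝ) (1 / 2), ∫⁻ x in U, S (x + t • (y - x)) := by
        rw [lintegral_const_mul' _ _ (by finiteness), lintegral_lintegral_swap]
        exact (hSc.comp (by fun_prop : Continuous fun q : Plane × ℝ =>
          q.1 + q.2 • (y - q.1))).measurable.aemeasurable
    _ ≤ 2 * ENNReal.ofReal D ^ 2 * ∫⁻ _t in Set.Ioc (0 : ℝ) (1 / 2), 4 * ∫⁻ z in U, S z := by
        gcongr 2 * ENNReal.ofReal D ^ 2 * ?_
        exact setLIntegral_mono' measurableSet_Ioc h1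
    _ ≤ 2 * ENNReal.ofReal D ^ 2 * (4 * ∫⁻ z in U, S z) := by
        gcongr 2 * ENNReal.ofReal D ^ 2 * ?_
        rw [setLIntegral_const]
        refine mul_le_of_le_one_right' ?_
        simp
    _ = _ := by rw [hSg]; ring

theorem enorm_add_sq_le (a b : ℝ) : ‖a + b‖ₑ ^ 2 ≤ 2 * ‖a‖ₑ ^ 2 + 2 * ‖b‖ₑ ^ 2 := by
  have h : ‖a + b‖ ^ 2 ≤ 2 * ‖a‖ ^ 2 + 2 * ‖b‖ ^ 2 := by
    simp only [Real.norm_eq_abs, sq_abs]; nlinarith [sq_nonneg (a - b)]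
  have h5 := ENNReal.ofReal_le_ofReal h
  rw [ENNReal.ofReal_add (by positivity) (by positivity), ENNReal.ofReal_mul (by positivity),
    ENNReal.ofReal_mul (by norm_num)] at h5
  simp only [ENNReal.ofReal_pow (norm_nonneg _), ofReal_norm, ENNReal.ofReal_ofNat] at h5
  exact h5

/-- The difference φ x - φ y is split at the midpoint, which is the same seen from x and from y.
Each half is bounded by the one-sided estimate. -/
theorem lintegral_pairs_le {U : Set Plane} (hU : MeasurableSet U) (hUc : Convex ℝ U) {D : ℝ}
    (hD : ∀ x ∈ U, ∀ y ∈ U, dist x y ≤ D) {φ : Plane → ℝ} (hφ : ContDiff ℝ ∞ φ) :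
    ∫⁻ x in U, ∫⁻ y in U, ‖φ x - φ y‖ₑ ^ 2 ≤
      32 * ENNReal.ofReal D ^ 2 * gradNorm U (fun i => pderiv i φ) ^ 2 * volume U := by
  set A := 8 * ENNReal.ofReal D ^ 2 * gradNorm U (fun i => pderiv i φ) ^ 2 with hA
  set f : Plane → Plane → ℝ≥0∞ := fun x y => ‖φ x - φ (x + (1 / 2 : ℝ) • (y - x))‖ₑ ^ 2 with hf
  have hc : Continuous fun q : Plane × Plane => f q.1 q.2 := by
    refine (ENNReal.continuous_pow 2).comp (Continuous.enorm ?_)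
    exact (hφ.continuous.comp continuous_fst).sub (hφ.continuous.comp (by fun_prop))
  have hc2 : Continuous fun q : Plane × Plane => f q.2 q.1 := hc.comp continuous_swap
  have h1 : ∀ x y, ‖φ x - φ y‖ₑ ^ 2 ≤ 2 * f x y + 2 * f y x := fun x y => by
    have e : y + (1 / 2 : ℝ) • (x - y) = x + (1 / 2 : ℝ) • (y - x) := by module
    have := enorm_add_sq_le (φ x - φ (x + (1 / 2 : ℝ) • (y - x)))
      (φ (x + (1 / 2 : ℝ) • (y - x)) - φ y)
    simp only [hf, e]
    rw [← enorm_neg (φ y - _), neg_sub]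
    simpa using this
  have h2 : ∫⁻ y in U, ∫⁻ x in U, f x y ≤ A * volume U := by
    rw [← setLIntegral_const]
    exact setLIntegral_mono' hU fun y hy => lintegral_midpoint_le hU hUc hD hφ hy
  calc _ ≤ ∫⁻ x in U, ∫⁻ y in U, (2 * f x y + 2 * f y x) :=
        lintegral_mono fun x => lintegral_mono fun y => h1 x y
    _ = 2 * (∫⁻ x in U, ∫⁻ y in U, f x y) + 2 * ∫⁻ x in U, ∫⁻ y in U, f y x := by
        have m1 : ∀ x, Measurable fun y => f x y := fun x =>
          (hc.comp (by fun_prop : Continuous fun y : Plane => (x, y))).measurable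
        have m2 : Measurable fun x => ∫⁻ y in U, f x y := hc.measurable.lintegral_prod_right'
        simp only [fun x => lintegral_add_left (μ := volume.restrict U) ((m1 x).const_mul 2)
          (fun y => 2 * f y x), lintegral_const_mul' (2 : ℝ≥0∞) _ (by simp)]
        rw [lintegral_add_left (m2.const_mul 2), lintegral_const_mul' (2 : ℝ≥0∞) _ (by simp),
          lintegral_const_mul' (2 : ℝ≥0∞) _ (by simp)]
    _ ≤ 2 * (A * volume U) + 2 * (A * volume U) := by
        gcongr
        rw [lintegral_lintegral_swap hc.measurable.aemeasurable]
        exact h2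
    _ = _ := by rw [hA]; ring

/-- The mean value of `u` on `U`. -/
def mean (U : Set Plane) (u : Plane → ℝ) : ℝ := (volume.real U)⁻¹ * ∫ x in U, u x

theorem l2Norm_sub_mean_le_smooth {U : Set Plane} (hU : MeasurableSet U) (hUc : Convex ℝ U)
    (hUb : Bornology.IsBounded U) (h0 : volume U ≠ 0) {D : ℝ}
    (hD : ∀ x ∈ U, ∀ y ∈ U, dist x y ≤ D) {φ : Plane → ℝ} (hφ : ContDiff ℝ ∞ φ) :
    l2Norm U (fun x => φ x - mean U φ) ≤ 6 * ENNReal.ofReal D * gradNorm U (fun i => pderiv i φ) := by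
  have hfin : volume U ≠ ⊤ := hUb.measure_lt_top.ne
  have : IsFiniteMeasure (volume.restrict U) := ⟨by simpa using hUb.measure_lt_top⟩
  have hint : IntegrableOn φ U := (hφ.continuous.memLp_restrict hU hUb).integrable (by norm_num)
  have h1 : ∀ x, volume U * ‖φ x - mean U φ‖ₑ ^ 2 ≤ ∫⁻ y in U, ‖φ x - φ y‖ₑ ^ 2 := by
    intro x
    -- The deviation from the mean is the average of φ x - φ y over y, so Cauchy-Schwarz in y
    -- reduces the claim to the double integral over pairs.
    have e : volume.real U * (φ x - mean U φ) = ∫ y in U, (φ x - φ y) := by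
      rw [integral_sub (integrable_const _) hint, setIntegral_const, mean, smul_eq_mul, mul_sub,
        mul_inv_cancel_left₀ (by rw [measureReal_def]; exact (ENNReal.toReal_pos h0 hfin).ne')]
    have h2 : ‖volume.real U * (φ x - mean U φ)‖ₑ ≤ ∫⁻ y in U, ‖φ x - φ y‖ₑ := by
      rw [e]; exact enorm_integral_le_lintegral_enorm _
    have hm : AEMeasurable (fun y => ‖φ x - φ y‖ₑ) (volume.restrict U) :=
      (continuous_const.sub hφ.continuous).enorm.measurable.aemeasurable
    have h3 := lintegral_mul_sq_le hm (aemeasurable_const (b := (1 : ℝ≥0∞)))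
    simp only [mul_one, one_pow, lintegral_one, Measure.restrict_apply_univ] at h3
    have h4 := (pow_le_pow_left' h2 2).trans h3
    have e2 : ‖volume.real U‖ₑ = volume U := by
      rw [Real.enorm_of_nonneg measureReal_nonneg, ofReal_measureReal hfin]
    rw [enorm_mul, e2, mul_pow, sq, mul_assoc, mul_comm (∫⁻ _ in _, _)] at h4
    exact (ENNReal.mul_le_mul_iff_right h0 hfin).1 h4
  have h5 := lintegral_pairs_le hU hUc hD hφ
  rw [← sq_le_sq_iff_ennreal, l2Norm_sq, ← ENNReal.mul_le_mul_iff_right h0 hfin,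
    ← lintegral_const_mul' _ _ hfin]
  refine (lintegral_mono fun x => h1 x).trans (h5.trans ?_)
  -- The constant 32 is rounded up to the square of 6.
  calc _ ≤ 36 * ENNReal.ofReal D ^ 2 * gradNorm U (fun i => pderiv i φ) ^ 2 * volume U := by
        gcongr; norm_num
    _ = _ := by ring

theorem tendsto_mean {U : Set Plane} (hUb : Bornology.IsBounded U) {u : Plane → ℝ}
    {φ : ℕ → Plane → ℝ} (hu : MemLp u 2 (volume.restrict U))
    (hφ : ∀ m, MemLp (φ m) 2 (volume.restrict U))
    (h : Tendsto (fun m => l2Norm U (fun x => φ m x - u x)) atTop (𝓝 0)) :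
    Tendsto (fun m => mean U (φ m)) atTop (𝓝 (mean U u)) := by
  have : IsFiniteMeasure (volume.restrict U) := ⟨by simpa using hUb.measure_lt_top⟩
  have := tendsto_integral_mul (memLp_const (1 : ℝ)) hu hφ h
  simp only [one_mul] at this
  exact this.const_mul _

theorem tendsto_gradNorm {U : Set Plane} {g : Fin 2 → Plane → ℝ} {φ : ℕ → Fin 2 → Plane → ℝ}
    (hφ : ∀ m i, MemLp (φ m i) 2 (volume.restrict U)) (hg : ∀ i, MemLp (g i) 2 (volume.restrict U))
    (h : ∀ i, Tendsto (fun m => l2Norm U (fun x => φ m i x - g i x)) atTop (𝓝 0)) :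
    Tendsto (fun m => gradNorm U (φ m)) atTop (𝓝 (gradNorm U g)) := by
  refine (ENNReal.continuous_rpow_const.tendsto _).comp (tendsto_finsetSum _ fun i _ => ?_)
  exact ((ENNReal.continuous_pow 2).tendsto _).comp
    (tendsto_eLpNorm_two (fun m => hφ m i) (hg i) (h i))

theorem tendsto_l2Norm_sub_const {U : Set Plane} (hUb : Bornology.IsBounded U) {u : Plane → ℝ}
    {φ : ℕ → Plane → ℝ} (hu : MemLp u 2 (volume.restrict U))
    (hφ : ∀ m, MemLp (φ m) 2 (volume.restrict U))
    (h : Tendsto (fun m => l2Norm U (fun x => φ m x - u x)) atTop (𝓝 0)) {a : ℕ → ℝ} {b : ℝ}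
    (ha : Tendsto a atTop (𝓝 b)) :
    Tendsto (fun m => l2Norm U (fun x => (φ m x - a m) - (u x - b))) atTop (𝓝 0) := by
  have hfin : volume U ≠ ⊤ := hUb.measure_lt_top.ne
  have hl : Tendsto (fun m => l2Norm U (fun x => φ m x - u x) +
      volume U ^ (1 / 2 : ℝ) * ‖a m - b‖ₑ) atTop (𝓝 (0 + volume U ^ (1 / 2 : ℝ) * 0)) := by
    refine h.add (ENNReal.Tendsto.const_mul ?_
      (Or.inr (ENNReal.rpow_ne_top_of_nonneg (by norm_num) hfin)))
    have := (continuous_enorm.tendsto _).comp (ha.sub_const b)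
    simpa [Function.comp_def] using this
  rw [mul_zero, add_zero] at hl
  refine tendsto_of_tendsto_of_tendsto_of_le_of_le tendsto_const_nhds hl (fun _ => zero_le)
    fun m => ?_
  have e : (fun x => (φ m x - a m) - (u x - b)) = (fun x => φ m x - u x) - fun _ => (a m - b) := by
    ext x; simp; ring
  rw [l2Norm, e]
  refine (eLpNorm_sub_le ((hφ m).1.sub hu.1) aestronglyMeasurable_const (by norm_num)).trans ?_
  gcongr
  · exact le_rfl
  · refine (eLpNorm_le_of_ae_enorm_bound (ae_of_all _ fun x => le_rfl)).trans ?_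
    simp [mul_comm]

/-- The Poincaré inequality for functions in `H¹` of a bounded convex open set. -/
theorem exists_poincare {U : Set Plane} (hUo : IsOpen U) (hUc : Convex ℝ U)
    (hUb : Bornology.IsBounded U) (hUn : U.Nonempty) :
    ∃ K : ℝ≥0∞, K ≠ ⊤ ∧ ∀ u g, IsH1 U u g →
      l2Norm U (fun x => u x - mean U u) ≤ K * gradNorm U g := by
  obtain ⟨D, hD⟩ := Metric.isBounded_iff.1 hUb
  refine ⟨6 * ENNReal.ofReal D, by finiteness, fun u g hu => ?_⟩
  have hUm := hUo.measurableSet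
  have : IsFiniteMeasure (volume.restrict U) := ⟨by simpa using hUb.measure_lt_top⟩
  obtain ⟨φ, hφ, h0, h1⟩ := hu.exists_smooth_approx hUo hUc hUb hUn
  have hm := fun m => (hφ m).continuous.memLp_restrict hUm hUb
  have hmg := fun m i => (contDiff_pderiv (hφ m) i).continuous.memLp_restrict hUm hUb
  refine le_of_tendsto_of_tendsto
    (tendsto_eLpNorm_two (fun m => (hm m).sub (memLp_const (mean U (φ m))))
      (hu.memLp.sub (memLp_const (mean U u)))
      (tendsto_l2Norm_sub_const hUb hu.memLp hm h0 (tendsto_mean hUb hu.memLp hm h0)))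
    (ENNReal.Tendsto.const_mul (tendsto_gradNorm hmg hu.memLp_grad h1) (Or.inr (by finiteness)))
    (Eventually.of_forall fun m => ?_)
  exact l2Norm_sub_mean_le_smooth hUm hUc hUb (hUo.measure_pos _ hUn).ne'
    (fun x hx y hy => hD hx hy) (hφ m)

/-! ### The Sobolev inequality `H² ⊂ C⁰` on a triangle -/

/-- The value f 0 = f t - ∫₀ᵗ f' is averaged over t in an interval of length 1/8, and 8 is the
reciprocal of that length. -/
theorem enorm_le_lintegral_add_deriv {f f' : ℝ → ℝ} (hf : ∀ t, HasDerivAt f (f' t) t)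
    (hf' : Continuous f') :
    ‖f 0‖ₑ ≤ 8 * (∫⁻ t in Set.Ioc (0 : ℝ) (1 / 8), ‖f t‖ₑ) +
      ∫⁻ t in Set.Ioc (0 : ℝ) (1 / 8), ‖f' t‖ₑ := by
  have h1 : ∀ t ∈ Set.Ioc (0 : ℝ) (1 / 8),
      ‖f 0‖ₑ ≤ ‖f t‖ₑ + ∫⁻ t in Set.Ioc (0 : ℝ) (1 / 8), ‖f' t‖ₑ := by
    intro t ht
    have h := intervalIntegral.integral_eq_sub_of_hasDerivAt (a := 0) (b := t)
      (fun t _ => hf t) (hf'.intervalIntegrable _ _)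
    rw [intervalIntegral.integral_of_le ht.1.le] at h
    have e : f 0 = f t - ∫ s in Set.Ioc 0 t, f' s := by rw [h]; ring
    rw [e]
    refine enorm_sub_le.trans (add_le_add le_rfl ((enorm_integral_le_lintegral_enorm _).trans ?_))
    exact lintegral_mono_set (Set.Ioc_subset_Ioc_right ht.2)
  have hfc : Continuous f := continuous_iff_continuousAt.2 fun t => (hf t).continuousAt
  have h2 := setLIntegral_mono' (μ := volume) measurableSet_Ioc h1
  rw [setLIntegral_const, lintegral_add_left hfc.enorm.measurable, setLIntegral_const] at h2
  have hv : volume (Set.Ioc (0 : ℝ) (1 / 8)) = 8⁻¹ := by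
    rw [Real.volume_Ioc, sub_zero, one_div, ENNReal.ofReal_inv_of_pos (by norm_num)]; simp
  rw [hv] at h2
  have h8 : (8 : ℝ≥0∞)⁻¹ * 8 = 1 := ENNReal.inv_mul_cancel (by simp) (by simp)
  calc ‖f 0‖ₑ = ‖f 0‖ₑ * 8⁻¹ * 8 := by rw [mul_assoc, h8, mul_one]
    _ ≤ ((∫⁻ t in Set.Ioc (0 : ℝ) (1 / 8), ‖f t‖ₑ) +
      (∫⁻ t in Set.Ioc (0 : ℝ) (1 / 8), ‖f' t‖ₑ) * 8⁻¹) * 8 := by gcongr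
    _ = _ := by rw [add_mul, mul_assoc _ 8⁻¹, h8, mul_one, mul_comm]

theorem lintegral_linear_combination {α : Type*} [MeasurableSpace α] {μ : Measure α}
    {f₁ f₂ f₃ : α → ℝ≥0∞} (f₄ : α → ℝ≥0∞) (h₁ : Measurable f₁) (h₂ : Measurable f₂)
    (h₃ : Measurable f₃) :
    ∫⁻ x, (64 * f₁ x + 8 * f₂ x + 8 * f₃ x + f₄ x) ∂μ =
      64 * (∫⁻ x, f₁ x ∂μ) + 8 * (∫⁻ x, f₂ x ∂μ) + 8 * (∫⁻ x, f₃ x ∂μ) + ∫⁻ x, f₄ x ∂μ := by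
  rw [lintegral_add_left (f := fun x => 64 * f₁ x + 8 * f₂ x + 8 * f₃ x) (by fun_prop),
    lintegral_add_left (f := fun x => 64 * f₁ x + 8 * f₂ x) (by fun_prop),
    lintegral_add_left (f := fun x => 64 * f₁ x) (by fun_prop), lintegral_const_mul' _ _ (by simp),
    lintegral_const_mul' _ _ (by simp), lintegral_const_mul' _ _ (by simp)]

/-! ### Pointwise bound at the corner of a parallelogram -/

/-- Directional derivative. -/
def dderiv (v : Plane) (f : Plane → ℝ) : Plane → ℝ := fun x => fderiv ℝ f x v

theorem contDiff_dderiv {f : Plane → ℝ} (hf : ContDiff ℝ ∞ f) (v : Plane) :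
    ContDiff ℝ ∞ (dderiv v f) :=
  (hf.fderiv_right (m := ∞) (by simp)).clm_apply contDiff_const

theorem hasDerivAt_line {f : Plane → ℝ} (hf : ContDiff ℝ ∞ f) (y v : Plane) (t : ℝ) :
    HasDerivAt (fun t : ℝ => f (y + t • v)) (dderiv v f (y + t • v)) t := by
  have hl : HasDerivAt (fun t : ℝ => y + t • v) ((1 : ℝ) • v) t :=
    ((hasDerivAt_id t).smul_const v).const_add y
  have h := (hf.differentiable (by simp) _).hasFDerivAt.comp_hasDerivAt t hl
  rw [one_smul] at h
  exact h

/-- The density bounding the value at the corner of a parallelogram. -/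
def cornerDensity (a b : Plane) (φ : Plane → ℝ) (x : Plane) : ℝ≥0∞ :=
  64 * ‖φ x‖ₑ + 8 * ‖dderiv b φ x‖ₑ + 8 * ‖dderiv a φ x‖ₑ + ‖dderiv b (dderiv a φ) x‖ₑ

theorem continuous_cornerDensity (a b : Plane) {φ : Plane → ℝ} (hφ : ContDiff ℝ ∞ φ) :
    Continuous (cornerDensity a b φ) := by
  have h1 := hφ.continuous.enorm
  have h2 := (contDiff_dderiv hφ a).continuous.enorm
  have h3 := (contDiff_dderiv hφ b).continuous.enorm
  have h4 := (contDiff_dderiv (contDiff_dderiv hφ a) b).continuous.enorm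
  unfold cornerDensity
  refine (((ENNReal.continuous_const_mul (by simp)).comp h1).add
    ((ENNReal.continuous_const_mul (by simp)).comp h3)).add
    ((ENNReal.continuous_const_mul (by simp)).comp h2) |>.add h4

/-- The one-dimensional estimate is used in direction a for φ, and then in direction b for φ and for
its derivative along a. The weights 64, 8, 8, 1 of the density come from this iteration, which
involves only the mixed second derivative. -/
theorem enorm_corner_le {φ : Plane → ℝ} (hφ : ContDiff ℝ ∞ φ) (x a b : Plane) :
    ‖φ x‖ₑ ≤ ∫⁻ s in Set.Ioc (0 : ℝ) (1 / 8), ∫⁻ t in Set.Ioc (0 : ℝ) (1 / 8),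
      cornerDensity a b φ (x + s • a + t • b) := by
  have c1 : ∀ {ψ : Plane → ℝ}, ContDiff ℝ ∞ ψ → ∀ y v : Plane,
      ‖ψ y‖ₑ ≤ 8 * (∫⁻ t in Set.Ioc (0 : ℝ) (1 / 8), ‖ψ (y + t • v)‖ₑ) +
        ∫⁻ t in Set.Ioc (0 : ℝ) (1 / 8), ‖dderiv v ψ (y + t • v)‖ₑ := by
    intro ψ hψ y v
    have := enorm_le_lintegral_add_deriv (fun t => hasDerivAt_line hψ y v t)
      ((contDiff_dderiv hψ v).continuous.comp (by fun_prop))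
    simpa using this
  have hm : ∀ {ψ : Plane → ℝ}, ContDiff ℝ ∞ ψ → ∀ y v : Plane,
      Measurable fun t : ℝ => ‖ψ (y + t • v)‖ₑ := fun hψ y v =>
    (hψ.continuous.comp (by fun_prop : Continuous fun t : ℝ => y + t • v)).enorm.measurable
  refine (c1 hφ x a).trans ?_
  rw [← lintegral_const_mul' _ _ (by simp),
    ← lintegral_add_left ((hm hφ x a).const_mul 8)]
  refine lintegral_mono fun s => ?_
  refine (add_le_add (mul_le_mul' le_rfl (c1 hφ (x + s • a) b))
    (c1 (contDiff_dderiv hφ a) (x + s • a) b)).trans (le_of_eq ?_)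
  unfold cornerDensity
  have m1 := hm hφ (x + s • a) b
  have m2 := hm (contDiff_dderiv hφ a) (x + s • a) b
  have m3 := hm (contDiff_dderiv hφ b) (x + s • a) b
  rw [lintegral_linear_combination _ m1 m3 m2]
  ring

theorem lintegral_triMap {p : Fin 3 → Plane} (hp : AffineIndependent ℝ p) :
    ∃ J : ℝ≥0∞, J ≠ ⊤ ∧ ∀ f : Plane → ℝ≥0∞,
      ∫⁻ z in refTri, f (triMap p z) = J * ∫⁻ x in openTri p, f x := by
  obtain ⟨J, hJ, h⟩ := exists_map_triMap hp
  refine ⟨ENNReal.ofReal J, by simp, fun f => ?_⟩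
  have := (measurableEmbedding_triMap hp).restrict_map volume (openTri p)
  rw [← preimage_triMap_openTri hp, ← (measurableEmbedding_triMap hp).lintegral_map, ← this, h,
    Measure.restrict_smul, lintegral_smul_measure, smul_eq_mul]

/-- In reference coordinates the parallelogram has sides 1/8. If z 0 + z 1 ≤ 2/3, it stays in the
triangle because 2/3 + 1/8 + 1/8 < 1. The constant J is the same for all such z, so the bound is
uniform up to the boundary. -/
theorem lintegral_corner_le {p : Fin 3 → Plane} (hp : AffineIndependent ℝ p) :
    ∃ J : ℝ≥0∞, J ≠ ⊤ ∧ ∀ z : Plane, 0 ≤ z 0 → 0 ≤ z 1 → z 0 + z 1 ≤ 2 / 3 →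
      ∀ G : Plane → ℝ≥0∞, Continuous G →
      ∫⁻ s in Set.Ioc (0 : ℝ) (1 / 8), ∫⁻ t in Set.Ioc (0 : ℝ) (1 / 8),
        G (triMap p z + s • (p 1 - p 0) + t • (p 2 - p 0)) ≤ J * ∫⁻ x in openTri p, G x := by
  obtain ⟨J, hJ, h⟩ := lintegral_triMap hp
  refine ⟨J, hJ, fun z h0 h1 h2 G hG => ?_⟩
  set H : ℝ × ℝ → ℝ≥0∞ := refTriProd.indicator fun q => G (triMap p !₂[q.1, q.2]) with hH
  have hHm : Measurable H := by
    refine Measurable.indicator ?_ measurableSet_refTriProd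
    exact (hG.comp ((continuous_triMap p).comp (by fun_prop))).measurable
  have e : ∀ s t : ℝ, triMap p z + s • (p 1 - p 0) + t • (p 2 - p 0) =
      triMap p !₂[z 0 + s, z 1 + t] := fun s t => by
    simp only [triMap, Matrix.cons_val_zero, Matrix.cons_val_one]
    module
  rw [← h G]
  calc _ ≤ ∫⁻ s in Set.Ioc (0 : ℝ) (1 / 8), ∫⁻ t in Set.Ioc (0 : ℝ) (1 / 8),
        H (z 0 + s, z 1 + t) := by
        refine setLIntegral_mono' measurableSet_Ioc fun s hs =>
          setLIntegral_mono' measurableSet_Ioc fun t ht => le_of_eq ?_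
        have hmem : (z 0 + s, z 1 + t) ∈ refTriProd :=
          ⟨by simp only; linarith [hs.1], by simp only; linarith [ht.1],
            by simp only; linarith [hs.2, ht.2]⟩
        rw [e, hH, Set.indicator_of_mem hmem]
    _ ≤ ∫⁻ s, ∫⁻ t, H (z 0 + s, z 1 + t) :=
        (setLIntegral_le_lintegral _ _).trans
          (lintegral_mono fun s => setLIntegral_le_lintegral _ _)
    _ = ∫⁻ s, ∫⁻ t, H (s, t) := by
        simp only [fun s => lintegral_add_left_eq_self (μ := volume)
          (fun t => H (z 0 + s, t)) (z 1)]
        exact lintegral_add_left_eq_self (μ := volume) (fun s => ∫⁻ t, H (s, t)) (z 0)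
    _ = ∫⁻ q, H q := by
        rw [Measure.volume_eq_prod, lintegral_prod _ hHm.aemeasurable]
    _ = ∫⁻ w : Plane, H (w 0, w 1) := by
        rw [measurePreserving_coords.lintegral_comp_emb measurableEmbedding_coords]
    _ = ∫⁻ w in refTri, G (triMap p w) := by
        have hm : MeasurableSet refTri :=
          measurableEmbedding_coords.measurable measurableSet_refTriProd
        rw [← lintegral_indicator hm]
        refine lintegral_congr fun w => ?_
        have : !₂[w 0, w 1] = w := by ext i; fin_cases i <;> rfl
        by_cases hw : w ∈ refTri
        · rw [Set.indicator_of_mem hw, hH, Set.indicator_of_mem (show (w 0, w 1) ∈ refTriProd from hw),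
            this]
        · rw [Set.indicator_of_notMem hw, hH,
            Set.indicator_of_notMem (show (w 0, w 1) ∉ refTriProd from hw)]

theorem lintegral_enorm_le_l2Norm (U : Set Plane) {f : Plane → ℝ} (hf : Continuous f) :
    ∫⁻ x in U, ‖f x‖ₑ ≤ volume U ^ (1 / 2 : ℝ) * l2Norm U f := by
  rw [← sq_le_sq_iff_ennreal, mul_pow, rpow_half_sq, l2Norm_sq, mul_comm]
  have := lintegral_mul_sq_le (μ := volume.restrict U) hf.enorm.measurable.aemeasurable
    (aemeasurable_const (b := (1 : ℝ≥0∞)))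
  simpa using this

theorem l2Norm_dderiv_le (U : Set Plane) {f : Plane → ℝ} (hf : ContDiff ℝ ∞ f) (v : Plane) :
    l2Norm U (dderiv v f) ≤ ‖v‖ₑ * ∑ i, l2Norm U (pderiv i f) := by
  have e : dderiv v f = ∑ i, v i • pderiv i f := by
    ext x; simp [dderiv, fderiv_eq_sum_pderiv]
  rw [e, l2Norm, Finset.mul_sum]
  refine (eLpNorm_sum_le (fun i _ =>
    ((contDiff_pderiv hf i).continuous.const_smul _).aestronglyMeasurable) (by norm_num)).trans ?_
  refine Finset.sum_le_sum fun i _ => ?_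
  rw [eLpNorm_const_smul]
  refine mul_le_mul' ?_ le_rfl
  rw [← ofReal_norm, ← ofReal_norm]
  exact ENNReal.ofReal_le_ofReal (PiLp.norm_apply_le v i)

theorem pderiv_dderiv {f : Plane → ℝ} (hf : ContDiff ℝ ∞ f) (v : Plane) (j : Fin 2) :
    pderiv j (dderiv v f) = ∑ i, v i • pderiv j (pderiv i f) := by
  have e : dderiv v f = fun x => ∑ i, v i * pderiv i f x := by
    ext x; simp [dderiv, fderiv_eq_sum_pderiv]
  ext x
  have hd : ∀ i, DifferentiableAt ℝ (pderiv i f) x := fun i =>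
    (contDiff_pderiv hf i).differentiable (by simp) x
  rw [e, pderiv, fderiv_fun_sum fun i _ => (hd i).const_mul _]
  simp only [fun i => fderiv_const_mul (hd i) (v i)]
  simp [pderiv]

/-- The sum of the `L²` norms of the derivatives up to order two. -/
def sobolevSum (U : Set Plane) (u : Plane → ℝ) (g : Fin 2 → Plane → ℝ)
    (h : Fin 2 → Fin 2 → Plane → ℝ) : ℝ≥0∞ :=
  l2Norm U u + ∑ i, l2Norm U (g i) + ∑ i, ∑ j, l2Norm U (h i j)

theorem lintegral_cornerDensity_le (U : Set Plane) (a b : Plane) {φ : Plane → ℝ}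
    (hφ : ContDiff ℝ ∞ φ) :
    ∫⁻ x in U, cornerDensity a b φ x ≤ volume U ^ (1 / 2 : ℝ) *
      (64 + 8 * ‖b‖ₑ + 8 * ‖a‖ₑ + ‖b‖ₑ * ‖a‖ₑ) *
      sobolevSum U φ (fun i => pderiv i φ) (fun i j => pderiv j (pderiv i φ)) := by
  set V := volume U ^ (1 / 2 : ℝ)
  set S := sobolevSum U φ (fun i => pderiv i φ) (fun i j => pderiv j (pderiv i φ)) with hS
  have s0 : l2Norm U φ ≤ S := by rw [hS, sobolevSum, add_assoc]; exact le_self_add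
  have s1 : ∑ i, l2Norm U (pderiv i φ) ≤ S := by
    rw [hS, sobolevSum, add_right_comm]; exact le_add_self
  have s2 : ∑ i, ∑ j, l2Norm U (pderiv j (pderiv i φ)) ≤ S := by
    rw [hS, sobolevSum]; exact le_add_self
  have ha := contDiff_dderiv hφ a
  have t0 := (lintegral_enorm_le_l2Norm U hφ.continuous).trans (mul_le_mul' le_rfl s0)
  have t1 := fun v => (lintegral_enorm_le_l2Norm U (contDiff_dderiv hφ v).continuous).trans
    (mul_le_mul' le_rfl ((l2Norm_dderiv_le U hφ v).trans (mul_le_mul' le_rfl s1)))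
  have t2 : ∫⁻ x in U, ‖dderiv b (dderiv a φ) x‖ₑ ≤ V * (‖b‖ₑ * (‖a‖ₑ * S)) := by
    refine (lintegral_enorm_le_l2Norm U (contDiff_dderiv ha b).continuous).trans
      (mul_le_mul' le_rfl ((l2Norm_dderiv_le U ha b).trans (mul_le_mul' le_rfl ?_)))
    calc _ ≤ ∑ j, ∑ i, ‖a‖ₑ * l2Norm U (pderiv j (pderiv i φ)) := by
          refine Finset.sum_le_sum fun j _ => ?_
          rw [pderiv_dderiv hφ]
          refine (eLpNorm_sum_le (fun i _ => ((contDiff_pderiv (contDiff_pderiv hφ i)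
            j).continuous.const_smul _).aestronglyMeasurable) (by norm_num)).trans ?_
          refine Finset.sum_le_sum fun i _ => ?_
          rw [eLpNorm_const_smul]
          refine mul_le_mul' ?_ le_rfl
          rw [← ofReal_norm, ← ofReal_norm]
          exact ENNReal.ofReal_le_ofReal (PiLp.norm_apply_le a i)
      _ = ‖a‖ₑ * ∑ i, ∑ j, l2Norm U (pderiv j (pderiv i φ)) := by
          rw [Finset.sum_comm]; simp only [Finset.mul_sum]
      _ ≤ _ := mul_le_mul' le_rfl s2
  unfold cornerDensity
  have m0 : Measurable fun x => ‖φ x‖ₑ := hφ.continuous.enorm.measurable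
  have m1 : ∀ v, Measurable fun x => ‖dderiv v φ x‖ₑ :=
    fun v => (contDiff_dderiv hφ v).continuous.enorm.measurable
  rw [lintegral_linear_combination _ m0 (m1 b) (m1 a)]
  calc _ ≤ 64 * (V * S) + 8 * (V * (‖b‖ₑ * S)) + 8 * (V * (‖a‖ₑ * S)) + V * (‖b‖ₑ * (‖a‖ₑ * S)) := by
        gcongr
        · exact t1 b
        · exact t1 a
    _ = _ := by ring

theorem exists_sobolev_corner {p : Fin 3 → Plane} (hp : AffineIndependent ℝ p) :
    ∃ K : ℝ≥0∞, K ≠ ⊤ ∧ ∀ z : Plane, 0 ≤ z 0 → 0 ≤ z 1 → z 0 + z 1 ≤ 2 / 3 →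
      ∀ φ : Plane → ℝ, ContDiff ℝ ∞ φ → ‖φ (triMap p z)‖ₑ ≤ K * sobolevSum (openTri p) φ
        (fun i => pderiv i φ) (fun i j => pderiv j (pderiv i φ)) := by
  obtain ⟨J, hJ, h⟩ := lintegral_corner_le hp
  have hV : volume (openTri p) ^ (1 / 2 : ℝ) ≠ ⊤ :=
    ENNReal.rpow_ne_top_of_nonneg (by norm_num) (volume_openTri_ne_top p)
  refine ⟨_, ?_, fun z h0 h1 h2 φ hφ => (enorm_corner_le hφ _ _ _).trans
    ((h z h0 h1 h2 _ (continuous_cornerDensity _ _ hφ)).trans ((mul_le_mul' le_rfl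
      (lintegral_cornerDensity_le _ _ _ hφ)).trans (le_of_eq (mul_assoc _ _ _).symm)))⟩
  finiteness

theorem exists_sobolev_smooth {p : Fin 3 → Plane} (hp : AffineIndependent ℝ p) :
    ∃ K : ℝ≥0∞, K ≠ ⊤ ∧ ∀ φ : Plane → ℝ, ContDiff ℝ ∞ φ → ∀ x ∈ closure (openTri p),
      ‖φ x‖ₑ ≤ K * sobolevSum (openTri p) φ
        (fun i => pderiv i φ) (fun i j => pderiv j (pderiv i φ)) := by
  choose K hK h using fun k => exists_sobolev_corner (affineIndependent_rotate hp k)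
  refine ⟨∑ k, K k, ENNReal.sum_ne_top.2 fun k _ => hK k, fun φ hφ x hx => ?_⟩
  have hle : ∀ k, K k ≤ ∑ k, K k := fun k =>
    Finset.single_le_sum (f := K) (fun _ _ => zero_le) (Finset.mem_univ k)
  suffices ∃ k z, 0 ≤ z 0 ∧ 0 ≤ z 1 ∧ z 0 + z 1 ≤ 2 / 3 ∧ triMap (fun i => p (i + k)) z = x by
    obtain ⟨k, z, h0, h1, h2, rfl⟩ := this
    have := h k z h0 h1 h2 φ hφ
    rw [openTri_rotate] at this
    exact this.trans (mul_le_mul' (hle k) le_rfl)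
  -- Some barycentric coordinate of x is at least 1/3. Taking the corresponding vertex as origin,
  -- the other two coordinates sum to at most 2/3.
  obtain ⟨z, rfl⟩ := triMap_surjective hp x
  rw [closure_openTri hp, triMap_mem_convexHull hp] at hx
  obtain ⟨h0, h1, h2⟩ := hx
  by_cases c0 : z 0 + z 1 ≤ 2 / 3
  · exact ⟨0, z, h0, h1, c0, by simp⟩
  by_cases c1 : 1 / 3 ≤ z 0
  · refine ⟨1, !₂[z 1, 1 - z 0 - z 1], by simpa, by simp; linarith, by simp; linarith, ?_⟩
    simp [triMap, show (2 : Fin 3) + 1 = 0 from rfl, show (1 : Fin 3) + 1 = 2 from rfl]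
    module
  · refine ⟨2, !₂[1 - z 0 - z 1, z 0], by simp; linarith, by simpa, by simp; linarith, ?_⟩
    simp [triMap, show (2 : Fin 3) + 2 = 1 from rfl, show (1 : Fin 3) + 2 = 0 from rfl]
    module

/-! ### Operations on Sobolev functions -/

theorem tsupport_pderiv_subset (i : Fin 2) (ψ : Plane → ℝ) : tsupport (pderiv i ψ) ⊆ tsupport ψ := by
  refine closure_minimal ?_ (isClosed_tsupport ψ)
  intro x hx
  have : x ∈ Function.support (fderiv ℝ ψ) := fun h => hx (by
    simp only [pderiv, h]; rfl)
  exact support_fderiv_subset ℝ this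

theorem isWeakDeriv_smooth {U : Set Plane} (hU : MeasurableSet U) {φ : Plane → ℝ}
    (hφ : ContDiff ℝ ∞ φ) (i : Fin 2) : IsWeakDeriv U i φ (pderiv i φ) := by
  intro ψ hψ hc hs
  have e : ∀ f g : Plane → ℝ, tsupport g ⊆ U → ∫ x in U, f x * g x = ∫ x, f x * g x := by
    intro f g hg
    rw [← integral_indicator hU]
    congr 1; ext x
    by_cases hx : x ∈ U
    · simp [hx]
    · have : g x = 0 := by
        by_contra h
        exact hx (hg (subset_tsupport g h))
      simp [hx, this]
  have hcp : HasCompactSupport (pderiv i ψ) :=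
    HasCompactSupport.of_support_subset_isCompact hc
      ((subset_tsupport _).trans (tsupport_pderiv_subset i ψ))
  rw [e _ _ ((tsupport_pderiv_subset i ψ).trans hs), e _ _ hs]
  have hcs : ∀ {f g : Plane → ℝ}, Continuous f → Continuous g → HasCompactSupport g →
      Integrable (fun x => f x * g x) := fun hf hg hgc =>
    (hf.mul hg).integrable_of_hasCompactSupport hgc.mul_left
  exact integral_mul_fderiv_eq_neg_fderiv_mul_of_integrable
    (hcs (contDiff_pderiv hφ i).continuous hψ.continuous hc)
    (hcs hφ.continuous (contDiff_pderiv hψ i).continuous hcp)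
    (hcs hφ.continuous hψ.continuous hc)
    (fun x _ => hφ.differentiable (by simp) x) (fun x _ => hψ.differentiable (by simp) x)

theorem isH1_smooth (p : Fin 3 → Plane) {φ : Plane → ℝ} (hφ : ContDiff ℝ ∞ φ) :
    IsH1 (openTri p) φ (fun i => pderiv i φ) :=
  ⟨memLp_smooth p hφ, fun i => memLp_smooth p (contDiff_pderiv hφ i),
    fun i => isWeakDeriv_smooth (measurableSet_openTri p) hφ i⟩

theorem memLp_testFunction {U : Set Plane} {ψ : Plane → ℝ} (hψ : Continuous ψ)
    (hc : HasCompactSupport ψ) : MemLp ψ 2 (volume.restrict U) :=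
  (hψ.memLp_of_hasCompactSupport hc).restrict U

theorem hasCompactSupport_pderiv {ψ : Plane → ℝ} (hc : HasCompactSupport ψ) (i : Fin 2) :
    HasCompactSupport (pderiv i ψ) :=
  HasCompactSupport.of_support_subset_isCompact hc
    ((subset_tsupport _).trans (tsupport_pderiv_subset i ψ))

theorem IsH1.sub {U : Set Plane} {u u' : Plane → ℝ} {g g' : Fin 2 → Plane → ℝ}
    (hu : IsH1 U u g) (hu' : IsH1 U u' g') :
    IsH1 U (fun x => u x - u' x) (fun i x => g i x - g' i x) := by
  refine ⟨hu.memLp.sub hu'.memLp, fun i => (hu.memLp_grad i).sub (hu'.memLp_grad i),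
    fun i ψ hψ hc hs => ?_⟩
  have m1 := memLp_testFunction (U := U) hψ.continuous hc
  have m2 := memLp_testFunction (U := U) (contDiff_pderiv hψ i).continuous
    (hasCompactSupport_pderiv hc i)
  simp only [sub_mul]
  have i1 : Integrable (fun x => u x * pderiv i ψ x) (volume.restrict U) := hu.memLp.integrable_mul m2
  have i2 : Integrable (fun x => u' x * pderiv i ψ x) (volume.restrict U) := hu'.memLp.integrable_mul m2
  have i3 : Integrable (fun x => g i x * ψ x) (volume.restrict U) := (hu.memLp_grad i).integrable_mul m1
  have i4 : Integrable (fun x => g' i x * ψ x) (volume.restrict U) :=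
    (hu'.memLp_grad i).integrable_mul m1
  rw [integral_sub i1 i2, integral_sub i3 i4, hu.weak i ψ hψ hc hs, hu'.weak i ψ hψ hc hs]
  ring

theorem IsH1.mono {U V : Set Plane} (hV : MeasurableSet V) (hU : MeasurableSet U) (hVU : V ⊆ U)
    {u : Plane → ℝ} {g : Fin 2 → Plane → ℝ} (hu : IsH1 U u g) : IsH1 V u g := by
  have hle : volume.restrict V ≤ volume.restrict U := Measure.restrict_mono hVU le_rfl
  refine ⟨hu.memLp.mono_measure hle, fun i => (hu.memLp_grad i).mono_measure hle,
    fun i ψ hψ hc hs => ?_⟩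
  have e : ∀ f g : Plane → ℝ, tsupport g ⊆ V → ∫ x in V, f x * g x = ∫ x in U, f x * g x := by
    intro f g hg
    rw [← integral_indicator hU, ← integral_indicator hV]
    congr 1; ext x
    by_cases hx : x ∈ V
    · simp [hx, hVU hx]
    · have : g x = 0 := by
        by_contra h
        exact hx (hg (subset_tsupport g h))
      by_cases hx' : x ∈ U <;> simp [hx, hx', this]
  rw [e _ _ ((tsupport_pderiv_subset i ψ).trans hs), e _ _ hs]
  exact hu.weak i ψ hψ hc (hs.trans hVU)

theorem IsH2.sub {U : Set Plane} {u u' : Plane → ℝ} {g g' : Fin 2 → Plane → ℝ}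
    {h h' : Fin 2 → Fin 2 → Plane → ℝ} (hu : IsH2 U u g h) (hu' : IsH2 U u' g' h') :
    IsH2 U (fun x => u x - u' x) (fun i x => g i x - g' i x) (fun i j x => h i j x - h' i j x) :=
  ⟨hu.isH1.sub hu'.isH1, fun i => (hu.isH1_grad i).sub (hu'.isH1_grad i)⟩

theorem IsH2.mono {U V : Set Plane} (hV : MeasurableSet V) (hU : MeasurableSet U) (hVU : V ⊆ U)
    {u : Plane → ℝ} {g : Fin 2 → Plane → ℝ} {h : Fin 2 → Fin 2 → Plane → ℝ} (hu : IsH2 U u g h) :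
    IsH2 V u g h :=
  ⟨hu.isH1.mono hV hU hVU, fun i => (hu.isH1_grad i).mono hV hU hVU⟩

theorem isH2_smooth (p : Fin 3 → Plane) {φ : Plane → ℝ} (hφ : ContDiff ℝ ∞ φ) :
    IsH2 (openTri p) φ (fun i => pderiv i φ) (fun i j => pderiv j (pderiv i φ)) :=
  ⟨isH1_smooth p hφ, fun i => isH1_smooth p (contDiff_pderiv hφ i)⟩

/-- The mixed weak derivatives agree. -/
theorem IsH2.ae_eq_swap {U : Set Plane} (hU : IsOpen U) (hUb : Bornology.IsBounded U)
    {u : Plane → ℝ} {g : Fin 2 → Plane → ℝ}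
    {h : Fin 2 → Fin 2 → Plane → ℝ} (hu : IsH2 U u g h) (i j : Fin 2) :
    h i j =ᵐ[volume.restrict U] h j i := by
  have : IsFiniteMeasure (volume.restrict U) := ⟨by simpa using hUb.measure_lt_top⟩
  have hsymm : ∀ ψ : Plane → ℝ, ContDiff ℝ ∞ ψ → pderiv i (pderiv j ψ) = pderiv j (pderiv i ψ) := by
    intro ψ hψ
    ext x
    have hd : DifferentiableAt ℝ (fderiv ℝ ψ) x :=
      (hψ.fderiv_right (m := ∞) (by simp)).differentiable (by simp) x
    have e : ∀ a b : Fin 2, pderiv a (pderiv b ψ) x =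
        fderiv ℝ (fderiv ℝ ψ) x (EuclideanSpace.single a 1) (EuclideanSpace.single b 1) := by
      intro a b
      rw [pderiv, show pderiv b ψ = fun y => fderiv ℝ ψ y (EuclideanSpace.single b 1) from rfl,
        fderiv_clm_apply hd (differentiableAt_const _)]
      simp
    rw [e, e]
    exact (hψ.contDiffAt.isSymmSndFDerivAt (by
      rw [minSmoothness_of_isRCLikeNormedField]
      exact WithTop.coe_le_coe.2 (OrderTop.le_top (2 : ℕ∞)))).eq _ _
  have hint : ∀ a b, IntegrableOn (h a b) U := fun a b =>
    ((hu.isH1_grad a).memLp_grad b).integrable (by norm_num)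
  have key := hU.ae_eq_zero_of_integral_contDiff_smul_eq_zero (μ := volume)
    (f := fun x => h i j x - h j i x) ((hint i j).sub (hint j i)).locallyIntegrableOn ?_
  · rw [Filter.EventuallyEq, ae_restrict_iff' hU.measurableSet]
    filter_upwards [key] with x hx hxU
    exact sub_eq_zero.1 (hx hxU)
  · intro ψ hψ hc hs
    have w : ∀ a b, ∫ x in U, ψ x * h a b x = ∫ x in U, u x * pderiv a (pderiv b ψ) x := by
      intro a b
      have h1 := (hu.isH1_grad a).weak b ψ hψ hc hs
      have h2 := hu.isH1.weak a (pderiv b ψ) (contDiff_pderiv hψ b) (hasCompactSupport_pderiv hc b)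
        ((tsupport_pderiv_subset b ψ).trans hs)
      simp only [mul_comm (ψ _)]
      rw [h2, h1, neg_neg]
    have e : ∫ x, ψ x • (h i j x - h j i x) = ∫ x in U, (ψ x * h i j x - ψ x * h j i x) := by
      rw [← integral_indicator hU.measurableSet]
      congr 1; ext x
      by_cases hx : x ∈ U
      · simp [hx, mul_sub]
      · have : ψ x = 0 := by
          by_contra h
          exact hx (hs (subset_tsupport ψ h))
        simp [hx, this]
    have m := memLp_testFunction (U := U) hψ.continuous hc
    have i1 : ∀ a b, Integrable (fun x => ψ x * h a b x) (volume.restrict U) := fun a b =>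
      m.integrable_mul ((hu.isH1_grad a).memLp_grad b)
    rw [e, integral_sub (i1 i j) (i1 j i), w, w, hsymm ψ hψ, sub_self]

/-! ### The continuous representative of an `H²` function -/

theorem tendsto_sobolevSum {U : Set Plane} {u : Plane → ℝ} {g : Fin 2 → Plane → ℝ}
    {h : Fin 2 → Fin 2 → Plane → ℝ} (hu : IsH2 U u g h) {φ : ℕ → Plane → ℝ}
    {ψ : ℕ → Fin 2 → Plane → ℝ} {χ : ℕ → Fin 2 → Fin 2 → Plane → ℝ}
    (hφ : ∀ m, IsH2 U (φ m) (ψ m) (χ m))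
    (h0 : Tendsto (fun m => l2Norm U (fun x => φ m x - u x)) atTop (𝓝 0))
    (h1 : ∀ i, Tendsto (fun m => l2Norm U (fun x => ψ m i x - g i x)) atTop (𝓝 0))
    (h2 : ∀ i j, Tendsto (fun m => l2Norm U (fun x => χ m i j x - h i j x)) atTop (𝓝 0)) :
    Tendsto (fun m => sobolevSum U (φ m) (ψ m) (χ m)) atTop (𝓝 (sobolevSum U u g h)) :=
  ((tendsto_eLpNorm_two (fun m => (hφ m).isH1.memLp) hu.isH1.memLp h0).add
    (tendsto_finsetSum _ fun i _ => tendsto_eLpNorm_two (fun m => (hφ m).isH1.memLp_grad i)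
      (hu.isH1.memLp_grad i) (h1 i))).add
    (tendsto_finsetSum _ fun i _ => tendsto_finsetSum _ fun j _ =>
      tendsto_eLpNorm_two (fun m => ((hφ m).isH1_grad i).memLp_grad j)
        ((hu.isH1_grad i).memLp_grad j) (h2 i j))

theorem l2Norm_sub_le {U : Set Plane} {a b f : Plane → ℝ} (ha : MemLp a 2 (volume.restrict U))
    (hb : MemLp b 2 (volume.restrict U)) (hf : MemLp f 2 (volume.restrict U)) :
    l2Norm U (fun x => a x - b x) ≤
      l2Norm U (fun x => a x - f x) + l2Norm U (fun x => b x - f x) := by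
  have e : (fun x => a x - b x) = (a - f) - (b - f) := by ext x; simp
  rw [l2Norm, e]
  exact eLpNorm_sub_le (ha.1.sub hf.1) (hb.1.sub hf.1) (by norm_num)

/-- An `H²` function on a triangle has a continuous representative, which is the pointwise limit
of smooth approximations and satisfies the Sobolev inequality. -/
theorem exists_continuous_rep {p : Fin 3 → Plane} (hp : AffineIndependent ℝ p) :
    ∃ K : ℝ≥0∞, K ≠ ⊤ ∧ ∀ u g h, IsH2 (openTri p) u g h →
      ∃ (v : Plane → ℝ) (φ : ℕ → Plane → ℝ), ContinuousOn v (closure (openTri p)) ∧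
        u =ᵐ[volume.restrict (openTri p)] v ∧
        (∀ x ∈ closure (openTri p), ‖v x‖ₑ ≤ K * sobolevSum (openTri p) u g h) ∧
        (∀ m, ContDiff ℝ ∞ (φ m)) ∧
        (∀ x ∈ closure (openTri p), Tendsto (fun m => φ m x) atTop (𝓝 (v x))) ∧
        (∀ i, Tendsto (fun m => l2Norm (openTri p) (fun x => pderiv i (φ m) x - g i x))
          atTop (𝓝 0)) ∧
        ∀ i j, Tendsto (fun m => l2Norm (openTri p) (fun x => pderiv j (pderiv i (φ m)) x - h i j x))
          atTop (𝓝 0) := by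
  obtain ⟨K, hK, hS⟩ := exists_sobolev_smooth hp
  refine ⟨K, hK, fun u g h hu => ?_⟩
  set T := openTri p with hT
  obtain ⟨φ, hφ, h0, h1, h2⟩ := hu.exists_smooth_approx (isOpen_openTri p) (convex_openTri p)
    (isBounded_openTri p) (nonempty_openTri hp)
  have hφH : ∀ m, IsH2 T (φ m) (fun i => pderiv i (φ m)) (fun i j => pderiv j (pderiv i (φ m))) :=
    fun m => isH2_smooth p (hφ m)
  -- This bound does not depend on x, so the smooth approximations converge uniformly on the closed
  -- triangle.
  set b : ℕ → ℝ≥0∞ := fun m => K * sobolevSum T (fun x => φ m x - u x)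
    (fun i x => pderiv i (φ m) x - g i x) (fun i j x => pderiv j (pderiv i (φ m)) x - h i j x) with hb
  have hbl : Tendsto b atTop (𝓝 0) := by
    have := ENNReal.Tendsto.const_mul (a := K) ((h0.add (tendsto_finsetSum Finset.univ fun i _ => h1 i)).add
      (tendsto_finsetSum Finset.univ fun i _ => tendsto_finsetSum Finset.univ fun j _ => h2 i j))
      (Or.inr hK)
    simp only [Finset.sum_const_zero, add_zero, mul_zero] at this
    exact this
  have hC : ∀ x ∈ closure T, ∀ m n, edist (φ m x) (φ n x) ≤ b m + b n := by
    intro x hx m n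
    have hs := hS _ ((hφ m).sub (hφ n)) x hx
    rw [edist_eq_enorm_sub]
    refine hs.trans ?_
    rw [hb, ← mul_add]
    refine mul_le_mul' le_rfl ?_
    have e1 : ∀ i, pderiv i (fun x => φ m x - φ n x) = fun x => pderiv i (φ m) x - pderiv i (φ n) x :=
      fun i => pderiv_sub (hφ m) (hφ n) i
    have e2 : ∀ i j, pderiv j (fun x => pderiv i (φ m) x - pderiv i (φ n) x) =
        fun x => pderiv j (pderiv i (φ m)) x - pderiv j (pderiv i (φ n)) x :=
      fun i j => pderiv_sub (contDiff_pderiv (hφ m) i) (contDiff_pderiv (hφ n) i) j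
    simp only [sobolevSum, e1, e2]
    calc _ ≤ (_ + _) + ∑ i, (_ + _) + ∑ i, ∑ j, (_ + _) := add_le_add (add_le_add
          (l2Norm_sub_le (hφH m).isH1.memLp (hφH n).isH1.memLp hu.isH1.memLp)
          (Finset.sum_le_sum fun i _ => l2Norm_sub_le ((hφH m).isH1.memLp_grad i)
            ((hφH n).isH1.memLp_grad i) (hu.isH1.memLp_grad i)))
          (Finset.sum_le_sum fun i _ => Finset.sum_le_sum fun j _ =>
            l2Norm_sub_le (((hφH m).isH1_grad i).memLp_grad j)
            (((hφH n).isH1_grad i).memLp_grad j) ((hu.isH1_grad i).memLp_grad j))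
      _ = _ := by simp only [Finset.sum_add_distrib]; ring
  have hlim : ∀ x ∈ closure T, ∃ a, Tendsto (fun m => φ m x) atTop (𝓝 a) := by
    intro x hx
    refine cauchySeq_tendsto_of_complete (EMetric.cauchySeq_iff.2 fun ε hε => ?_)
    obtain ⟨N, hN⟩ := eventually_atTop.1 (hbl.eventually (gt_mem_nhds (ENNReal.half_pos hε.ne')))
    refine ⟨N, fun m hm n hn => (hC x hx m n).trans_lt ?_⟩
    calc b m + b n < ε / 2 + ε / 2 := ENNReal.add_lt_add (hN m hm) (hN n hn)
      _ = ε := ENNReal.add_halves ε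
  choose! v hv using hlim
  have hbd : ∀ x ∈ closure T, ∀ m, edist (φ m x) (v x) ≤ b m := by
    intro x hx m
    have l1 := (tendsto_const_nhds (x := φ m x)).edist (hv x hx)
    have l2 : Tendsto (fun n => b m + b n) atTop (𝓝 (b m + 0)) := tendsto_const_nhds.add hbl
    rw [add_zero] at l2
    exact le_of_tendsto_of_tendsto' l1 l2 fun n => hC x hx m n
  have hvc : ContinuousOn v (closure T) := by
    refine TendstoUniformlyOn.continuousOn (F := φ) (p := atTop) ?_
      (Frequently.of_forall fun m => (hφ m).continuous.continuousOn)
    rw [EMetric.tendstoUniformlyOn_iff]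
    intro ε hε
    filter_upwards [hbl.eventually (gt_mem_nhds hε)] with m hm x hx
    rw [edist_comm]
    exact (hbd x hx m).trans_lt hm
  have hTm := measurableSet_openTri p
  have hvm : AEStronglyMeasurable v (volume.restrict T) :=
    (hvc.mono subset_closure).aestronglyMeasurable hTm
  have huv : u =ᵐ[volume.restrict T] v := by
    have hz : eLpNorm (fun x => u x - v x) 2 (volume.restrict T) = 0 := by
      have l : Tendsto (fun m => l2Norm T (fun x => φ m x - u x) + b m * volume T ^ (1 / 2 : ℝ)) atTop
          (𝓝 (0 + 0 * volume T ^ (1 / 2 : ℝ))) :=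
        h0.add (ENNReal.Tendsto.mul_const hbl (Or.inr
          (ENNReal.rpow_ne_top_of_nonneg (by norm_num) (volume_openTri_ne_top p))))
      rw [zero_mul, add_zero] at l
      refine le_antisymm (ge_of_tendsto' l fun m => ?_) zero_le
      have e : (fun x => u x - v x) = (fun x => φ m x - v x) - fun x => φ m x - u x := by
        ext x; simp
      rw [e, add_comm]
      refine (eLpNorm_sub_le ((hφ m).continuous.aestronglyMeasurable.sub hvm)
        ((hφ m).continuous.aestronglyMeasurable.sub hu.isH1.memLp.1) (by norm_num)).trans
        (add_le_add ?_ le_rfl)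
      refine (eLpNorm_le_of_ae_enorm_bound (C := b m) (ae_restrict_of_forall_mem hTm fun x hx => ?_)).trans ?_
      · rw [Pi.sub_apply, ← edist_eq_enorm_sub]; exact hbd x (subset_closure hx) m
      · simp [hT]
    replace hz := (eLpNorm_eq_zero_iff (hu.isH1.memLp.1.sub hvm) (by norm_num)).1 hz
    filter_upwards [hz] with x hx
    exact sub_eq_zero.1 hx
  refine ⟨v, φ, hvc, huv, fun x hx => ?_, hφ, hv, h1, h2⟩
  refine le_of_tendsto_of_tendsto' ((continuous_enorm.tendsto _).comp (hv x hx))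
    (ENNReal.Tendsto.const_mul (tendsto_sobolevSum hu hφH h0 h1 h2) (Or.inr hK))
    fun m => hS _ (hφ m) x hx

/-! ### Point values and tangential derivatives -/

theorem eqOn_closure_of_ae_eq {U : Set Plane} (hU : IsOpen U) {v w : Plane → ℝ}
    (hv : ContinuousOn v (closure U)) (hw : ContinuousOn w (closure U))
    (h : v =ᵐ[volume.restrict U] w) : Set.EqOn v w (closure U) :=
  (Measure.eqOn_open_of_ae_eq h hU (hv.mono subset_closure) (hw.mono subset_closure)).of_subset_closure
    hv hw subset_closure subset_rfl

/-- Two continuous representatives agree on U and therefore on its closure, so point values may be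
read off from any of them. -/
theorem HasPointValue.eq {U : Set Plane} (hU : IsOpen U) {u v : Plane → ℝ} {x : Plane} {c : ℝ}
    (h : HasPointValue U u x c) (hv : ContinuousOn v (closure U))
    (huv : u =ᵐ[volume.restrict U] v) (hx : x ∈ closure U) : v x = c := by
  obtain ⟨w, hw, huw, rfl⟩ := h
  exact eqOn_closure_of_ae_eq hU hv hw (huv.symm.trans huw) hx

theorem integral_edge_dderiv (p : Fin 3 → Plane) (k : Fin 3) {φ : Plane → ℝ}
    (hφ : ContDiff ℝ ∞ φ) :
    ∫ x, dderiv (p (k + 2) - p (k + 1)) φ x ∂(edge p k) =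
      dist (p (k + 1)) (p (k + 2)) * (φ (p (k + 2)) - φ (p (k + 1))) := by
  have hc := (contDiff_dderiv hφ (p (k + 2) - p (k + 1))).continuous
  rw [edge, integral_edgeMeasure _ _ hc]
  congr 1
  have e : ∀ t : ℝ, AffineMap.lineMap (p (k + 1)) (p (k + 2)) t =
      p (k + 1) + t • (p (k + 2) - p (k + 1)) := fun t => by
    rw [AffineMap.lineMap_apply, vsub_eq_sub, vadd_eq_add, add_comm]
  simp only [e]
  rw [intervalIntegral.integral_eq_sub_of_hasDerivAt
    (fun t _ => hasDerivAt_line hφ (p (k + 1)) (p (k + 2) - p (k + 1)) t)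
    ((hc.comp (by fun_prop)).intervalIntegrable _ _)]
  simp

/-- The tangential derivative of an `H²` function vanishing at the vertices has mean zero on each
edge. -/
theorem sum_edgeFunctional_tangent_eq_zero {p : Fin 3 → Plane} (hp : AffineIndependent ℝ p)
    {u : Plane → ℝ} {g : Fin 2 → Plane → ℝ} {h : Fin 2 → Fin 2 → Plane → ℝ}
    (hu : IsH2 (openTri p) u g h) (h0 : ∀ k, HasPointValue (openTri p) u (p k) 0) (k : Fin 3) :
    ∑ i, (p (k + 2) - p (k + 1)) i * edgeFunctional p k (g i) (h i) = 0 := by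
  obtain ⟨K, -, hrep⟩ := exists_continuous_rep hp
  obtain ⟨v, φ, hvc, huv, -, hφ, hv, h1, h2⟩ := hrep u g h hu
  have hvz : ∀ k, v (p k) = 0 := fun k =>
    (h0 k).eq (isOpen_openTri p) hvc huv (vertex_mem_closure hp k)
  set d := p (k + 2) - p (k + 1)
  have l1 : Tendsto (fun m => ∑ i, d i * edgeFunctional p k (pderiv i (φ m))
      (fun j => pderiv j (pderiv i (φ m)))) atTop
      (𝓝 (∑ i, d i * edgeFunctional p k (g i) (h i))) := by
    refine tendsto_finsetSum _ fun i _ => Tendsto.const_mul _ ?_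
    exact tendsto_edgeFunctional p k (hu.isH1.memLp_grad i) (hu.isH1_grad i).memLp_grad
      (fun m => memLp_smooth p (contDiff_pderiv (hφ m) i))
      (fun m j => memLp_smooth p (contDiff_pderiv (contDiff_pderiv (hφ m) i) j)) (h1 i) (h2 i)
  have l2 : Tendsto (fun m => dist (p (k + 1)) (p (k + 2)) *
      (φ m (p (k + 2)) - φ m (p (k + 1)))) atTop (𝓝 0) := by
    have := ((hv _ (vertex_mem_closure hp (k + 2))).sub
      (hv _ (vertex_mem_closure hp (k + 1)))).const_mul (dist (p (k + 1)) (p (k + 2)))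
    simpa [hvz] using this
  -- For smooth functions the integral of the tangential derivative over an edge is a difference of
  -- vertex values. It is expanded here in the two coordinate derivatives, so that the limit can be
  -- taken in the edge functionals.
  have e : ∀ m, dist (p (k + 1)) (p (k + 2)) * (φ m (p (k + 2)) - φ m (p (k + 1))) =
      edgeConst hp k * ∑ i, d i * edgeFunctional p k (pderiv i (φ m))
        (fun j => pderiv j (pderiv i (φ m))) := by
    intro m
    rw [← integral_edge_dderiv p k (hφ m)]
    simp only [dderiv, fderiv_eq_sum_pderiv]
    rw [integral_finsetSum, Finset.mul_sum]
    · refine Finset.sum_congr rfl fun i _ => ?_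
      rw [integral_const_mul, integral_edge_eq hp k (contDiff_pderiv (hφ m) i)]
      ring
    · intro i _
      exact (((contDiff_pderiv (hφ m) i).continuous.memLp_edgeMeasure (p (k + 1))
        (p (k + 2))).integrable (by norm_num)).const_mul _
  have l3 := l1.const_mul (edgeConst hp k)
  simp only [← e] at l3
  have := tendsto_nhds_unique l3 l2
  exact (mul_eq_zero.1 this).resolve_left (edgeConst_pos hp k).ne'

/-! ### Quadratic polynomials -/

/-- The quadratic polynomial with Hessian `H`, linear coefficients `b` and constant term `c`. -/
def quad (H : Fin 2 → Fin 2 → ℝ) (b : Fin 2 → ℝ) (c : ℝ) (x : Plane) : ℝ :=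
  (∑ i, ∑ j, H i j * x i * x j) / 2 + ∑ i, b i * x i + c

theorem contDiff_coord (i : Fin 2) : ContDiff ℝ ∞ fun x : Plane => x i :=
  (EuclideanSpace.proj (𝕜 := ℝ) i).contDiff

theorem contDiff_quad (H : Fin 2 → Fin 2 → ℝ) (b : Fin 2 → ℝ) (c : ℝ) :
    ContDiff ℝ ∞ (quad H b c) := by
  have h0 := contDiff_coord 0
  have h1 := contDiff_coord 1
  unfold quad
  simp only [Fin.sum_univ_two]
  fun_prop

theorem hasFDerivAt_coord (i : Fin 2) (x : Plane) :
    HasFDerivAt (fun x : Plane => x i) (EuclideanSpace.proj (𝕜 := ℝ) i) x :=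
  (EuclideanSpace.proj (𝕜 := ℝ) i).hasFDerivAt

theorem pderiv_quad {H : Fin 2 → Fin 2 → ℝ} (hH : ∀ i j, H i j = H j i) (b : Fin 2 → ℝ) (c : ℝ)
    (i : Fin 2) : pderiv i (quad H b c) = fun x => ∑ j, H i j * x j + b i := by
  ext x
  have h0 := hasFDerivAt_coord 0 x
  have h1 := hasFDerivAt_coord 1 x
  have e : quad H b c = fun x => (H 0 0 / 2) * (x 0 * x 0) + H 0 1 * (x 0 * x 1) +
      (H 1 1 / 2) * (x 1 * x 1) + b 0 * x 0 + b 1 * x 1 + c := by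
    ext y; simp only [quad, Fin.sum_univ_two, hH 1 0]; ring
  have hd := ((((((h0.mul h0).const_mul (H 0 0 / 2)).add ((h0.mul h1).const_mul (H 0 1))).add
    ((h1.mul h1).const_mul (H 1 1 / 2))).add (h0.const_mul (b 0))).add (h1.const_mul (b 1))).add_const c
  have hd' := hd.congr_of_eventuallyEq (f₁ := quad H b c)
    (Eventually.of_forall fun y => by rw [e]; rfl)
  rw [pderiv, hd'.fderiv]
  fin_cases i <;> simp [Fin.sum_univ_two, hH 1 0] <;> ring

theorem pderiv_pderiv_quad {H : Fin 2 → Fin 2 → ℝ} (hH : ∀ i j, H i j = H j i) (b : Fin 2 → ℝ)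
    (c : ℝ) (i j : Fin 2) : pderiv j (pderiv i (quad H b c)) = fun _ => H i j := by
  rw [pderiv_quad hH]
  ext x
  have h0 := hasFDerivAt_coord 0 x
  have h1 := hasFDerivAt_coord 1 x
  have hd := ((h0.const_mul (H i 0)).add (h1.const_mul (H i 1))).add_const (b i)
  have hd' := hd.congr_of_eventuallyEq (f₁ := fun x : Plane => ∑ j, H i j * x j + b i)
    (Eventually.of_forall fun y => by simp only [Fin.sum_univ_two]; rfl)
  rw [pderiv, hd'.fderiv]
  fin_cases j <;> simp

/-! ### Finiteness of the constants -/

/-- The trace exists, and its integral is a positive multiple of the functional. From here on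
membership in V^{1,2} is tested by integrals over the triangle. -/
theorem isV12_iff {p : Fin 3 → Plane} (hp : AffineIndependent ℝ p) {u : Plane → ℝ}
    {g : Fin 2 → Plane → ℝ} :
    IsV12 p u g ↔ IsH1 (openTri p) u g ∧ ∀ k, edgeFunctional p k u g = 0 := by
  refine and_congr_right fun hu => forall_congr' fun k => ⟨?_, fun h => ?_⟩
  · rintro ⟨θ, hθ, h0⟩
    rw [hθ.integral_eq hp hu] at h0
    exact (mul_eq_zero.1 h0).resolve_left (edgeConst_pos hp k).ne'
  · obtain ⟨θ, hθ⟩ := hu.exists_isEdgeTrace hp k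
    exact ⟨θ, hθ, by rw [hθ.integral_eq hp hu, h, mul_zero]⟩

theorem enorm_integral_mul_le {U : Set Plane} {w f : Plane → ℝ}
    (hw : MemLp w 2 (volume.restrict U)) (hf : MemLp f 2 (volume.restrict U)) :
    ‖∫ x in U, w x * f x‖ₑ ≤ l2Norm U w * l2Norm U f := by
  refine (enorm_integral_le_lintegral_enorm _).trans ?_
  rw [← sq_le_sq_iff_ennreal, mul_pow, l2Norm_sq, l2Norm_sq]
  simp only [enorm_mul]
  exact lintegral_mul_sq_le hw.1.enorm hf.1.enorm

theorem gradNorm_le_sum (U : Set Plane) (g : Fin 2 → Plane → ℝ) :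
    gradNorm U g ≤ ∑ i, l2Norm U (g i) := by
  rw [← sq_le_sq_iff_ennreal, gradNorm_sq]
  simp only [Fin.sum_univ_two]
  calc _ ≤ l2Norm U (g 0) ^ 2 + l2Norm U (g 1) ^ 2 + 2 * l2Norm U (g 0) * l2Norm U (g 1) := le_self_add
    _ = _ := by ring

theorem C1_ne_top {p : Fin 3 → Plane} (hp : AffineIndependent ℝ p) : C1 p ≠ ⊤ := by
  obtain ⟨K, hK, h⟩ := exists_poincare (isOpen_openTri p) (convex_openTri p) (isBounded_openTri p)
    (nonempty_openTri hp)
  refine ne_top_of_le_ne_top hK (sSup_le ?_)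
  rintro r ⟨u, g, ⟨hu, h0⟩, -, rfl⟩
  have := h u g hu
  simp only [mean, h0, mul_zero, sub_zero] at this
  exact ENNReal.div_le_of_le_mul this

/-- A single vanishing edge functional reads 2∫u = -∫(x - p₀)·∇u and so bounds the mean of u by its
gradient. The Poincaré inequality controls the rest. -/
theorem C2_ne_top {p : Fin 3 → Plane} (hp : AffineIndependent ℝ p) : C2 p ≠ ⊤ := by
  obtain ⟨K, hK, h⟩ := exists_poincare (isOpen_openTri p) (convex_openTri p) (isBounded_openTri p)
    (nonempty_openTri hp)
  set T := openTri p
  set W : ℝ≥0∞ := ∑ i, l2Norm T (fun x => x i - p 0 i)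
  have hW : W ≠ ⊤ := ENNReal.sum_ne_top.2 fun i _ => (memLp_coord_sub p i _).eLpNorm_lt_top.ne
  have hV : volume T ^ (1 / 2 : ℝ) ≠ ⊤ :=
    ENNReal.rpow_ne_top_of_nonneg (by norm_num) (volume_openTri_ne_top p)
  refine ne_top_of_le_ne_top (b := K + ‖(volume.real T)⁻¹ / 2‖ₑ * W * volume T ^ (1 / 2 : ℝ))
    (by finiteness) (sSup_le ?_)
  rintro r ⟨u, g, hu, -, rfl⟩
  obtain ⟨hu, hE⟩ := (isV12_iff hp).1 hu
  refine ENNReal.div_le_of_le_mul ?_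
  have h1 := h u g hu
  have h2 := hE 0
  rw [edgeFunctional_eq p 0 hu.memLp hu.memLp_grad] at h2
  have h3 : mean T u = -((volume.real T)⁻¹ / 2 * ∑ i, ∫ x in T, (x i - p 0 i) * g i x) := by
    rw [mean]; linear_combination ((volume.real T)⁻¹ / 2) * h2
  have h4 : ‖mean T u‖ₑ ≤ ‖(volume.real T)⁻¹ / 2‖ₑ * (W * gradNorm T g) := by
    rw [h3, enorm_neg, enorm_mul, Finset.sum_mul]
    refine mul_le_mul' le_rfl ((enorm_sum_le _ _).trans (Finset.sum_le_sum fun i _ => ?_))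
    exact (enorm_integral_mul_le (memLp_coord_sub p i _) (hu.memLp_grad i)).trans
      (mul_le_mul' le_rfl (l2Norm_le_gradNorm _ _ i))
  have e : u = (fun x => u x - mean T u) + fun _ => mean T u := by ext x; simp
  calc l2Norm T u ≤ l2Norm T (fun x => u x - mean T u) + l2Norm T (fun _ => mean T u) := by
        conv_lhs => rw [l2Norm, e]
        exact eLpNorm_add_le (hu.memLp.1.sub aestronglyMeasurable_const) aestronglyMeasurable_const
          (by norm_num)
    _ ≤ K * gradNorm T g + ‖(volume.real T)⁻¹ / 2‖ₑ * (W * gradNorm T g) * volume T ^ (1 / 2 : ℝ) := by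
        refine add_le_add h1 ?_
        refine (eLpNorm_le_of_ae_enorm_bound (ae_of_all _ fun x => h4)).trans ?_
        simp
    _ = _ := by ring

theorem abs_affine_le {p : Fin 3 → Plane} (hp : AffineIndependent ℝ p) (b : Fin 2 → ℝ) (c : ℝ)
    {x : Plane} (hx : x ∈ openTri p) : |quad 0 b c x| ≤ ∑ k, |quad 0 b c (p k)| := by
  obtain ⟨z, rfl⟩ := triMap_surjective hp x
  obtain ⟨h0, h1, h2⟩ := (triMap_mem_openTri hp z).1 hx
  have e : quad 0 b c (triMap p z) = (1 - z 0 - z 1) * quad 0 b c (p 0) + z 0 * quad 0 b c (p 1) +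
      z 1 * quad 0 b c (p 2) := by
    simp [quad, triMap, Fin.sum_univ_two]; ring
  rw [e, Fin.sum_univ_three]
  have ha : ∀ t y : ℝ, 0 ≤ t → t ≤ 1 → |t * y| ≤ |y| := fun t y h0 h1 => by
    rw [abs_mul, abs_of_nonneg h0]; exact mul_le_of_le_one_left (abs_nonneg y) h1
  refine (abs_add_three _ _ _).trans (add_le_add_three ?_ ?_ ?_) <;> apply ha <;> linarith

/-- Let u be split into an affine function and a remainder, where the affine function carries the
mean gradient and the mean value. Two applications of Poincaré bound the full H² norm of the
remainder by the Hessian, and the Sobolev inequality then bounds it uniformly by some s. At the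
vertices u vanishes, so the affine part is at most s there and, by `abs_affine_le`, at most 3s
inside. Hence |u| ≤ 4s. -/
theorem C3_ne_top {p : Fin 3 → Plane} (hp : AffineIndependent ℝ p) : C3 p ≠ ⊤ := by
  obtain ⟨K₁, hK₁, hP⟩ := exists_poincare (isOpen_openTri p) (convex_openTri p) (isBounded_openTri p)
    (nonempty_openTri hp)
  obtain ⟨K₂, hK₂, hS⟩ := exists_continuous_rep hp
  set T := openTri p
  have hV : volume T ^ (1 / 2 : ℝ) ≠ ⊤ :=
    ENNReal.rpow_ne_top_of_nonneg (by norm_num) (volume_openTri_ne_top p)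
  refine ne_top_of_le_ne_top (b := 4 * (K₂ * (K₁ * (2 * K₁) + 2 * K₁ + 4)) * volume T ^ (1 / 2 : ℝ))
    (by finiteness) (sSup_le ?_)
  rintro r ⟨u, g, h, ⟨hu, h0⟩, -, rfl⟩
  refine ENNReal.div_le_of_le_mul ?_
  set N := hessNorm T h
  set m : Fin 2 → ℝ := fun i => mean T (g i)
  set c : ℝ := mean T (fun x => u x - quad 0 m 0 x)
  have hz : ∀ i j : Fin 2, (0 : Fin 2 → Fin 2 → ℝ) i j = (0 : Fin 2 → Fin 2 → ℝ) j i := fun _ _ => rfl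
  have hd1 : ∀ c i, pderiv i (quad 0 m c) = fun _ => m i := fun c i => by
    rw [pderiv_quad hz]; simp
  have hd2 : ∀ (j : Fin 2) (a : ℝ), pderiv j (fun _ => a) = fun _ => 0 := fun j a => by
    ext x; simp [pderiv]
  have hq : ∀ x, quad 0 m c x = quad 0 m 0 x + c := fun x => by simp [quad]
  have H : ∀ c, IsH2 T (fun x => u x - quad 0 m c x) (fun i x => g i x - m i) h := by
    intro c
    have := hu.sub (isH2_smooth p (contDiff_quad 0 m c))
    simpa only [hd1, hd2, sub_zero] using this
  obtain ⟨v, -, hvc, huv, hvb, -⟩ := hS _ _ _ (H c)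
  have b2 : ∀ i, l2Norm T (fun x => g i x - m i) ≤ K₁ * N := fun i =>
    (hP (g i) (h i) (hu.isH1_grad i)).trans (mul_le_mul' le_rfl (gradNorm_le_hessNorm T h i))
  have b1 : l2Norm T (fun x => u x - quad 0 m c x) ≤ K₁ * (2 * K₁) * N := by
    have e : (fun x => u x - quad 0 m c x) = fun x => (u x - quad 0 m 0 x) - c := by
      ext x; rw [hq]; ring
    rw [e]
    refine (hP _ _ (H 0).isH1).trans ?_
    rw [mul_assoc]
    refine mul_le_mul' le_rfl ((gradNorm_le_sum T _).trans ?_)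
    calc _ ≤ ∑ _i : Fin 2, K₁ * N := Finset.sum_le_sum fun i _ => b2 i
      _ = _ := by simp; ring
  have b3 : ∀ i j, l2Norm T (h i j) ≤ N := fun i j =>
    (l2Norm_le_gradNorm T (h i) j).trans (gradNorm_le_hessNorm T h i)
  have bS : sobolevSum T (fun x => u x - quad 0 m c x) (fun i x => g i x - m i) h ≤
      (K₁ * (2 * K₁) + 2 * K₁ + 4) * N := by
    calc _ ≤ K₁ * (2 * K₁) * N + ∑ _i : Fin 2, K₁ * N + ∑ _i : Fin 2, ∑ _j : Fin 2, N :=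
          add_le_add (add_le_add b1 (Finset.sum_le_sum fun i _ => b2 i))
            (Finset.sum_le_sum fun i _ => Finset.sum_le_sum fun j _ => b3 i j)
      _ = _ := by simp; ring
  set s := K₂ * (K₁ * (2 * K₁) + 2 * K₁ + 4) * N with hs
  have hvs : ∀ x ∈ closure T, ‖v x‖ₑ ≤ s := fun x hx => (hvb x hx).trans (by
    rw [hs, mul_assoc]; exact mul_le_mul' le_rfl bS)
  have hqc := (contDiff_quad 0 m c).continuous
  have hae : u =ᵐ[volume.restrict T] fun x => v x + quad 0 m c x := by
    filter_upwards [huv] with x hx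
    rw [← hx]; ring
  have hk : ∀ k, quad 0 m c (p k) = -v (p k) := fun k => by
    have := (h0 k).eq (isOpen_openTri p) (v := fun x => v x + quad 0 m c x)
      (hvc.add hqc.continuousOn) hae (vertex_mem_closure hp k)
    linarith
  have hqs : ∀ x ∈ T, ‖quad 0 m c x‖ₑ ≤ 3 * s := fun x hx => by
    have h1 := ENNReal.ofReal_le_ofReal (abs_affine_le hp m c hx)
    rw [ENNReal.ofReal_sum_of_nonneg fun _ _ => abs_nonneg _] at h1
    simp only [← Real.enorm_eq_ofReal_abs, hk, enorm_neg] at h1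
    calc _ ≤ _ := h1
      _ ≤ ∑ _k : Fin 3, s := Finset.sum_le_sum fun k _ => hvs _ (vertex_mem_closure hp k)
      _ = _ := by simp
  have hus : ∀ᵐ x ∂(volume.restrict T), ‖u x‖ₑ ≤ 4 * s := by
    filter_upwards [hae, ae_restrict_mem (measurableSet_openTri p)] with x hx hxT
    rw [hx]
    calc _ ≤ _ := enorm_add_le _ _
      _ ≤ s + 3 * s := add_le_add (hvs x (subset_closure hxT)) (hqs x hxT)
      _ = _ := by ring
  refine (eLpNorm_le_of_ae_enorm_bound hus).trans (le_of_eq ?_)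
  rw [hs]
  simp
  ring

/-! ### The interpolations and their orthogonality properties -/

theorem gradNorm_sq_eq_add {U : Set Plane} {f a : Fin 2 → Plane → ℝ}
    (hf : ∀ i, MemLp (f i) 2 (volume.restrict U)) (ha : ∀ i, MemLp (a i) 2 (volume.restrict U))
    (h : ∑ i, ∫ x in U, a i x * (f i x - a i x) = 0) :
    gradNorm U f ^ 2 = gradNorm U a ^ 2 + gradNorm U (fun i x => f i x - a i x) ^ 2 := by
  have hd : ∀ i, MemLp (fun x => f i x - a i x) 2 (volume.restrict U) := fun i => (hf i).sub (ha i)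
  have hn : ∀ k : Fin 2 → Plane → ℝ, (∀ i, MemLp (k i) 2 (volume.restrict U)) →
      gradNorm U k ^ 2 = ENNReal.ofReal (∑ i, ∫ x in U, k i x ^ 2) := fun k hk => by
    rw [gradNorm_sq, ENNReal.ofReal_sum_of_nonneg fun i _ => integral_nonneg fun x => sq_nonneg _]
    exact Finset.sum_congr rfl fun i _ => l2Norm_sq_eq_ofReal (hk i)
  rw [hn f hf, hn a ha, hn _ hd, ← ENNReal.ofReal_add
    (Finset.sum_nonneg fun i _ => integral_nonneg fun x => sq_nonneg _)
    (Finset.sum_nonneg fun i _ => integral_nonneg fun x => sq_nonneg _)]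
  congr 1
  have e : ∀ i, ∫ x in U, f i x ^ 2 = (∫ x in U, a i x ^ 2) + (∫ x in U, (f i x - a i x) ^ 2) +
      2 * ∫ x in U, a i x * (f i x - a i x) := by
    intro i
    have i1 := (ha i).integrable_sq
    have i2 := (hd i).integrable_sq
    have i3 : Integrable (fun x => a i x * (f i x - a i x)) (volume.restrict U) :=
      (ha i).integrable_mul (hd i)
    have i4 : Integrable (fun x => a i x ^ 2 + (f i x - a i x) ^ 2) (volume.restrict U) := i1.add i2
    rw [← integral_const_mul, ← integral_add i1 i2, ← integral_add i4 (i3.const_mul 2)]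
    congr 1; ext x; ring
  simp only [e, Finset.sum_add_distrib, ← Finset.mul_sum, h, mul_zero, add_zero]

theorem integral_mul_mean {U : Set Plane} (hU : volume U ≠ 0) (hUt : volume U ≠ ⊤) (u : Plane → ℝ) :
    volume.real U * mean U u = ∫ x in U, u x := by
  rw [mean, mul_inv_cancel_left₀]
  rw [measureReal_def]; exact (ENNReal.toReal_pos hU hUt).ne'

theorem integral_sub_mean {p : Fin 3 → Plane} (hp : AffineIndependent ℝ p) {u : Plane → ℝ}
    (hu : MemLp u 2 (volume.restrict (openTri p))) :
    ∫ x in openTri p, (u x - mean (openTri p) u) = 0 := by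
  rw [integral_sub (hu.integrable (by norm_num)) (integrable_const _), setIntegral_const, smul_eq_mul,
    integral_mul_mean (volume_openTri_ne_zero hp) (volume_openTri_ne_top p), sub_self]

theorem edgeFunctional_sub (p : Fin 3 → Plane) (k : Fin 3) {u u' : Plane → ℝ}
    {g g' : Fin 2 → Plane → ℝ} (hu : IsH1 (openTri p) u g) (hu' : IsH1 (openTri p) u' g') :
    edgeFunctional p k (fun x => u x - u' x) (fun i x => g i x - g' i x) =
      edgeFunctional p k u g - edgeFunctional p k u' g' := by
  have hd := hu.sub hu'
  rw [edgeFunctional_eq p k hd.memLp hd.memLp_grad, edgeFunctional_eq p k hu.memLp hu.memLp_grad,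
    edgeFunctional_eq p k hu'.memLp hu'.memLp_grad,
    integral_sub (hu.memLp.integrable (by norm_num)) (hu'.memLp.integrable (by norm_num))]
  have e : ∀ i, ∫ x in openTri p, (x i - p k i) * (g i x - g' i x) =
      (∫ x in openTri p, (x i - p k i) * g i x) - ∫ x in openTri p, (x i - p k i) * g' i x := by
    intro i
    have i1 : Integrable (fun x : Plane => (x i - p k i) * g i x) (volume.restrict (openTri p)) :=
      (memLp_coord_sub p i _).integrable_mul (hu.memLp_grad i)
    have i2 : Integrable (fun x : Plane => (x i - p k i) * g' i x) (volume.restrict (openTri p)) :=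
      (memLp_coord_sub p i _).integrable_mul (hu'.memLp_grad i)
    rw [← integral_sub i1 i2]
    simp only [mul_sub]
  simp only [e, Finset.sum_sub_distrib]
  ring

/-! ### Existence of the two interpolants -/

/-- The gradient of q is the L² projection of g onto the span of the field x - x̄ and the constant
fields, and the constant term of q fixes the mean value. The error gradient is then orthogonal to
every field x - a. The choice a = p_k gives the edge conditions, and orthogonality to the gradient
of q gives Pythagoras. -/
theorem exists_interp_α {p : Fin 3 → Plane} (hp : AffineIndependent ℝ p) {u : Plane → ℝ}
    {g : Fin 2 → Plane → ℝ} (hu : IsH1 (openTri p) u g) :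
    ∃ q ∈ Qα, ContDiff ℝ ∞ q ∧ IsInterpα p u g q ∧ ∫ x in openTri p, (u x - q x) = 0 ∧
      (∀ k, edgeFunctional p k (fun x => u x - q x) (fun i x => g i x - pderiv i q x) = 0) ∧
      gradNorm (openTri p) g ^ 2 = gradNorm (openTri p) (fun i => pderiv i q) ^ 2 +
        gradNorm (openTri p) (fun i x => g i x - pderiv i q x) ^ 2 := by
  set T := openTri p with hT
  have hT0 := volume_openTri_ne_zero hp
  have hTt := volume_openTri_ne_top p
  set xb : Fin 2 → ℝ := fun i => mean T (fun x => x i)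
  set y : Fin 2 → Plane → ℝ := fun i x => x i - xb i
  have hy : ∀ i, MemLp (y i) 2 (volume.restrict T) := fun i => memLp_coord_sub p i _
  have hy0 : ∀ i, ∫ x in T, y i x = 0 := fun i =>
    integral_sub_mean hp (memLp_smooth p (contDiff_coord i))
  set S := ∑ i, ∫ x in T, y i x ^ 2
  set R := ∑ i, ∫ x in T, y i x * g i x
  -- The normal equation for the coefficient of x - x̄. When S = 0, Cauchy-Schwarz gives R = 0 and
  -- any κ will do, so positivity of S need not be shown.
  obtain ⟨κ, hκ⟩ : ∃ κ, κ * S = R := by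
    by_cases hS : S = 0
    · refine ⟨0, ?_⟩
      have h0 : ∀ i, ∫ x in T, y i x ^ 2 = 0 := fun i =>
        (Finset.sum_eq_zero_iff_of_nonneg fun i _ => integral_nonneg fun x => sq_nonneg _).1 hS i
          (Finset.mem_univ i)
      rw [zero_mul, eq_comm]
      refine Finset.sum_eq_zero fun i _ => ?_
      have h1 := enorm_integral_mul_le (hy i) (hu.memLp_grad i)
      have h2 : l2Norm T (y i) = 0 := by
        have := l2Norm_sq_eq_ofReal (hy i)
        rw [h0 i, ENNReal.ofReal_zero] at this
        exact pow_eq_zero_iff (by norm_num) |>.1 this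
      rw [h2, zero_mul] at h1
      exact enorm_eq_zero.1 (le_antisymm h1 zero_le)
    · exact ⟨R / S, div_mul_cancel₀ _ hS⟩
  set m : Fin 2 → ℝ := fun i => mean T (g i)
  set H : Fin 2 → Fin 2 → ℝ := fun i j => if i = j then κ else 0 with hH
  set b : Fin 2 → ℝ := fun i => m i - κ * xb i
  set c := mean T (fun x => u x - quad H b 0 x)
  set q := quad H b c with hq
  have hHs : ∀ i j, H i j = H j i := fun i j => by simp only [hH, eq_comm]
  have hqd : ∀ i, pderiv i q = fun x => κ * y i x + m i := fun i => by
    rw [hq, pderiv_quad hHs]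
    ext x
    simp only [hH, ite_mul, zero_mul, Finset.sum_ite_eq, Finset.mem_univ, if_true, b, y]
    ring
  have hqs : ContDiff ℝ ∞ q := contDiff_quad H b c
  have hqH := isH1_smooth p hqs
  have hdH := hu.sub hqH
  have hqα : q ∈ Qα := ⟨κ / 2, b 0, b 1, c, fun x => by
    simp only [hq, quad, hH, Fin.sum_univ_two]
    simp
    ring⟩
  have hmean : ∫ x in T, (u x - q x) = 0 := by
    have := integral_sub_mean hp (hu.memLp.sub (memLp_smooth p (contDiff_quad H b 0)))
    rw [← this]
    congr 1; ext x
    simp only [hq, quad, c, Pi.sub_apply, T]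
    change _ = u x - _ - mean _ (fun x => u x - quad H b 0 x)
    simp only [quad]
    ring
  set G : Fin 2 → Plane → ℝ := fun i x => g i x - pderiv i q x with hG
  have hGm : ∀ i, MemLp (G i) 2 (volume.restrict T) := hdH.memLp_grad
  have hG0 : ∀ i, ∫ x in T, G i x = 0 := fun i => by
    have e : ∀ x, G i x = (g i x - m i) - κ * y i x := fun x => by
      simp only [hG, hqd]; ring
    simp only [e]
    have i1 : Integrable (fun x => g i x - m i) (volume.restrict T) :=
      ((hu.memLp_grad i).integrable (by norm_num)).sub (integrable_const _)
    rw [integral_sub i1 (((hy i).integrable (by norm_num)).const_mul κ), integral_const_mul, hy0,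
      integral_sub_mean hp (hu.memLp_grad i)]
    simp
  have hyG : ∑ i, ∫ x in T, y i x * G i x = 0 := by
    have e : ∀ i, ∫ x in T, y i x * G i x =
        (∫ x in T, y i x * g i x) - κ * ∫ x in T, y i x ^ 2 := fun i => by
      have i1 : Integrable (fun x => y i x * g i x) (volume.restrict T) :=
        (hy i).integrable_mul (hu.memLp_grad i)
      have e2 : ∀ x, y i x * G i x = (y i x * g i x - κ * y i x ^ 2) - m i * y i x := fun x => by
        simp only [hG, hqd]; ring
      simp only [e2]
      have i2 : Integrable (fun x => y i x * g i x - κ * y i x ^ 2) (volume.restrict T) :=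
        i1.sub ((hy i).integrable_sq.const_mul κ)
      rw [integral_sub i2 (((hy i).integrable (by norm_num)).const_mul _),
        integral_sub i1 ((hy i).integrable_sq.const_mul κ), integral_const_mul, integral_const_mul,
        hy0, mul_zero, sub_zero]
    simp only [e, Finset.sum_sub_distrib, ← Finset.mul_sum]
    rw [hκ, sub_self]
  have haff : ∀ a : Fin 2 → ℝ, ∑ i, ∫ x in T, (x i - a i) * G i x = 0 := by
    intro a
    rw [← hyG]
    refine Finset.sum_congr rfl fun i _ => ?_
    have i1 : Integrable (fun x => y i x * G i x) (volume.restrict T) := (hy i).integrable_mul (hGm i)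
    have e2 : ∀ x : Plane, (x i - a i) * G i x = y i x * G i x + (xb i - a i) * G i x := fun x => by
      simp only [y]; ring
    simp only [e2]
    rw [integral_add i1 (((hGm i).integrable (by norm_num)).const_mul _), integral_const_mul, hG0,
      mul_zero, add_zero]
  have hE : ∀ k, edgeFunctional p k (fun x => u x - q x) G = 0 := fun k => by
    rw [edgeFunctional_eq p k hdH.memLp hGm, hmean, haff (p k), mul_zero, add_zero]
  refine ⟨q, hqα, hqs, ⟨hqα, fun k => ?_, ?_⟩, hmean, hE, ?_⟩
  · obtain ⟨θ, hθ⟩ := hu.exists_isEdgeTrace hp k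
    refine ⟨θ, hθ, ?_⟩
    rw [hθ.integral_eq hp hu, integral_edge_eq hp k hqs]
    have := edgeFunctional_sub p k hu hqH
    rw [hE k] at this
    rw [sub_eq_zero.1 this.symm]
  · rw [integral_sub (hu.memLp.integrable (by norm_num)) (hqH.memLp.integrable (by norm_num))] at hmean
    exact (sub_eq_zero.1 hmean).symm
  · refine gradNorm_sq_eq_add hu.memLp_grad hqH.memLp_grad ?_
    have e : ∀ i, ∫ x in T, pderiv i q x * G i x = κ * ∫ x in T, y i x * G i x := fun i => by
      have i1 : Integrable (fun x => y i x * G i x) (volume.restrict T) := (hy i).integrable_mul (hGm i)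
      have e2 : ∀ x, pderiv i q x * G i x = κ * (y i x * G i x) + m i * G i x := fun x => by
        rw [hqd]; ring
      simp only [e2]
      rw [integral_add (i1.const_mul κ) (((hGm i).integrable (by norm_num)).const_mul _),
        integral_const_mul, integral_const_mul, hG0, mul_zero, add_zero]
    change ∑ i, ∫ x in T, pderiv i q x * G i x = 0
    simp only [e, ← Finset.mul_sum, hyG, mul_zero]

theorem exists_affine_interp {p : Fin 3 → Plane} (hp : AffineIndependent ℝ p) (val : Fin 3 → ℝ) :
    ∃ (b : Fin 2 → ℝ) (c : ℝ), ∀ k, ∑ i, b i * p k i + c = val k := by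
  set A : Plane ≃ₗ[ℝ] Plane := LinearEquiv.ofInjectiveEndo (triLin p : Plane →ₗ[ℝ] Plane)
    (triLin_injective hp)
  -- The linear functional with the prescribed increments along the two edges issuing from p₀. The
  -- vector b represents it.
  set L : Plane → ℝ := fun w => (val 1 - val 0) * (A.symm w) 0 + (val 2 - val 0) * (A.symm w) 1
  set b : Fin 2 → ℝ := fun i => L (EuclideanSpace.single i 1)
  have hL : ∀ w, ∑ i, b i * w i = L w := fun w => by
    have : w = w 0 • EuclideanSpace.single 0 (1 : ℝ) + w 1 • EuclideanSpace.single 1 (1 : ℝ) := by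
      ext j; fin_cases j <;> simp
    have e : A.symm w = w 0 • A.symm (EuclideanSpace.single 0 (1 : ℝ)) +
        w 1 • A.symm (EuclideanSpace.single 1 (1 : ℝ)) := by
      conv_lhs => rw [this]
      simp
    simp only [L, b, Fin.sum_univ_two, e]
    simp
    ring
  have h1 : A.symm (p 1 - p 0) = !₂[1, 0] := by
    rw [LinearEquiv.symm_apply_eq]
    change _ = triLin p _
    simp [triLin_apply]
  have h2 : A.symm (p 2 - p 0) = !₂[0, 1] := by
    rw [LinearEquiv.symm_apply_eq]
    change _ = triLin p _
    simp [triLin_apply]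
  have k1 := hL (p 1 - p 0)
  have k2 := hL (p 2 - p 0)
  simp only [L, h1, h2] at k1 k2
  simp [Fin.sum_univ_two] at k1 k2
  refine ⟨b, val 0 - ∑ i, b i * p 0 i, fun k => ?_⟩
  simp only [Fin.sum_univ_two]
  fin_cases k <;> simp <;> linarith

theorem eq_zero_of_sum_mul_edge {p : Fin 3 → Plane} (hp : AffineIndependent ℝ p) {w : Fin 2 → ℝ}
    (h : ∀ k, ∑ i, (p (k + 2) - p (k + 1)) i * w i = 0) : w = 0 := by
  have h1 := h 1
  have h2 := h 2
  rw [show (1 : Fin 3) + 2 = 0 from rfl, show (1 : Fin 3) + 1 = 2 from rfl] at h1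
  rw [show (2 : Fin 3) + 2 = 1 from rfl, show (2 : Fin 3) + 1 = 0 from rfl] at h2
  have key : ∀ x : Plane, ∑ i, x i * w i = 0 := by
    intro x
    obtain ⟨z, rfl⟩ := (LinearMap.injective_iff_surjective
      (f := (triLin p : Plane →ₗ[ℝ] Plane))).1 (triLin_injective hp) x
    change ∑ i, (triLin p z) i * w i = 0
    simp only [triLin_apply, Fin.sum_univ_two, PiLp.add_apply, PiLp.smul_apply, PiLp.sub_apply,
      smul_eq_mul] at h1 h2 ⊢
    linear_combination z 0 * h2 - z 1 * h1
  ext i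
  have := key (EuclideanSpace.single i 1)
  simpa using this

/-- The Hessian of q is the mean Hessian, symmetric because the mixed weak derivatives agree, and
the affine part fits the vertex values. The normal conditions need no further parameters: the error
in the whole gradient, not only in its normal component, has mean zero on every edge. -/
theorem exists_interp_β {p : Fin 3 → Plane} (hp : AffineIndependent ℝ p) {u v : Plane → ℝ}
    {g : Fin 2 → Plane → ℝ} {h : Fin 2 → Fin 2 → Plane → ℝ} (hu : IsH2 (openTri p) u g h)
    (hv : ContinuousOn v (closure (openTri p))) (huv : u =ᵐ[volume.restrict (openTri p)] v) :
    ∃ q, ContDiff ℝ ∞ q ∧ IsInterpβ p u g h q ∧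
      (∀ k, HasPointValue (openTri p) (fun x => u x - q x) (p k) 0) ∧
      (∀ i k, edgeFunctional p k (fun x => g i x - pderiv i q x)
        (fun j x => h i j x - pderiv j (pderiv i q) x) = 0) ∧
      ∀ i, gradNorm (openTri p) (h i) ^ 2 =
        gradNorm (openTri p) (fun j => pderiv j (pderiv i q)) ^ 2 +
        gradNorm (openTri p) (fun j x => h i j x - pderiv j (pderiv i q) x) ^ 2 := by
  set T := openTri p with hT
  set H : Fin 2 → Fin 2 → ℝ := fun i j => mean T (h i j) with hH
  have hHs : ∀ i j, H i j = H j i := fun i j => by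
    simp only [hH, mean]
    rw [integral_congr_ae (hu.ae_eq_swap (isOpen_openTri p) (isBounded_openTri p) i j)]
  obtain ⟨b, c, hbc⟩ := exists_affine_interp hp fun k => v (p k) - quad H 0 0 (p k)
  set q := quad H b c with hq
  have hqs : ContDiff ℝ ∞ q := contDiff_quad H b c
  have hqv : ∀ k, q (p k) = v (p k) := fun k => by
    have := hbc k
    simp only [quad, Pi.zero_apply, zero_mul, Finset.sum_const_zero, add_zero] at this
    simp only [hq, quad]
    linarith
  have hqH := isH2_smooth p hqs
  have hdH := hu.sub hqH
  have hpv : ∀ k, HasPointValue T (fun x => u x - q x) (p k) 0 := fun k =>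
    ⟨fun x => v x - q x, hv.sub hqs.continuous.continuousOn,
      huv.sub (ae_eq_refl q), by simp only [hqv, sub_self]⟩
  have hq2 : ∀ i j, pderiv j (pderiv i q) = fun _ => H i j := pderiv_pderiv_quad hHs b c
  have hD0 : ∀ i j, ∫ x in T, (h i j x - pderiv j (pderiv i q) x) = 0 := fun i j => by
    rw [hq2]; exact integral_sub_mean hp ((hu.isH1_grad i).memLp_grad j)
  set w : Fin 2 → ℝ := fun i => edgeFunctional p 0 (fun x => g i x - pderiv i q x)
        (fun j x => h i j x - pderiv j (pderiv i q) x) with hw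
  -- Replacing p_0 by p_k changes the functional by a constant vector paired with the mean of the
  -- Hessian error, which is zero.
  have hE : ∀ i k, edgeFunctional p k (fun x => g i x - pderiv i q x)
        (fun j x => h i j x - pderiv j (pderiv i q) x) = w i := fun i k => by
    have hm := (hdH.isH1_grad i).memLp_grad
    rw [hw]
    simp only
    rw [edgeFunctional_eq p k (hdH.isH1.memLp_grad i) hm,
      edgeFunctional_eq p 0 (hdH.isH1.memLp_grad i) hm]
    congr 1
    refine Finset.sum_congr rfl fun j _ => ?_
    have i1 : Integrable (fun x : Plane => (x j - p 0 j) * (h i j x - pderiv j (pderiv i q) x))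
      (volume.restrict T) := (memLp_coord_sub p j _).integrable_mul (hm j)
    have e : ∀ x : Plane, (x j - p k j) * (h i j x - pderiv j (pderiv i q) x) =
        (x j - p 0 j) * (h i j x - pderiv j (pderiv i q) x) +
        (p 0 j - p k j) * (h i j x - pderiv j (pderiv i q) x) := fun x => by ring
    simp only [e]
    rw [integral_add i1 (((hm j).integrable (by norm_num)).const_mul _), integral_const_mul, hD0,
      mul_zero, add_zero]
  -- The error vanishes at the vertices, so its tangential derivatives have mean zero on the edges.
  -- Thus w is orthogonal to all edges.
  have hw0 : w = 0 := eq_zero_of_sum_mul_edge hp fun k => by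
    have := sum_edgeFunctional_tangent_eq_zero hp hdH hpv k
    simpa only [hE] using this
  have hE0 : ∀ i k, edgeFunctional p k (fun x => g i x - pderiv i q x)
        (fun j x => h i j x - pderiv j (pderiv i q) x) = 0 := fun i k => by
    rw [hE, hw0]; rfl
  refine ⟨q, hqs, ⟨?_, fun k => ?_, fun k ν _ => ?_⟩, hpv, hE0, fun i => ?_⟩
  · refine ⟨H 0 0 / 2, H 0 1, H 1 1 / 2, b 0, b 1, c, fun x => ?_⟩
    simp only [hq, quad, Fin.sum_univ_two, hHs 1 0]
    ring
  · exact ⟨v, hv, huv, (hqv k).symm⟩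
  · choose θ hθ using fun i => (hu.isH1_grad i).exists_isEdgeTrace hp k
    refine ⟨θ, hθ, ?_⟩
    have i1 : ∀ i, Integrable (θ i) (edge p k) := fun i => by
      have : MemLp (θ i) 2 (edgeMeasure (p (k + 1)) (p (k + 2))) := (hθ i).1
      exact this.integrable (by norm_num)
    have i2 : ∀ i, Integrable (pderiv i q) (edge p k) := fun i => by
      have := (contDiff_pderiv hqs i).continuous.memLp_edgeMeasure (p (k + 1)) (p (k + 2))
      exact this.integrable (by norm_num)
    rw [integral_finsetSum _ fun i _ => (i2 i).mul_const _,
      integral_finsetSum _ fun i _ => (i1 i).mul_const _]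
    refine Finset.sum_congr rfl fun i _ => ?_
    rw [integral_mul_const, integral_mul_const, (hθ i).integral_eq hp (hu.isH1_grad i),
      integral_edge_eq hp k (contDiff_pderiv hqs i)]
    have := edgeFunctional_sub p k (hu.isH1_grad i) (hqH.isH1_grad i)
    rw [hE0 i k] at this
    rw [sub_eq_zero.1 this.symm]
  · refine gradNorm_sq_eq_add (hu.isH1_grad i).memLp_grad (hqH.isH1_grad i).memLp_grad ?_
    refine Finset.sum_eq_zero fun j _ => ?_
    have e : ∀ x, pderiv j (pderiv i q) x * (h i j x - pderiv j (pderiv i q) x) =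
        H i j * (h i j x - pderiv j (pderiv i q) x) := fun x => by simp only [hq2]
    simp only [e]
    rw [integral_const_mul, hD0, mul_zero]

/-! ### Scaling -/

/-- The image of the triangle with vertices `p` under the homothety `x ↦ q + c • x`. -/
def homTri (q : Plane) (c : ℝ) (p : Fin 3 → Plane) : Fin 3 → Plane := fun k => q + c • p k

theorem triMap_homTri (q : Plane) (c : ℝ) (p : Fin 3 → Plane) (z : Plane) :
    triMap (homTri q c p) z = q + c • triMap p z := by
  simp only [triMap, homTri]; module

theorem affineIndependent_homTri (q : Plane) {c : ℝ} (hc : c ≠ 0) {p : Fin 3 → Plane}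
    (hp : AffineIndependent ℝ p) : AffineIndependent ℝ (homTri q c p) := by
  have h := (affineIndependent_iff_linearIndependent_vsub ℝ p 0).1 hp
  refine (affineIndependent_iff_linearIndependent_vsub ℝ _ 0).2 ?_
  have e : (fun i : {x : Fin 3 // x ≠ 0} => homTri q c p i -ᵥ homTri q c p 0) =
      (Units.mk0 c hc) • fun i : {x : Fin 3 // x ≠ 0} => p i -ᵥ p 0 := by
    ext i : 1
    simp only [homTri, vsub_eq_sub, Pi.smul_apply, Units.smul_mk0]
    module
  rw [e]
  exact h.units_smul (fun _ => Units.mk0 c hc)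

theorem mem_openTri_homTri (q : Plane) {c : ℝ} (hc : c ≠ 0) {p : Fin 3 → Plane}
    (hp : AffineIndependent ℝ p) (x : Plane) :
    q + c • x ∈ openTri (homTri q c p) ↔ x ∈ openTri p := by
  obtain ⟨z, rfl⟩ := triMap_surjective hp x
  rw [← triMap_homTri, triMap_mem_openTri (affineIndependent_homTri q hc hp), triMap_mem_openTri hp]

theorem map_homothety_restrict (q : Plane) {c : ℝ} (hc : c ≠ 0) {p : Fin 3 → Plane}
    (hp : AffineIndependent ℝ p) :
    Measure.map (fun x : Plane => q + c • x) (volume.restrict (openTri p)) =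
      ENNReal.ofReal (c⁻¹ ^ 2) • volume.restrict (openTri (homTri q c p)) := by
  have e : openTri p = (fun x : Plane => q + c • x) ⁻¹' openTri (homTri q c p) :=
    Set.ext fun x => (mem_openTri_homTri q hc hp x).symm
  rw [e, ← (measurableEmbedding_homothety q hc).restrict_map, map_homothety q hc,
    Measure.restrict_smul]

theorem setIntegral_homothety (q : Plane) {c : ℝ} (hc : c ≠ 0) {p : Fin 3 → Plane}
    (hp : AffineIndependent ℝ p) (f : Plane → ℝ) :
    ∫ x in openTri p, f (q + c • x) = c⁻¹ ^ 2 * ∫ y in openTri (homTri q c p), f y := by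
  rw [← (measurableEmbedding_homothety q hc).integral_map, map_homothety_restrict q hc hp,
    integral_smul_measure, ENNReal.toReal_ofReal (sq_nonneg _), smul_eq_mul]

theorem memLp_homothety (q : Plane) {c : ℝ} (hc : c ≠ 0) {p : Fin 3 → Plane}
    (hp : AffineIndependent ℝ p) {f : Plane → ℝ}
    (hf : MemLp f 2 (volume.restrict (openTri (homTri q c p)))) :
    MemLp (fun x => f (q + c • x)) 2 (volume.restrict (openTri p)) := by
  have h := hf.smul_measure (c := ENNReal.ofReal (c⁻¹ ^ 2)) ENNReal.ofReal_ne_top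
  rw [← map_homothety_restrict q hc hp] at h
  exact (measurableEmbedding_homothety q hc).memLp_map_measure_iff.1 h

theorem l2Norm_homothety (q : Plane) {c : ℝ} (hc : c ≠ 0) {p : Fin 3 → Plane}
    (hp : AffineIndependent ℝ p) (f : Plane → ℝ) :
    l2Norm (openTri (homTri q c p)) f =
      ENNReal.ofReal |c| * l2Norm (openTri p) (fun x => f (q + c • x)) := by
  have h : l2Norm (openTri p) (fun x => f (q + c • x)) ^ 2 =
      ENNReal.ofReal (c⁻¹ ^ 2) * l2Norm (openTri (homTri q c p)) f ^ 2 := by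
    rw [l2Norm_sq, l2Norm_sq,
      ← (measurableEmbedding_homothety q hc).lintegral_map (fun y => ‖f y‖ₑ ^ 2),
      map_homothety_restrict q hc hp, lintegral_smul_measure, smul_eq_mul]
  have hc1 : ENNReal.ofReal |c| ^ 2 * ENNReal.ofReal (c⁻¹ ^ 2) = 1 := by
    rw [← ENNReal.ofReal_pow (abs_nonneg c), sq_abs, ← ENNReal.ofReal_mul (sq_nonneg c), ← mul_pow,
      mul_inv_cancel₀ hc, one_pow, ENNReal.ofReal_one]
  refine le_antisymm (sq_le_sq_iff_ennreal.1 (le_of_eq ?_)) (sq_le_sq_iff_ennreal.1 (le_of_eq ?_)) <;>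
    rw [mul_pow, h, ← mul_assoc, hc1, one_mul]

/-- Test functions on the triangle p are carried to its image by the inverse homothety. The ratio c
may be negative, which covers the point-reflected small triangles. -/
theorem isH1_homothety (q : Plane) {c : ℝ} (hc : c ≠ 0) {p : Fin 3 → Plane}
    (hp : AffineIndependent ℝ p) {u : Plane → ℝ} {g : Fin 2 → Plane → ℝ}
    (hu : IsH1 (openTri (homTri q c p)) u g) :
    IsH1 (openTri p) (fun x => u (q + c • x)) (fun i x => c * g i (q + c • x)) := by
  refine ⟨memLp_homothety q hc hp hu.memLp, fun i => (memLp_homothety q hc hp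
    (hu.memLp_grad i)).const_mul c, fun i φ hφ hφc hφs => ?_⟩
  set ψ : Plane → ℝ := fun y => φ (c⁻¹ • (y - q)) with hψ
  have hinv : ∀ x : Plane, c⁻¹ • (q + c • x - q) = x := fun x => by
    rw [add_sub_cancel_left, inv_smul_smul₀ hc]
  have hd : ∀ y, pderiv i ψ y = c⁻¹ * pderiv i φ (c⁻¹ • (y - q)) := fun y => by
    have hl : HasFDerivAt (fun y : Plane => c⁻¹ • (y - q)) (c⁻¹ • ContinuousLinearMap.id ℝ Plane) y :=
      ((hasFDerivAt_id (𝕜 := ℝ) y).sub_const q).const_smul c⁻¹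
    have h := (hφ.differentiable (by simp) _).hasFDerivAt.comp y hl
    rw [pderiv, show ψ = φ ∘ (fun y : Plane => c⁻¹ • (y - q)) from rfl, h.fderiv]
    simp [pderiv]
  have key := hu.weak i ψ (by fun_prop)
    (hφc.comp_homeomorph ((Homeomorph.subRight q).trans (Homeomorph.smulOfNeZero c⁻¹ (inv_ne_zero hc))))
    (by
      intro y hy
      have h1 : c⁻¹ • (y - q) ∈ tsupport φ :=
        tsupport_comp_subset_preimage φ (f := fun y : Plane => c⁻¹ • (y - q)) (by fun_prop) hy
      have := (mem_openTri_homTri q hc hp _).2 (hφs h1)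
      rwa [smul_inv_smul₀ hc, add_sub_cancel] at this)
  have e1 := setIntegral_homothety q hc hp (fun y => u y * pderiv i φ (c⁻¹ • (y - q)))
  have e2 := setIntegral_homothety q hc hp (fun y => g i y * φ (c⁻¹ • (y - q)))
  simp only [hinv] at e1 e2
  simp only [hd] at key
  simp only [hψ] at key
  have k1 : ∫ x in openTri (homTri q c p), u x * (c⁻¹ * pderiv i φ (c⁻¹ • (x - q))) =
      c⁻¹ * ∫ x in openTri (homTri q c p), u x * pderiv i φ (c⁻¹ • (x - q)) := by
    rw [← integral_const_mul]; congr 1; ext x; ring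
  have k2 : ∫ x in openTri p, c * g i (q + c • x) * φ x =
      c * ∫ x in openTri p, g i (q + c • x) * φ x := by
    rw [← integral_const_mul]; congr 1; ext x; ring
  rw [k1] at key
  rw [k2, e1, e2]
  field_simp at key ⊢
  linear_combination key

theorem isH2_homothety (q : Plane) {c : ℝ} (hc : c ≠ 0) {p : Fin 3 → Plane}
    (hp : AffineIndependent ℝ p) {u : Plane → ℝ} {g : Fin 2 → Plane → ℝ}
    {h : Fin 2 → Fin 2 → Plane → ℝ} (hu : IsH2 (openTri (homTri q c p)) u g h) :
    IsH2 (openTri p) (fun x => u (q + c • x)) (fun i x => c * g i (q + c • x))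
      (fun i j x => c * (c * h i j (q + c • x))) := by
  refine ⟨isH1_homothety q hc hp hu.isH1, fun i => ?_⟩
  have := isH1_homothety q hc hp (hu.isH1_grad i)
  refine ⟨this.memLp.const_mul c, fun j => (this.memLp_grad j).const_mul c, fun j φ h1 h2 h3 => ?_⟩
  have hw := this.weak j φ h1 h2 h3
  simp only [mul_assoc c]
  rw [integral_const_mul, integral_const_mul, hw]
  simp only [mul_assoc]
  ring

theorem edgeFunctional_homothety (q : Plane) {c : ℝ} (hc : c ≠ 0) {p : Fin 3 → Plane}
    (hp : AffineIndependent ℝ p) (k : Fin 3) (u : Plane → ℝ) (g : Fin 2 → Plane → ℝ) :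
    edgeFunctional p k (fun x => u (q + c • x)) (fun i x => c * g i (q + c • x)) =
      c⁻¹ ^ 2 * edgeFunctional (homTri q c p) k u g := by
  rw [edgeFunctional, edgeFunctional, ← setIntegral_homothety q hc hp]
  congr 1; ext x
  congr 1
  refine Finset.sum_congr rfl fun i _ => ?_
  simp [homTri]
  ring

theorem hasPointValue_homothety (q : Plane) {c : ℝ} (hc : c ≠ 0) {p : Fin 3 → Plane}
    (hp : AffineIndependent ℝ p) {u : Plane → ℝ} {k : Fin 3} {a : ℝ}
    (h : HasPointValue (openTri (homTri q c p)) u (homTri q c p k) a) :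
    HasPointValue (openTri p) (fun x => u (q + c • x)) (p k) a := by
  obtain ⟨v, hv, huv, rfl⟩ := h
  refine ⟨fun x => v (q + c • x), ?_, ?_, rfl⟩
  · refine hv.comp (by fun_prop) fun x hx => ?_
    have hm : Set.MapsTo (fun x : Plane => q + c • x) (openTri p) (openTri (homTri q c p)) :=
      fun x hx => (mem_openTri_homTri q hc hp x).2 hx
    exact hm.closure (by fun_prop) hx
  · have h2 : u =ᵐ[ENNReal.ofReal (c⁻¹ ^ 2) • volume.restrict (openTri (homTri q c p))] v :=
      Measure.ae_smul_measure huv _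
    rw [← map_homothety_restrict q hc hp] at h2
    exact ((measurableEmbedding_homothety q hc).ae_map_iff).1 h2

/-! ### Error constants on homothetic images of the triangle -/

/-- Finiteness of C excludes b = 0 < a, where the quotient is ∞. For b = ∞ the quotient would carry
no information on a. -/
theorem le_mul_of_div_le {a b C : ℝ≥0∞} (h : a / b ≤ C) (hC : C ≠ ⊤) (hb : b ≠ ⊤) : a ≤ C * b :=
  (ENNReal.div_le_iff_le_mul (Or.inr hC) (Or.inl hb)).1 h

theorem l2Norm_eq_zero_of_not_nonzeroOn {p : Fin 3 → Plane} {u : Plane → ℝ} (h : ¬ NonzeroOn p u) :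
    l2Norm (openTri p) u = 0 := by
  rw [l2Norm, eLpNorm_congr_ae (not_not.1 h)]
  exact eLpNorm_zero

theorem l2Norm_le_C1 {p : Fin 3 → Plane} (hp : AffineIndependent ℝ p) {u : Plane → ℝ}
    {g : Fin 2 → Plane → ℝ} (hu : IsV11 p u g) :
    l2Norm (openTri p) u ≤ C1 p * gradNorm (openTri p) g := by
  by_cases h : NonzeroOn p u
  · exact le_mul_of_div_le (le_sSup ⟨u, g, hu, h, rfl⟩) (C1_ne_top hp) (gradNorm_ne_top hu.1.memLp_grad)
  · rw [l2Norm_eq_zero_of_not_nonzeroOn h]; exact zero_le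

theorem l2Norm_le_C2 {p : Fin 3 → Plane} (hp : AffineIndependent ℝ p) {u : Plane → ℝ}
    {g : Fin 2 → Plane → ℝ} (hu : IsV12 p u g) :
    l2Norm (openTri p) u ≤ C2 p * gradNorm (openTri p) g := by
  by_cases h : NonzeroOn p u
  · exact le_mul_of_div_le (le_sSup ⟨u, g, hu, h, rfl⟩) (C2_ne_top hp) (gradNorm_ne_top hu.1.memLp_grad)
  · rw [l2Norm_eq_zero_of_not_nonzeroOn h]; exact zero_le

theorem hessNorm_ne_top {U : Set Plane} {h : Fin 2 → Fin 2 → Plane → ℝ}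
    (hh : ∀ i j, MemLp (h i j) 2 (volume.restrict U)) : hessNorm U h ≠ ⊤ :=
  ENNReal.rpow_ne_top_of_nonneg (by norm_num) (ENNReal.sum_ne_top.2 fun i _ =>
    ENNReal.sum_ne_top.2 fun j _ => ENNReal.pow_ne_top (hh i j).eLpNorm_lt_top.ne)

theorem l2Norm_le_C3 {p : Fin 3 → Plane} (hp : AffineIndependent ℝ p) {u : Plane → ℝ}
    {g : Fin 2 → Plane → ℝ} {h : Fin 2 → Fin 2 → Plane → ℝ} (hu : IsV2 p u g h) :
    l2Norm (openTri p) u ≤ C3 p * hessNorm (openTri p) h := by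
  by_cases hz : NonzeroOn p u
  · exact le_mul_of_div_le (le_sSup ⟨u, g, h, hu, hz, rfl⟩) (C3_ne_top hp)
      (hessNorm_ne_top fun i => (hu.1.isH1_grad i).memLp_grad)
  · rw [l2Norm_eq_zero_of_not_nonzeroOn hz]; exact zero_le

theorem l2Norm_const_mul (U : Set Plane) (c : ℝ) (f : Plane → ℝ) :
    l2Norm U (fun x => c * f x) = ENNReal.ofReal |c| * l2Norm U f := by
  have := eLpNorm_const_smul c f 2 (volume.restrict U)
  rw [Real.enorm_eq_ofReal_abs] at this
  exact this

/-- In dimension two the Dirichlet integral is scale invariant: the factor c of the chain rule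
cancels the area factor. The L² norm carries the factor |c|, which is therefore the gain in the
constants C₁ and C₂; the Hessian supplies a second factor for C₃. -/
theorem gradNorm_homothety (q : Plane) {c : ℝ} (hc : c ≠ 0) {p : Fin 3 → Plane}
    (hp : AffineIndependent ℝ p) (g : Fin 2 → Plane → ℝ) :
    gradNorm (openTri p) (fun i x => c * g i (q + c • x)) = gradNorm (openTri (homTri q c p)) g := by
  simp only [gradNorm, l2Norm_const_mul, l2Norm_homothety q hc hp]

theorem hessNorm_homothety (q : Plane) {c : ℝ} (hc : c ≠ 0) {p : Fin 3 → Plane}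
    (hp : AffineIndependent ℝ p) (h : Fin 2 → Fin 2 → Plane → ℝ) :
    hessNorm (openTri p) (fun i j x => c * (c * h i j (q + c • x))) =
      ENNReal.ofReal |c| * hessNorm (openTri (homTri q c p)) h := by
  refine le_antisymm (sq_le_sq_iff_ennreal.1 (le_of_eq ?_)) (sq_le_sq_iff_ennreal.1 (le_of_eq ?_)) <;>
  simp only [mul_pow, hessNorm_sq, l2Norm_const_mul, l2Norm_homothety q hc hp, Finset.mul_sum]

theorem l2Norm_le_C1_homTri (q : Plane) {c : ℝ} (hc : c ≠ 0) {p : Fin 3 → Plane}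
    (hp : AffineIndependent ℝ p) {u : Plane → ℝ} {g : Fin 2 → Plane → ℝ}
    (hu : IsH1 (openTri (homTri q c p)) u g) (h0 : ∫ x in openTri (homTri q c p), u x = 0) :
    l2Norm (openTri (homTri q c p)) u ≤
      ENNReal.ofReal |c| * C1 p * gradNorm (openTri (homTri q c p)) g := by
  have := l2Norm_le_C1 hp ⟨isH1_homothety q hc hp hu, by rw [setIntegral_homothety q hc hp, h0, mul_zero]⟩
  rw [gradNorm_homothety q hc hp] at this
  rw [l2Norm_homothety q hc hp, mul_assoc]
  exact mul_le_mul' le_rfl this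

theorem l2Norm_le_C2_homTri (q : Plane) {c : ℝ} (hc : c ≠ 0) {p : Fin 3 → Plane}
    (hp : AffineIndependent ℝ p) {u : Plane → ℝ} {g : Fin 2 → Plane → ℝ}
    (hu : IsH1 (openTri (homTri q c p)) u g) (h0 : ∀ k, edgeFunctional (homTri q c p) k u g = 0) :
    l2Norm (openTri (homTri q c p)) u ≤
      ENNReal.ofReal |c| * C2 p * gradNorm (openTri (homTri q c p)) g := by
  have := l2Norm_le_C2 hp ((isV12_iff hp).2 ⟨isH1_homothety q hc hp hu, fun k => by
    rw [edgeFunctional_homothety q hc hp, h0, mul_zero]⟩)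
  rw [gradNorm_homothety q hc hp] at this
  rw [l2Norm_homothety q hc hp, mul_assoc]
  exact mul_le_mul' le_rfl this

theorem l2Norm_le_C3_homTri (q : Plane) {c : ℝ} (hc : c ≠ 0) {p : Fin 3 → Plane}
    (hp : AffineIndependent ℝ p) {u : Plane → ℝ} {g : Fin 2 → Plane → ℝ}
    {h : Fin 2 → Fin 2 → Plane → ℝ} (hu : IsH2 (openTri (homTri q c p)) u g h)
    (h0 : ∀ k, HasPointValue (openTri (homTri q c p)) u (homTri q c p k) 0) :
    l2Norm (openTri (homTri q c p)) u ≤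
      ENNReal.ofReal |c| ^ 2 * C3 p * hessNorm (openTri (homTri q c p)) h := by
  have := l2Norm_le_C3 hp ⟨isH2_homothety q hc hp hu, fun k => hasPointValue_homothety q hc hp (h0 k)⟩
  rw [hessNorm_homothety q hc hp] at this
  rw [l2Norm_homothety q hc hp]
  calc _ ≤ ENNReal.ofReal |c| * _ := mul_le_mul' le_rfl this
    _ = _ := by ring

/-! ### The subdivision -/

/-- The small triangle of the lattice cell `(i, j)` that is a translate of the scaled triangle. -/
def upTri (p : Fin 3 → Plane) (n i j : ℕ) : Fin 3 → Plane :=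
  ![gridPt p n i j, gridPt p n (i + 1) j, gridPt p n i (j + 1)]

/-- The small triangle of the lattice cell `(i, j)` that is a point reflection of the scaled
triangle. -/
def downTri (p : Fin 3 → Plane) (n i j : ℕ) : Fin 3 → Plane :=
  ![gridPt p n (i + 1) (j + 1), gridPt p n i (j + 1), gridPt p n (i + 1) j]

theorem mem_subtriangles {p : Fin 3 → Plane} {n : ℕ} {τ : Fin 3 → Plane} :
    τ ∈ subtriangles p n ↔ (∃ i j, i + j + 1 ≤ n ∧ τ = upTri p n i j) ∨
      ∃ i j, i + j + 2 ≤ n ∧ τ = downTri p n i j := Iff.rfl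

theorem upTri_eq_homTri (p : Fin 3 → Plane) {n : ℕ} (i j : ℕ) :
    upTri p n i j = homTri (gridPt p n i j - (n : ℝ)⁻¹ • p 0) (n : ℝ)⁻¹ p := by
  ext k : 1
  fin_cases k <;> simp [upTri, homTri, gridPt] <;> module

theorem downTri_eq_homTri (p : Fin 3 → Plane) {n : ℕ} (i j : ℕ) :
    downTri p n i j = homTri (gridPt p n (i + 1) (j + 1) + (n : ℝ)⁻¹ • p 0) (-(n : ℝ)⁻¹) p := by
  ext k : 1
  fin_cases k <;> simp [downTri, homTri, gridPt] <;> module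

theorem exists_homTri_of_mem_subtriangles {p : Fin 3 → Plane} {n : ℕ} (hn : n ≠ 0)
    {τ : Fin 3 → Plane} (hτ : τ ∈ subtriangles p n) :
    ∃ q c, c ≠ 0 ∧ ENNReal.ofReal |c| = (n : ℝ≥0∞)⁻¹ ∧ τ = homTri q c p := by
  have hn' : (0 : ℝ) < n := by positivity
  have h : ENNReal.ofReal |(n : ℝ)⁻¹| = (n : ℝ≥0∞)⁻¹ := by
    rw [abs_of_pos (by positivity), ENNReal.ofReal_inv_of_pos hn', ENNReal.ofReal_natCast]
  rcases mem_subtriangles.1 hτ with ⟨i, j, -, rfl⟩ | ⟨i, j, -, rfl⟩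
  · exact ⟨_, _, inv_ne_zero hn'.ne', h, upTri_eq_homTri p i j⟩
  · exact ⟨_, _, neg_ne_zero.2 (inv_ne_zero hn'.ne'), by rw [abs_neg, h], downTri_eq_homTri p i j⟩

theorem affineIndependent_of_mem_subtriangles {p : Fin 3 → Plane} (hp : AffineIndependent ℝ p)
    {n : ℕ} (hn : n ≠ 0) {τ : Fin 3 → Plane} (hτ : τ ∈ subtriangles p n) :
    AffineIndependent ℝ τ := by
  obtain ⟨q, c, hc, -, rfl⟩ := exists_homTri_of_mem_subtriangles hn hτ
  exact affineIndependent_homTri q hc hp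

theorem triMap_upTri (p : Fin 3 → Plane) {n : ℕ} (hn : n ≠ 0) (i j : ℕ) (z : Plane) :
    triMap (upTri p n i j) !₂[n * z 0 - i, n * z 1 - j] = triMap p z := by
  have hn' : (n : ℝ) ≠ 0 := by positivity
  ext k
  simp [triMap, upTri, gridPt]
  field_simp
  ring

theorem triMap_downTri (p : Fin 3 → Plane) {n : ℕ} (hn : n ≠ 0) (i j : ℕ) (z : Plane) :
    triMap (downTri p n i j) !₂[i + 1 - n * z 0, j + 1 - n * z 1] = triMap p z := by
  have hn' : (n : ℝ) ≠ 0 := by positivity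
  ext k
  simp [triMap, downTri, gridPt]
  field_simp
  ring

/-! ### Locating points in the subdivision -/

theorem affineIndependent_upTri {p : Fin 3 → Plane} (hp : AffineIndependent ℝ p) {n : ℕ} (hn : n ≠ 0)
    (i j : ℕ) : AffineIndependent ℝ (upTri p n i j) := by
  rw [upTri_eq_homTri]
  exact affineIndependent_homTri _ (by positivity) hp

theorem affineIndependent_downTri {p : Fin 3 → Plane} (hp : AffineIndependent ℝ p) {n : ℕ} (hn : n ≠ 0)
    (i j : ℕ) : AffineIndependent ℝ (downTri p n i j) := by
  rw [downTri_eq_homTri]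
  exact affineIndependent_homTri _ (neg_ne_zero.2 (by positivity)) hp

theorem mem_upTri {p : Fin 3 → Plane} (hp : AffineIndependent ℝ p) {n : ℕ} (hn : n ≠ 0) (i j : ℕ)
    (z : Plane) : triMap p z ∈ openTri (upTri p n i j) ↔
      i < n * z 0 ∧ j < n * z 1 ∧ n * z 0 + n * z 1 < i + j + 1 := by
  rw [← triMap_upTri p hn i j, triMap_mem_openTri (affineIndependent_upTri hp hn i j)]
  simp only [Matrix.cons_val_zero, Matrix.cons_val_one, sub_pos]
  refine and_congr_right fun _ => and_congr_right fun _ => ?_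
  constructor <;> intro h <;> linarith

theorem mem_downTri {p : Fin 3 → Plane} (hp : AffineIndependent ℝ p) {n : ℕ} (hn : n ≠ 0) (i j : ℕ)
    (z : Plane) : triMap p z ∈ openTri (downTri p n i j) ↔
      n * z 0 < i + 1 ∧ n * z 1 < j + 1 ∧ i + j + 1 < n * z 0 + n * z 1 := by
  rw [← triMap_downTri p hn i j, triMap_mem_openTri (affineIndependent_downTri hp hn i j)]
  simp only [Matrix.cons_val_zero, Matrix.cons_val_one, sub_pos]
  refine and_congr_right fun _ => and_congr_right fun _ => ?_
  constructor <;> intro h <;> linarith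

/-- The integer parts of n z 0 and n z 1 recover the lattice cell, and the side of the diagonal of
the cell recovers the orientation. -/
theorem eq_of_mem_openTri_subtriangles {p : Fin 3 → Plane} (hp : AffineIndependent ℝ p) {n : ℕ}
    (hn : n ≠ 0) {τ τ' : Fin 3 → Plane} (hτ : τ ∈ subtriangles p n) (hτ' : τ' ∈ subtriangles p n)
    {x : Plane} (h : x ∈ openTri τ) (h' : x ∈ openTri τ') : τ = τ' := by
  obtain ⟨z, rfl⟩ := triMap_surjective hp x
  have floor_eq : ∀ {σ}, σ ∈ subtriangles p n → triMap p z ∈ openTri σ →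
      σ = if n * z 0 + n * z 1 < ⌊n * z 0⌋₊ + ⌊n * z 1⌋₊ + 1 then upTri p n ⌊n * z 0⌋₊ ⌊n * z 1⌋₊
        else downTri p n ⌊n * z 0⌋₊ ⌊n * z 1⌋₊ := by
    intro σ hσ hx
    rcases mem_subtriangles.1 hσ with ⟨i, j, -, rfl⟩ | ⟨i, j, -, rfl⟩
    · obtain ⟨h0, h1, h2⟩ := (mem_upTri hp hn i j z).1 hx
      have e0 : ⌊n * z 0⌋₊ = i := (Nat.floor_eq_iff (by linarith [i.cast_nonneg (α := ℝ)])).2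
        ⟨h0.le, by linarith⟩
      have e1 : ⌊n * z 1⌋₊ = j := (Nat.floor_eq_iff (by linarith [j.cast_nonneg (α := ℝ)])).2
        ⟨h1.le, by linarith⟩
      rw [e0, e1, if_pos h2]
    · obtain ⟨h0, h1, h2⟩ := (mem_downTri hp hn i j z).1 hx
      have e0 : ⌊n * z 0⌋₊ = i := (Nat.floor_eq_iff (by linarith [i.cast_nonneg (α := ℝ)])).2
        ⟨by linarith, h0⟩
      have e1 : ⌊n * z 1⌋₊ = j := (Nat.floor_eq_iff (by linarith [j.cast_nonneg (α := ℝ)])).2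
        ⟨by linarith, h1⟩
      rw [e0, e1, if_neg h2.not_gt]
  rw [floor_eq hτ h, floor_eq hτ' h']

theorem openTri_subset_of_mem_subtriangles {p : Fin 3 → Plane} (hp : AffineIndependent ℝ p) {n : ℕ}
    (hn : n ≠ 0) {τ : Fin 3 → Plane} (hτ : τ ∈ subtriangles p n) : openTri τ ⊆ openTri p := by
  intro x hx
  obtain ⟨z, rfl⟩ := triMap_surjective hp x
  have hn' : (0 : ℝ) < n := by positivity
  rw [triMap_mem_openTri hp]
  suffices h : 0 < n * z 0 ∧ 0 < n * z 1 ∧ n * z 0 + n * z 1 < n by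
    refine ⟨pos_of_mul_pos_right h.1 hn'.le, pos_of_mul_pos_right h.2.1 hn'.le, ?_⟩
    have := h.2.2
    rw [← mul_add] at this
    exact lt_of_mul_lt_mul_left (this.trans_eq (mul_one _).symm) hn'.le
  rcases mem_subtriangles.1 hτ with ⟨i, j, hij, rfl⟩ | ⟨i, j, hij, rfl⟩
  · obtain ⟨h0, h1, h2⟩ := (mem_upTri hp hn i j z).1 hx
    have : (i : ℝ) + j + 1 ≤ n := by exact_mod_cast hij
    refine ⟨?_, ?_, ?_⟩ <;> linarith [i.cast_nonneg (α := ℝ), j.cast_nonneg (α := ℝ)]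
  · obtain ⟨h0, h1, h2⟩ := (mem_downTri hp hn i j z).1 hx
    have : (i : ℝ) + j + 2 ≤ n := by exact_mod_cast hij
    refine ⟨?_, ?_, ?_⟩ <;> linarith [i.cast_nonneg (α := ℝ), j.cast_nonneg (α := ℝ)]

theorem exists_subtriangle_mem_closure {p : Fin 3 → Plane} (hp : AffineIndependent ℝ p) {n : ℕ}
    (hn : n ≠ 0) {x : Plane} (hx : x ∈ openTri p) :
    ∃ τ ∈ subtriangles p n, x ∈ closure (openTri τ) := by
  obtain ⟨z, rfl⟩ := triMap_surjective hp x
  have hn' : (0 : ℝ) < n := by positivity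
  obtain ⟨h0, h1, h2⟩ := (triMap_mem_openTri hp z).1 hx
  set i := ⌊n * z 0⌋₊
  set j := ⌊n * z 1⌋₊
  have hi : (i : ℝ) ≤ n * z 0 := Nat.floor_le (by positivity)
  have hj : (j : ℝ) ≤ n * z 1 := Nat.floor_le (by positivity)
  have hi' : n * z 0 < (i : ℝ) + 1 := Nat.lt_floor_add_one _
  have hj' : n * z 1 < (j : ℝ) + 1 := Nat.lt_floor_add_one _
  have hs : n * z 0 + n * z 1 < n := by nlinarith
  rcases le_or_gt (n * z 0 + n * z 1) ((i : ℝ) + j + 1) with h | h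
  · refine ⟨upTri p n i j, mem_subtriangles.2 (Or.inl ⟨i, j, ?_, rfl⟩), ?_⟩
    · have : (i : ℝ) + j < n := by linarith
      exact_mod_cast this
    · have ha := affineIndependent_upTri hp hn i j
      rw [closure_openTri ha, ← triMap_upTri p hn i j, triMap_mem_convexHull ha]
      simp only [Matrix.cons_val_zero, Matrix.cons_val_one]
      refine ⟨?_, ?_, ?_⟩ <;> linarith
  · refine ⟨downTri p n i j, mem_subtriangles.2 (Or.inr ⟨i, j, ?_, rfl⟩), ?_⟩
    -- For integers this strict inequality is the required i + j + 2 ≤ n, so the reflected triangle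
    -- does not cross the side opposite p₀.
    · have : (i : ℝ) + j + 1 < n := by linarith
      exact_mod_cast this
    · have ha := affineIndependent_downTri hp hn i j
      rw [closure_openTri ha, ← triMap_downTri p hn i j, triMap_mem_convexHull ha]
      simp only [Matrix.cons_val_zero, Matrix.cons_val_one]
      refine ⟨?_, ?_, ?_⟩ <;> linarith

theorem finite_subtriangles (p : Fin 3 → Plane) (n : ℕ) : (subtriangles p n).Finite := by
  have hf := (Set.finite_Iio n).prod (Set.finite_Iio n)
  refine ((hf.image fun a => upTri p n a.1 a.2).union (hf.image fun a => downTri p n a.1 a.2)).subset ?_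
  intro τ hτ
  rcases mem_subtriangles.1 hτ with ⟨i, j, hij, rfl⟩ | ⟨i, j, hij, rfl⟩
  · exact Or.inl ⟨(i, j), ⟨by simp; omega, by simp; omega⟩, rfl⟩
  · exact Or.inr ⟨(i, j), ⟨by simp; omega, by simp; omega⟩, rfl⟩

/-! ### Norms on the union of the small triangles -/

/-- The small triangles as a finite set. -/
def subtriFinset (p : Fin 3 → Plane) (n : ℕ) : Finset (Fin 3 → Plane) :=
  (finite_subtriangles p n).toFinset

theorem mem_subtriFinset {p : Fin 3 → Plane} {n : ℕ} {τ : Fin 3 → Plane} :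
    τ ∈ subtriFinset p n ↔ τ ∈ subtriangles p n := Set.Finite.mem_toFinset _

theorem brokenTri_eq_biUnion (p : Fin 3 → Plane) (n : ℕ) :
    brokenTri p n = ⋃ τ ∈ subtriFinset p n, openTri τ := by
  simp only [brokenTri, mem_subtriFinset]

theorem lintegral_brokenTri {p : Fin 3 → Plane} (hp : AffineIndependent ℝ p) {n : ℕ} (hn : n ≠ 0)
    (F : Plane → ℝ≥0∞) :
    ∫⁻ x in brokenTri p n, F x = ∑ τ ∈ subtriFinset p n, ∫⁻ x in openTri τ, F x := by
  rw [brokenTri_eq_biUnion, lintegral_biUnion_finset _ fun τ _ => measurableSet_openTri τ]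
  intro τ hτ τ' hτ' hne
  refine Set.disjoint_left.2 fun x hx hx' => hne ?_
  exact eq_of_mem_openTri_subtriangles hp hn (mem_subtriFinset.1 hτ) (mem_subtriFinset.1 hτ') hx hx'

/-- What T' misses of T lies on the frontiers of finitely many convex sets, and these are null sets.
-/
theorem brokenTri_ae_eq {p : Fin 3 → Plane} (hp : AffineIndependent ℝ p) {n : ℕ} (hn : n ≠ 0) :
    brokenTri p n =ᵐ[volume] openTri p := by
  have hs : brokenTri p n ⊆ openTri p :=
    Set.iUnion₂_subset fun τ hτ => openTri_subset_of_mem_subtriangles hp hn hτ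
  refine Filter.EventuallyLE.antisymm (ae_of_all _ hs) ?_
  rw [ae_le_set]
  refine measure_mono_null (t := ⋃ τ ∈ subtriFinset p n, frontier (openTri τ)) ?_ ?_
  · rintro x ⟨hx, hx'⟩
    obtain ⟨τ, hτ, hm⟩ := exists_subtriangle_mem_closure hp hn hx
    refine Set.mem_iUnion₂.2 ⟨τ, mem_subtriFinset.2 hτ, hm, fun hi => hx' ?_⟩
    exact Set.mem_iUnion₂.2 ⟨τ, hτ, interior_subset hi⟩
  · exact (measure_biUnion_null_iff (Finset.countable_toSet _)).2 fun τ _ =>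
      (convex_openTri τ).addHaar_frontier volume

theorem l2Norm_brokenTri_sq {p : Fin 3 → Plane} (hp : AffineIndependent ℝ p) {n : ℕ} (hn : n ≠ 0)
    (f : Plane → ℝ) :
    l2Norm (brokenTri p n) f ^ 2 = ∑ τ ∈ subtriFinset p n, l2Norm (openTri τ) f ^ 2 := by
  simp only [l2Norm_sq]; exact lintegral_brokenTri hp hn _

theorem l2Norm_brokenTri {p : Fin 3 → Plane} (hp : AffineIndependent ℝ p) {n : ℕ} (hn : n ≠ 0)
    (f : Plane → ℝ) : l2Norm (brokenTri p n) f = l2Norm (openTri p) f := by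
  rw [l2Norm, l2Norm, Measure.restrict_congr_set (brokenTri_ae_eq hp hn)]

theorem gradNorm_brokenTri_sq {p : Fin 3 → Plane} (hp : AffineIndependent ℝ p) {n : ℕ} (hn : n ≠ 0)
    (g : Fin 2 → Plane → ℝ) :
    gradNorm (brokenTri p n) g ^ 2 = ∑ τ ∈ subtriFinset p n, gradNorm (openTri τ) g ^ 2 := by
  simp only [gradNorm_sq, l2Norm_brokenTri_sq hp hn]; exact Finset.sum_comm

theorem gradNorm_brokenTri {p : Fin 3 → Plane} (hp : AffineIndependent ℝ p) {n : ℕ} (hn : n ≠ 0)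
    (g : Fin 2 → Plane → ℝ) :
    gradNorm (brokenTri p n) g = gradNorm (openTri p) g := by
  simp only [gradNorm, l2Norm_brokenTri hp hn]

theorem hessNorm_brokenTri_sq {p : Fin 3 → Plane} (hp : AffineIndependent ℝ p) {n : ℕ} (hn : n ≠ 0)
    (h : Fin 2 → Fin 2 → Plane → ℝ) :
    hessNorm (brokenTri p n) h ^ 2 = ∑ τ ∈ subtriFinset p n, hessNorm (openTri τ) h ^ 2 := by
  simp only [hessNorm_sq_eq, gradNorm_brokenTri_sq hp hn]; exact Finset.sum_comm

theorem hessNorm_brokenTri {p : Fin 3 → Plane} (hp : AffineIndependent ℝ p) {n : ℕ} (hn : n ≠ 0)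
    (h : Fin 2 → Fin 2 → Plane → ℝ) :
    hessNorm (brokenTri p n) h = hessNorm (openTri p) h := by
  simp only [hessNorm, l2Norm_brokenTri hp hn]

/-! ### Gluing -/

theorem pderiv_eqOn {U : Set Plane} (hU : IsOpen U) {f f' : Plane → ℝ} (h : Set.EqOn f f' U)
    (i : Fin 2) : Set.EqOn (pderiv i f) (pderiv i f') U := fun x hx => by
  have : f =ᶠ[𝓝 x] f' := h.eventuallyEq_of_mem (hU.mem_nhds hx)
  simp only [pderiv, this.fderiv_eq]

/-- No regularity of f is needed, so this applies to the glued function w, whatever its behaviour on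
the interfaces. -/
theorem measurable_pderiv (i : Fin 2) (f : Plane → ℝ) : Measurable (pderiv i f) :=
  measurable_fderiv_apply_const ℝ f _

theorem gradNorm_congr {U : Set Plane} (hU : MeasurableSet U) {g g' : Fin 2 → Plane → ℝ}
    (h : ∀ i, Set.EqOn (g i) (g' i) U) : gradNorm U g = gradNorm U g' := by
  simp only [gradNorm, l2Norm_congr hU (h _)]

theorem hessNorm_congr {U : Set Plane} (hU : MeasurableSet U) {h h' : Fin 2 → Fin 2 → Plane → ℝ}
    (he : ∀ i j, Set.EqOn (h i j) (h' i j) U) : hessNorm U h = hessNorm U h' := by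
  simp only [hessNorm, l2Norm_congr hU (he _ _)]

/-- A measurable function that agrees with prescribed functions on the small triangles. -/
theorem exists_glue {p : Fin 3 → Plane} (hp : AffineIndependent ℝ p) {n : ℕ} (hn : n ≠ 0)
    (q : (Fin 3 → Plane) → Plane → ℝ) (hq : ∀ τ ∈ subtriangles p n, Measurable (q τ)) :
    ∃ w, Measurable w ∧ ∀ τ ∈ subtriangles p n, Set.EqOn w (q τ) (openTri τ) := by
  refine ⟨fun x => ∑ τ ∈ subtriFinset p n, (openTri τ).indicator (q τ) x, ?_, fun τ hτ x hx => ?_⟩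
  · exact Finset.measurable_fun_sum _ fun τ hτ =>
      (hq τ (mem_subtriFinset.1 hτ)).indicator (measurableSet_openTri τ)
  · simp only
    rw [Finset.sum_eq_single_of_mem τ (mem_subtriFinset.2 hτ), Set.indicator_of_mem hx]
    intro τ' hτ' hne
    refine Set.indicator_of_notMem (fun hx' => hne ?_) _
    exact eq_of_mem_openTri_subtriangles hp hn (mem_subtriFinset.1 hτ') hτ hx' hx

/-! ### Error bounds on the small triangles -/

theorem l2Norm_le_C1_of_mem_subtriangles {p : Fin 3 → Plane} (hp : AffineIndependent ℝ p) {n : ℕ}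
    (hn : n ≠ 0) {τ : Fin 3 → Plane} (hτ : τ ∈ subtriangles p n) {u : Plane → ℝ}
    {g : Fin 2 → Plane → ℝ} (hu : IsH1 (openTri τ) u g) (h0 : ∫ x in openTri τ, u x = 0) :
    l2Norm (openTri τ) u ≤ (n : ℝ≥0∞)⁻¹ * C1 p * gradNorm (openTri τ) g := by
  obtain ⟨q, c, hc, h, rfl⟩ := exists_homTri_of_mem_subtriangles hn hτ
  exact h ▸ l2Norm_le_C1_homTri q hc hp hu h0

theorem l2Norm_le_C2_of_mem_subtriangles {p : Fin 3 → Plane} (hp : AffineIndependent ℝ p) {n : ℕ}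
    (hn : n ≠ 0) {τ : Fin 3 → Plane} (hτ : τ ∈ subtriangles p n) {u : Plane → ℝ}
    {g : Fin 2 → Plane → ℝ} (hu : IsH1 (openTri τ) u g) (h0 : ∀ k, edgeFunctional τ k u g = 0) :
    l2Norm (openTri τ) u ≤ (n : ℝ≥0∞)⁻¹ * C2 p * gradNorm (openTri τ) g := by
  obtain ⟨q, c, hc, h, rfl⟩ := exists_homTri_of_mem_subtriangles hn hτ
  exact h ▸ l2Norm_le_C2_homTri q hc hp hu h0

theorem l2Norm_le_C3_of_mem_subtriangles {p : Fin 3 → Plane} (hp : AffineIndependent ℝ p) {n : ℕ}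
    (hn : n ≠ 0) {τ : Fin 3 → Plane} (hτ : τ ∈ subtriangles p n) {u : Plane → ℝ}
    {g : Fin 2 → Plane → ℝ} {h : Fin 2 → Fin 2 → Plane → ℝ} (hu : IsH2 (openTri τ) u g h)
    (h0 : ∀ k, HasPointValue (openTri τ) u (τ k) 0) :
    l2Norm (openTri τ) u ≤ (n : ℝ≥0∞)⁻¹ ^ 2 * C3 p * hessNorm (openTri τ) h := by
  obtain ⟨q, c, hc, hn', rfl⟩ := exists_homTri_of_mem_subtriangles hn hτ
  exact hn' ▸ l2Norm_le_C3_homTri q hc hp hu h0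

/-! ### The piecewise interpolations -/

theorem sum_sq_le_mul {ι : Type*} {s : Finset ι} {a b : ι → ℝ≥0∞} {K A B : ℝ≥0∞}
    (hA : A ^ 2 = ∑ i ∈ s, a i ^ 2) (hB : B ^ 2 = ∑ i ∈ s, b i ^ 2) (h : ∀ i ∈ s, a i ≤ K * b i) :
    A ≤ K * B := by
  rw [← sq_le_sq_iff_ennreal, mul_pow, hA, hB, Finset.mul_sum]
  exact Finset.sum_le_sum fun i hi => (pow_le_pow_left' (h i hi) 2).trans_eq (mul_pow _ _ _)

/-- Y is the piecewise gradient norm of the error. The same error has mean zero over each small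
triangle and over each of its edges, so a single w serves both C₁ and C₂. -/
theorem exists_piecewiseα {p : Fin 3 → Plane} (hp : AffineIndependent ℝ p) {n : ℕ} (hn : n ≠ 0)
    {u : Plane → ℝ} {g : Fin 2 → Plane → ℝ} (hu : IsH1 (openTri p) u g) :
    ∃ w Y, Measurable w ∧ IsPiecewiseα p n u g w ∧
      gradNorm (openTri p) g ^ 2 = gradNorm (brokenTri p n) (fun i => pderiv i w) ^ 2 + Y ^ 2 ∧
      l2Norm (openTri p) (fun x => u x - w x) ≤ (n : ℝ≥0∞)⁻¹ * C1 p * Y ∧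
      l2Norm (openTri p) (fun x => u x - w x) ≤ (n : ℝ≥0∞)⁻¹ * C2 p * Y := by
  have hu' : ∀ τ ∈ subtriangles p n, IsH1 (openTri τ) u g := fun τ hτ =>
    hu.mono (measurableSet_openTri τ) (measurableSet_openTri p)
      (openTri_subset_of_mem_subtriangles hp hn hτ)
  choose! q _ hqs hq h1 h2 h3 using fun τ (hτ : τ ∈ subtriangles p n) =>
    exists_interp_α (affineIndependent_of_mem_subtriangles hp hn hτ) (hu' τ hτ)
  obtain ⟨w, hwm, hw⟩ := exists_glue hp hn q fun τ hτ => (hqs τ hτ).continuous.measurable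
  have hw' : ∀ τ ∈ subtriangles p n, ∀ i, Set.EqOn (pderiv i w) (pderiv i (q τ)) (openTri τ) :=
    fun τ hτ i => pderiv_eqOn (isOpen_openTri τ) (hw τ hτ) i
  have eg : ∀ τ ∈ subtriangles p n, gradNorm (openTri τ) (fun i x => g i x - pderiv i w x) =
      gradNorm (openTri τ) (fun i x => g i x - pderiv i (q τ) x) := fun τ hτ =>
    gradNorm_congr (measurableSet_openTri τ) fun i x hx => by simp only [hw' τ hτ i hx]
  have ew : ∀ τ ∈ subtriangles p n, l2Norm (openTri τ) (fun x => u x - w x) =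
      l2Norm (openTri τ) (fun x => u x - q τ x) := fun τ hτ =>
    l2Norm_congr (measurableSet_openTri τ) fun x hx => by simp only [hw τ hτ hx]
  refine ⟨w, gradNorm (brokenTri p n) (fun i x => g i x - pderiv i w x), hwm,
    fun τ hτ => ⟨q τ, hq τ hτ, hw τ hτ⟩, ?_, ?_, ?_⟩
  · rw [← gradNorm_brokenTri hp hn, gradNorm_brokenTri_sq hp hn, gradNorm_brokenTri_sq hp hn,
      gradNorm_brokenTri_sq hp hn, ← Finset.sum_add_distrib]
    refine Finset.sum_congr rfl fun τ hτ => ?_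
    rw [mem_subtriFinset] at hτ
    rw [eg τ hτ, gradNorm_congr (measurableSet_openTri τ) (hw' τ hτ), h3 τ hτ]
  · rw [← l2Norm_brokenTri hp hn]
    refine sum_sq_le_mul (l2Norm_brokenTri_sq hp hn _) (gradNorm_brokenTri_sq hp hn _) fun τ hτ => ?_
    rw [mem_subtriFinset] at hτ
    rw [eg τ hτ, ew τ hτ]
    exact l2Norm_le_C1_of_mem_subtriangles hp hn hτ ((hu' τ hτ).sub (isH1_smooth τ (hqs τ hτ)))
      (h1 τ hτ)
  · rw [← l2Norm_brokenTri hp hn]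
    refine sum_sq_le_mul (l2Norm_brokenTri_sq hp hn _) (gradNorm_brokenTri_sq hp hn _) fun τ hτ => ?_
    rw [mem_subtriFinset] at hτ
    rw [eg τ hτ, ew τ hτ]
    exact l2Norm_le_C2_of_mem_subtriangles hp hn hτ ((hu' τ hτ).sub (isH1_smooth τ (hqs τ hτ)))
      (h2 τ hτ)

theorem exists_piecewiseβ {p : Fin 3 → Plane} (hp : AffineIndependent ℝ p) {n : ℕ} (hn : n ≠ 0)
    {u : Plane → ℝ} {g : Fin 2 → Plane → ℝ} {h : Fin 2 → Fin 2 → Plane → ℝ}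
    (hu : IsH2 (openTri p) u g h) :
    ∃ w Y, Measurable w ∧ IsPiecewiseβ p n u g h w ∧
      hessNorm (openTri p) h ^ 2 =
        hessNorm (brokenTri p n) (fun i j => pderiv j (pderiv i w)) ^ 2 + Y ^ 2 ∧
      l2Norm (openTri p) (fun x => u x - w x) ≤ (n : ℝ≥0∞)⁻¹ ^ 2 * C3 p * Y ∧
      gradNorm (openTri p) (fun i x => g i x - pderiv i w x) ≤ (n : ℝ≥0∞)⁻¹ * C2 p * Y := by
  obtain ⟨K, -, hK⟩ := exists_continuous_rep hp
  obtain ⟨v, -, hv, huv, -⟩ := hK u g h hu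
  have hsub : ∀ τ ∈ subtriangles p n, openTri τ ⊆ openTri p := fun τ hτ =>
    openTri_subset_of_mem_subtriangles hp hn hτ
  have hu' : ∀ τ ∈ subtriangles p n, IsH2 (openTri τ) u g h := fun τ hτ =>
    hu.mono (measurableSet_openTri τ) (measurableSet_openTri p) (hsub τ hτ)
  choose! q hqs hq h1 h2 h3 using fun τ (hτ : τ ∈ subtriangles p n) =>
    exists_interp_β (affineIndependent_of_mem_subtriangles hp hn hτ) (hu' τ hτ)
      (hv.mono (closure_mono (hsub τ hτ))) (ae_restrict_of_ae_restrict_of_subset (hsub τ hτ) huv)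
  obtain ⟨w, hwm, hw⟩ := exists_glue hp hn q fun τ hτ => (hqs τ hτ).continuous.measurable
  have hw1 : ∀ τ ∈ subtriangles p n, ∀ i, Set.EqOn (pderiv i w) (pderiv i (q τ)) (openTri τ) :=
    fun τ hτ i => pderiv_eqOn (isOpen_openTri τ) (hw τ hτ) i
  have hw2 : ∀ τ ∈ subtriangles p n, ∀ i j,
      Set.EqOn (pderiv j (pderiv i w)) (pderiv j (pderiv i (q τ))) (openTri τ) :=
    fun τ hτ i j => pderiv_eqOn (isOpen_openTri τ) (hw1 τ hτ i) j
  have eh : ∀ τ ∈ subtriangles p n,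
      hessNorm (openTri τ) (fun i j x => h i j x - pderiv j (pderiv i w) x) =
      hessNorm (openTri τ) (fun i j x => h i j x - pderiv j (pderiv i (q τ)) x) := fun τ hτ =>
    hessNorm_congr (measurableSet_openTri τ) fun i j x hx => by simp only [hw2 τ hτ i j hx]
  have eg : ∀ τ ∈ subtriangles p n, gradNorm (openTri τ) (fun i x => g i x - pderiv i w x) =
      gradNorm (openTri τ) (fun i x => g i x - pderiv i (q τ) x) := fun τ hτ =>
    gradNorm_congr (measurableSet_openTri τ) fun i x hx => by simp only [hw1 τ hτ i hx]
  have ew : ∀ τ ∈ subtriangles p n, l2Norm (openTri τ) (fun x => u x - w x) =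
      l2Norm (openTri τ) (fun x => u x - q τ x) := fun τ hτ =>
    l2Norm_congr (measurableSet_openTri τ) fun x hx => by simp only [hw τ hτ hx]
  refine ⟨w, hessNorm (brokenTri p n) (fun i j x => h i j x - pderiv j (pderiv i w) x), hwm,
    fun τ hτ => ⟨q τ, hq τ hτ, hw τ hτ⟩, ?_, ?_, ?_⟩
  · rw [← hessNorm_brokenTri hp hn, hessNorm_brokenTri_sq hp hn, hessNorm_brokenTri_sq hp hn,
      hessNorm_brokenTri_sq hp hn, ← Finset.sum_add_distrib]
    refine Finset.sum_congr rfl fun τ hτ => ?_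
    rw [mem_subtriFinset] at hτ
    rw [eh τ hτ, hessNorm_congr (measurableSet_openTri τ) (hw2 τ hτ), hessNorm_sq_eq, hessNorm_sq_eq,
      hessNorm_sq_eq, ← Finset.sum_add_distrib]
    exact Finset.sum_congr rfl fun i _ => h3 τ hτ i
  · rw [← l2Norm_brokenTri hp hn]
    refine sum_sq_le_mul (l2Norm_brokenTri_sq hp hn _) (hessNorm_brokenTri_sq hp hn _) fun τ hτ => ?_
    rw [mem_subtriFinset] at hτ
    rw [eh τ hτ, ew τ hτ]
    exact l2Norm_le_C3_of_mem_subtriangles hp hn hτ ((hu' τ hτ).sub (isH2_smooth τ (hqs τ hτ)))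
      (h1 τ hτ)
  · rw [← gradNorm_brokenTri hp hn]
    refine sum_sq_le_mul (gradNorm_brokenTri_sq hp hn _) (hessNorm_brokenTri_sq hp hn _) fun τ hτ => ?_
    rw [mem_subtriFinset] at hτ
    rw [eh τ hτ, eg τ hτ]
    -- Each component of the gradient error belongs to V^{1,2} of the small triangle. The C₂ bounds
    -- for the two components are added in squares.
    refine sum_sq_le_mul (gradNorm_sq _ _) (hessNorm_sq_eq _ _) fun i _ => ?_
    exact l2Norm_le_C2_of_mem_subtriangles hp hn hτ
      (((hu' τ hτ).sub (isH2_smooth τ (hqs τ hτ))).isH1_grad i) (h2 τ hτ i)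

/-! ### The bounds for the constants -/

theorem ennreal_two_mul_le_add_sq (a b : ℝ≥0∞) : 2 * (a * b) ≤ a ^ 2 + b ^ 2 := by
  wlog h : a ≤ b generalizing a b
  · rw [mul_comm a, add_comm]; exact this b a (le_of_not_ge h)
  obtain ⟨d, rfl⟩ := exists_add_of_le h
  calc 2 * (a * (a + d)) ≤ 2 * (a * (a + d)) + d ^ 2 := le_self_add
    _ = _ := by ring

theorem ennreal_add_mul_sq_le (a b x y : ℝ≥0∞) :
    (a * x + b * y) ^ 2 ≤ (a ^ 2 + b ^ 2) * (x ^ 2 + y ^ 2) := by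
  calc (a * x + b * y) ^ 2 = (a * x) ^ 2 + (b * y) ^ 2 + 2 * ((a * y) * (b * x)) := by ring
    _ ≤ (a * x) ^ 2 + (b * y) ^ 2 + ((a * y) ^ 2 + (b * x) ^ 2) :=
      add_le_add le_rfl (ennreal_two_mul_le_add_sq _ _)
    _ = _ := by ring

/-- Cauchy-Schwarz in ℝ² for DX + KY, where X and Y are the two orthogonal parts of Z. -/
theorem div_le_rpow_half {N N₁ N₂ D K X Y Z : ℝ≥0∞} (hN : N ≤ N₁ + N₂) (h₁ : N₁ ≤ D * X)
    (h₂ : N₂ ≤ K * Y) (hZ : Z ^ 2 = X ^ 2 + Y ^ 2) : N / Z ≤ (D ^ 2 + K ^ 2) ^ (1 / 2 : ℝ) := by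
  refine ENNReal.div_le_of_le_mul ?_
  rw [← sq_le_sq_iff_ennreal, mul_pow, rpow_half_sq, hZ]
  exact (pow_le_pow_left' (hN.trans (add_le_add h₁ h₂)) 2).trans (ennreal_add_mul_sq_le _ _ _ _)

theorem l2Norm_le_add_sub {U : Set Plane} {u w : Plane → ℝ}
    (hu : AEStronglyMeasurable u (volume.restrict U)) (hw : Measurable w) :
    l2Norm U u ≤ l2Norm U w + l2Norm U (fun x => u x - w x) := by
  have h := eLpNorm_add_le hw.aestronglyMeasurable (hu.sub hw.aestronglyMeasurable)
    (p := 2) (by norm_num)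
  rwa [add_sub_cancel] at h

theorem gradNorm_le_add_sub {U : Set Plane} {g w : Fin 2 → Plane → ℝ}
    (hg : ∀ i, AEStronglyMeasurable (g i) (volume.restrict U)) (hw : ∀ i, Measurable (w i)) :
    gradNorm U g ≤ gradNorm U w + gradNorm U (fun i x => g i x - w i x) := by
  have h := ENNReal.Lp_add_le Finset.univ (fun i => l2Norm U (w i))
    (fun i => l2Norm U (fun x => g i x - w i x)) (p := 2) (by norm_num)
  simp only [ENNReal.rpow_two] at h
  refine le_trans ?_ h
  exact ENNReal.rpow_le_rpow (Finset.sum_le_sum fun i _ =>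
    pow_le_pow_left' (l2Norm_le_add_sub (hg i) (hw i)) 2) (by norm_num)

theorem ne_top_of_sq_eq_add {X Y Z : ℝ≥0∞} (h : Z ^ 2 = X ^ 2 + Y ^ 2) (hZ : Z ≠ ⊤) : X ≠ ⊤ :=
  ne_top_of_le_ne_top hZ (sq_le_sq_iff_ennreal.1 (h ▸ le_self_add))

theorem rpow_half_add_eq_top {D K : ℝ≥0∞} (hD : D = ⊤) : (D ^ 2 + K ^ 2) ^ (1 / 2 : ℝ) = ⊤ := by
  rw [hD]; simp

/-- The constant bounds itself: the error on the small triangles is estimated by C₁ again, with the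
gain 1/n. -/
theorem C1_le_rpow {p : Fin 3 → Plane} (hp : AffineIndependent ℝ p) {n : ℕ} (hn : n ≠ 0) :
    C1 p ≤ (C1d p n ^ 2 + ((n : ℝ≥0∞)⁻¹ * C1 p) ^ 2) ^ (1 / 2 : ℝ) := by
  -- A finite discrete constant is needed to turn its quotients into products. An infinite one makes
  -- the claim trivial.
  by_cases hD : C1d p n = ⊤
  · rw [rpow_half_add_eq_top hD]; exact le_top
  refine sSup_le ?_
  rintro r ⟨u, g, hu, hnz, rfl⟩
  obtain ⟨w, Y, hwm, hw, hZ, h1, -⟩ := exists_piecewiseα hp hn hu.1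
  refine div_le_rpow_half (l2Norm_le_add_sub hu.1.memLp.1 hwm) ?_ h1 hZ
  rw [← l2Norm_brokenTri hp hn]
  exact le_mul_of_div_le (le_sSup ⟨u, g, w, hu, hnz, hw, rfl⟩) hD
    (ne_top_of_sq_eq_add hZ (gradNorm_ne_top hu.1.memLp_grad))

theorem C2_le_rpow {p : Fin 3 → Plane} (hp : AffineIndependent ℝ p) {n : ℕ} (hn : n ≠ 0) :
    C2 p ≤ (C2d p n ^ 2 + ((n : ℝ≥0∞)⁻¹ * C2 p) ^ 2) ^ (1 / 2 : ℝ) := by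
  by_cases hD : C2d p n = ⊤
  · rw [rpow_half_add_eq_top hD]; exact le_top
  refine sSup_le ?_
  rintro r ⟨u, g, hu, hnz, rfl⟩
  obtain ⟨w, Y, hwm, hw, hZ, -, h2⟩ := exists_piecewiseα hp hn hu.1
  refine div_le_rpow_half (l2Norm_le_add_sub hu.1.memLp.1 hwm) ?_ h2 hZ
  rw [← l2Norm_brokenTri hp hn]
  exact le_mul_of_div_le (le_sSup ⟨u, g, w, hu, hnz, hw, rfl⟩) hD
    (ne_top_of_sq_eq_add hZ (gradNorm_ne_top hu.1.memLp_grad))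

theorem C3_le_rpow {p : Fin 3 → Plane} (hp : AffineIndependent ℝ p) {n : ℕ} (hn : n ≠ 0) :
    C3 p ≤ (C3d p n ^ 2 + ((n : ℝ≥0∞)⁻¹ ^ 2 * C3 p) ^ 2) ^ (1 / 2 : ℝ) := by
  by_cases hD : C3d p n = ⊤
  · rw [rpow_half_add_eq_top hD]; exact le_top
  refine sSup_le ?_
  rintro r ⟨u, g, h, hu, hnz, rfl⟩
  obtain ⟨w, Y, hwm, hw, hZ, h1, -⟩ := exists_piecewiseβ hp hn hu.1
  refine div_le_rpow_half (l2Norm_le_add_sub hu.1.isH1.memLp.1 hwm) ?_ h1 hZ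
  rw [← l2Norm_brokenTri hp hn]
  exact le_mul_of_div_le (le_sSup ⟨u, g, h, w, hu, hnz, hw, rfl⟩) hD
    (ne_top_of_sq_eq_add hZ (hessNorm_ne_top fun i => (hu.1.isH1_grad i).memLp_grad))

/-- The error term contains C₂ rather than C₄, so this is already the final bound and the finiteness
of C₄ is not needed. -/
theorem C4_le_rpow {p : Fin 3 → Plane} (hp : AffineIndependent ℝ p) {n : ℕ} (hn : n ≠ 0) :
    C4 p ≤ (C4d p n ^ 2 + ((n : ℝ≥0∞)⁻¹ * C2 p) ^ 2) ^ (1 / 2 : ℝ) := by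
  by_cases hD : C4d p n = ⊤
  · rw [rpow_half_add_eq_top hD]; exact le_top
  refine sSup_le ?_
  rintro r ⟨u, g, h, hu, hnz, rfl⟩
  obtain ⟨w, Y, hwm, hw, hZ, -, h2⟩ := exists_piecewiseβ hp hn hu.1
  refine div_le_rpow_half (gradNorm_le_add_sub (fun i => (hu.1.isH1.memLp_grad i).1)
    fun i => measurable_pderiv i w) ?_ h2 hZ
  rw [← gradNorm_brokenTri hp hn]
  exact le_mul_of_div_le (le_sSup ⟨u, g, h, w, hu, hnz, hw, rfl⟩) hD
    (ne_top_of_sq_eq_add hZ (hessNorm_ne_top fun i => (hu.1.isH1_grad i).memLp_grad))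

/-- After squaring, C²(1 - k⁻²) ≤ D². The subtraction is legitimate because C is finite, and it is
carried out in ℝ. The ratio k is n for C₁ and C₂, and n² for C₃. -/
theorem le_sqrt_mul_of_le_rpow_half {C D : ℝ≥0∞} (hC : C ≠ ⊤) {k : ℕ} (hk : 2 ≤ k)
    (h : C ≤ (D ^ 2 + ((k : ℝ≥0∞)⁻¹ * C) ^ 2) ^ (1 / 2 : ℝ)) :
    C ≤ ENNReal.ofReal (√((k : ℝ) ^ 2 / ((k : ℝ) ^ 2 - 1))) * D := by
  have hk' : (2 : ℝ) ≤ k := by exact_mod_cast hk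
  have hk1 : (0 : ℝ) < (k : ℝ) ^ 2 - 1 := by nlinarith
  have hk0 : (0 : ℝ) < k := by linarith
  by_cases hD : D = ⊤
  · rw [hD, ENNReal.mul_top]
    · exact le_top
    · rw [ne_eq, ENNReal.ofReal_eq_zero, not_le]; positivity
  rw [← sq_le_sq_iff_ennreal, rpow_half_sq] at h
  lift C to NNReal using hC
  lift D to NNReal using hD
  have hki : (k : ℝ≥0∞)⁻¹ = ((k : NNReal)⁻¹ : NNReal) := by
    rw [ENNReal.coe_inv (by exact_mod_cast hk0.ne'), ENNReal.coe_natCast]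
  rw [hki] at h
  have h' : (C : ℝ) ^ 2 ≤ (D : ℝ) ^ 2 + ((k : ℝ)⁻¹ * C) ^ 2 := by exact_mod_cast h
  rw [← ENNReal.ofReal_coe_nnreal, ← ENNReal.ofReal_coe_nnreal (p := D), ← ENNReal.ofReal_mul (by positivity)]
  refine ENNReal.ofReal_le_ofReal (abs_le_of_sq_le_sq' ?_ (by positivity)).2
  rw [mul_pow, Real.sq_sqrt (by positivity), div_mul_eq_mul_div, le_div_iff₀ hk1]
  rw [mul_pow] at h'
  field_simp at h'
  linarith

end TriInterp

end

theorem theorem4p1 (p : Fin 3 → TriInterp.Plane) (hp : AffineIndependent ℝ p)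
    (n : ℕ) (hn : 2 ≤ n) :
    TriInterp.C1 p ≤ ENNReal.ofReal (√((n : ℝ) ^ 2 / ((n : ℝ) ^ 2 - 1))) * TriInterp.C1d p n ∧
    TriInterp.C2 p ≤ ENNReal.ofReal (√((n : ℝ) ^ 2 / ((n : ℝ) ^ 2 - 1))) * TriInterp.C2d p n ∧
    TriInterp.C3 p ≤ ENNReal.ofReal (√((n : ℝ) ^ 4 / ((n : ℝ) ^ 4 - 1))) * TriInterp.C3d p n ∧
    TriInterp.C4 p ≤
      (TriInterp.C4d p n ^ 2 + TriInterp.C2 p ^ 2 / (n : ℝ≥0∞) ^ 2) ^ (1 / 2 : ℝ) := by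
  have hn0 : n ≠ 0 := by omega
  refine ⟨TriInterp.le_sqrt_mul_of_le_rpow_half (TriInterp.C1_ne_top hp) hn
      (TriInterp.C1_le_rpow hp hn0),
    TriInterp.le_sqrt_mul_of_le_rpow_half (TriInterp.C2_ne_top hp) hn
      (TriInterp.C2_le_rpow hp hn0), ?_, ?_⟩
  -- The second-order estimate gains n⁻², so absorption with ratio n² produces n⁴/(n⁴ - 1).
  · have h := TriInterp.le_sqrt_mul_of_le_rpow_half (k := n ^ 2) (D := TriInterp.C3d p n)
      (TriInterp.C3_ne_top hp)
      (by nlinarith) (by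
        rw [Nat.cast_pow, ENNReal.inv_pow]
        exact TriInterp.C3_le_rpow hp hn0)
    simpa only [Nat.cast_pow, ← pow_mul] using h
  · have h := TriInterp.C4_le_rpow hp hn0
    rwa [mul_pow, ← ENNReal.inv_pow, mul_comm _ (TriInterp.C2 p ^ 2), ← div_eq_mul_inv] at h
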